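/- Let $d\ge 2$, let $U\subseteq\mathbb R^d$ be a bounded open set, and let $s\in[0,1)$. All functions are real valued. **Function spaces.** For $A\subseteq\mathbb R^d$ open put $\|f\|_{H^s(A)}=\|f\|_{L^2(A)}+[f]_{s,A}$, where $[f]_{0,A}=0$ and $[f]_{s,A}^2=\int_A\int_A\frac{|f(x)-f(y)|^2}{|x-y|^{d+2s}}\,dx\,dy$ for $0<s<1$. Let $H^s(U)$ be the completion of $\{\varphi|_U:\varphi\in C^\infty(\mathbb R^d),\ \|\varphi\|_{H^s(U)}<\infty\}$ in $\|\cdot\|_{H^s(U)}$, and $H^1(U)$ the completion of $\{\varphi|_U:\varphi\in C^\infty(\mathbb R^d),\ \|\varphi\|_{L^2(U)}+\|\nabla\varphi\|_{L^2(U)}<\infty\}$ in the norm $\|\varphi\|_{L^2(U)}+\|\nabla\varphi\|_{L^2(U)}$; let $H^s_0(U)$ be the completion of $C_c^\infty(U)$ in $\|\cdot\|_{H^s(\mathbb R^d)}$, and $H^1_0(U)$ that of $C_c^\infty(U)$ in $\|\varphi\|_{L^2}+\|\nabla\varphi\|_{L^2}$. All of them are regarded as subspaces of $L^2(U)$. A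 bounded symmetric form $\mathcal Z$ on $V\in\{H^s_0(U),H^s(U)\}$ is a symmetric bilinear map $V\times V\to\mathbb R$ with $|||\mathcal Z|||_V:=\sup\{|\mathcal Z(v,v)|:\|v\|_V=1\}<\infty$. $U$ is called a Lipschitz domain if for each $y\in\partial U$ there is an $r>0$ such that, in suitably rotated orthonormal coordinates, $U\cap B(y,r)$ is the set of points of $B(y,r)$ that lie strictly above the graph of a Lipschitz function of the first $d-1$ coordinates. **The forms.** Let $W\in C(\overline U)$. For a bounded symmetric form $\mathcal Z$ on $H^s_0(U)$ (resp. $H^s(U)$, with $U$ Lipschitz) let $\mathcal E^{\mathrm D}_{W,\mathcal Z}$ (resp. $\mathcal E^{\mathrm N}_{W,\mathcal Z}$) be the symmetric form on $L^2(U)$ with domain $e^WH^1_0(U)$ (resp. $e^WH^1(U)$) and $$\mathcal E_{W,\mathcal Z}(e^Wu^\flat,e^Wu^\flat)=\int_U e^{2W}|\nabla u^\flat|^2\,dx+\mathcal Z(u^\flat,u^\flat).$$ **Compact convergence.** A symmetric form $\mathcal Q$ with domain $\mathcal D(\mathcal Q)$ in a real Hilbert space $H$ is $M$-bounded from below if $\mathcal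 Q(u,u)+M\|u\|^2\ge0$ on $\mathcal D(\mathcal Q)$, and closed if $\mathcal D(\mathcal Q)$ is dense and is, for some $M>0$, a Hilbert space under $\mathcal Q+M\langle\cdot,\cdot\rangle$. Put $\mathcal Q(u,u)=\infty$ for $u\notin\mathcal D(\mathcal Q)$. A sequence $(\mathcal Q_n)$ converges compactly to $\mathcal Q$ if there is an $M>0$ such that all $\mathcal Q_n$ and $\mathcal Q$ are closed and $M$-bounded from below, and 1. ($\Gamma$-convergence) $u_n\to u$ in $H$ implies $\mathcal Q(u,u)\le\liminf_n\mathcal Q_n(u_n,u_n)$, and for each $u\in\mathcal D(\mathcal Q)$ there are $u_n\to u$ in $H$ with $\mathcal Q_n(u_n,u_n)\to\mathcal Q(u,u)$; 2. (compactness) every sequence $(u_n)$ in $H$ with $\sup_n\big(\mathcal Q_n(u_n,u_n)+(M+1)\|u_n\|^2\big)<\infty$ is precompact in $H$. **Theorem.** Let $W_n,W\in C(\overline U)$ with $W_n\to W$ uniformly on $\overline U$. * One has $H^1_0(U)\subseteq H^s_0(U)$, and if $\mathcal Z_n,\mathcal Z$ are bounded symmetric forms on $H^s_0(U)$ with $|||\mathcal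 Z_n-\mathcal Z|||_{H^s_0(U)}\to0$, then $\mathcal E^{\mathrm D}_{W_n,\mathcal Z_n}$ converges compactly to $\mathcal E^{\mathrm D}_{W,\mathcal Z}$ in $L^2(U)$. * If $U$ is a bounded Lipschitz domain, then $H^1(U)\subseteq H^s(U)$, and if $\mathcal Z_n,\mathcal Z$ are bounded symmetric forms on $H^s(U)$ with $|||\mathcal Z_n-\mathcal Z|||_{H^s(U)}\to0$, then $\mathcal E^{\mathrm N}_{W_n,\mathcal Z_n}$ converges compactly to $\mathcal E^{\mathrm N}_{W,\mathcal Z}$ in $L^2(U)$. -/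

import Mathlib

open MeasureTheory Filter Topology TopologicalSpace
open scoped ENNReal ContDiff

noncomputable section

namespace SymFormConv

/-! ### Symmetric forms on a real Hilbert space and their compact convergence -/

/-- A symmetric bilinear form on a linear subspace `domain` of `H`. Density of the domain is part
of `SymmForm.IsClosed` below. -/
structure SymmForm (H : Type*) [NormedAddCommGroup H] [InnerProductSpace ℝ H] where
  domain : Submodule ℝ H
  bilin : domain →ₗ[ℝ] domain →ₗ[ℝ] ℝ
  symm : ∀ u v, bilin u v = bilin v u

section Forms

variable {H : Type*} [NormedAddCommGroup H] [InnerProductSpace ℝ H]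

open Classical in
/-- The diagonal value `Q(u, u)`, with the convention `Q(u, u) = ∞` for `u ∉ D(Q)`. -/
def SymmForm.val (Q : SymmForm H) (u : H) : EReal :=
  if h : u ∈ Q.domain then ((Q.bilin ⟨u, h⟩ ⟨u, h⟩ : ℝ) : EReal) else ⊤

/-- The shifted form `Q(u, u) + M ‖u‖²` on `D(Q)`. -/
def SymmForm.shifted (Q : SymmForm H) (M : ℝ) (u : Q.domain) : ℝ :=
  Q.bilin u u + M * ‖(u : H)‖ ^ 2

/-- `Q` is `M`-bounded from below. -/
def SymmForm.BoundedBelow (Q : SymmForm H) (M : ℝ) : Prop :=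
  ∀ u : Q.domain, 0 ≤ Q.shifted M u

/-- `Q` is densely defined and, for some `M > 0`, the space `D(Q)` with the bilinear form
`Q + M⟨·,·⟩` is a Hilbert space: the form is positive definite and `D(Q)` is complete for the
norm that it induces. -/
def SymmForm.IsClosed (Q : SymmForm H) : Prop :=
  Dense (Q.domain : Set H) ∧
  ∃ M : ℝ, 0 < M ∧ (∀ u : Q.domain, u ≠ 0 → 0 < Q.shifted M u) ∧
    ∀ u : ℕ → Q.domain,
      (∀ ε : ℝ, 0 < ε → ∃ N : ℕ, ∀ m ≥ N, ∀ n ≥ N, Q.shifted M (u m - u n) < ε) →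
      ∃ v : Q.domain, Tendsto (fun n => Q.shifted M (u n - v)) atTop (𝓝 0)

/-- `Γ`-convergence of forms. -/
def GammaConverges (Qn : ℕ → SymmForm H) (Q : SymmForm H) : Prop :=
  (∀ (u : ℕ → H) (v : H), Tendsto u atTop (𝓝 v) →
    Q.val v ≤ liminf (fun n => (Qn n).val (u n)) atTop) ∧
  (∀ v ∈ Q.domain, ∃ u : ℕ → H, Tendsto u atTop (𝓝 v) ∧
    Tendsto (fun n => (Qn n).val (u n)) atTop (𝓝 (Q.val v)))

/-- Compactness of a sequence of forms that are `M`-bounded from below: if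
`sup_n Q_n(u_n, u_n) + (M + 1) ‖u_n‖² < ∞`, then `(u_n)` is precompact (so that each of its
subsequences has a convergent subsequence). -/
def CompactSequence (M : ℝ) (Qn : ℕ → SymmForm H) : Prop :=
  ∀ u : ℕ → H,
    (⨆ n, ((Qn n).val (u n) + (((M + 1) * ‖u n‖ ^ 2 : ℝ) : EReal))) < ⊤ →
    IsCompact (closure (Set.range u))

/-- Compact convergence of closed forms with a common lower bound `-M`. -/
def ConvergesCompactly (Qn : ℕ → SymmForm H) (Q : SymmForm H) : Prop :=
  ∃ M : ℝ, 0 < M ∧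
    (∀ n, (Qn n).IsClosed ∧ (Qn n).BoundedBelow M) ∧ Q.IsClosed ∧ Q.BoundedBelow M ∧
    GammaConverges Qn Q ∧ CompactSequence M Qn

end Forms

/-! ### Function spaces -/

abbrev E (d : ℕ) := EuclideanSpace ℝ (Fin d)

variable {d : ℕ}

abbrev L2 (U : Opens (E d)) := Lp ℝ 2 (volume.restrict (U : Set (E d)))

/-- Square integrable vector fields on `U`. -/
abbrev L2Vec (U : Opens (E d)) := Lp (E d) 2 (volume.restrict (U : Set (E d)))

/-- `C^∞(ℝ^d)`; the restrictions of its elements to the closure of `U` are `C^∞` up to the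
boundary. -/
def smoothFns (d : ℕ) : Set (E d → ℝ) := {φ | ContDiff ℝ ∞ φ}

/-- `C_c^∞(U)`, extended by zero to `ℝ^d`. -/
def testFns (U : Opens (E d)) : Set (E d → ℝ) :=
  {φ | ContDiff ℝ ∞ φ ∧ HasCompactSupport φ ∧ tsupport φ ⊆ (U : Set (E d))}

/-- A Lipschitz domain: near each boundary point `y`, after a rotation of the coordinate axes that
makes the unit vector `e` the last one, `U` is the set above the graph of a Lipschitz function
`γ` of the remaining coordinates `x - ⟨e, x⟩ e`. -/
def IsLipschitzDomain (U : Set (E d)) : Prop :=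
  ∀ y ∈ frontier U, ∃ r : ℝ, 0 < r ∧ ∃ e : E d, ‖e‖ = 1 ∧
    ∃ (K : NNReal) (γ : E d → ℝ), LipschitzWith K γ ∧
      U ∩ Metric.ball y r =
        {x | x ∈ Metric.ball y r ∧ γ (x - inner ℝ e x • e) < inner ℝ e x}

/-- The closure in `L²(U) × L²(U; ℝ^d)` of `{(φ, ∇φ) : φ ∈ T}`, i.e. the completion of (the
elements of finite norm of) `T` in the norm of `H¹(U)`. The set inside `span` is a linear subspace
already if `T` is one. -/
def H1Graph (T : Set (E d → ℝ)) (U : Opens (E d)) : Submodule ℝ (L2 U × L2Vec U) :=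
  (Submodule.span ℝ {p : L2 U × L2Vec U | ∃ φ ∈ T,
    p.1 =ᵐ[volume.restrict (U : Set (E d))] φ ∧
    p.2 =ᵐ[volume.restrict (U : Set (E d))] gradient φ}).topologicalClosure

/-- The gradient is closable, so `gradOp` is well defined. -/
lemma H1Graph_snd_eq_zero (T : Set (E d → ℝ)) (hT : T ⊆ smoothFns d) (U : Opens (E d)) :
    ∀ p ∈ H1Graph T U, p.1 = 0 → p.2 = 0 := by
  -- pairing with a test function
  have key : ∀ (ψ : E d → ℝ), ψ ∈ testFns U → ∀ v : E d, ∀ p ∈ H1Graph T U,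
      (∫ x in (U : Set (E d)), fderiv ℝ ψ x v * p.1 x)
        + (∫ x in (U : Set (E d)), ψ x * inner ℝ v (p.2 x)) = 0 := by
    intro ψ hψ v
    obtain ⟨hs, hcs, hsub⟩ := hψ
    have hdc : Continuous fun x => fderiv ℝ ψ x v :=
      (hs.continuous_fderiv (by simp)).clm_apply continuous_const
    have hdcs : HasCompactSupport fun x => fderiv ℝ ψ x v := hcs.fderiv_apply (𝕜 := ℝ) v
    have ha : MemLp (fun x => fderiv ℝ ψ x v) 2 (volume.restrict (U : Set (E d))) :=
      hdc.memLp_of_hasCompactSupport hdcs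
    have hvcs : HasCompactSupport fun x => ψ x • v := hcs.smul_right
    have hb : MemLp (fun x => ψ x • v) 2 (volume.restrict (U : Set (E d))) :=
      (hs.continuous.smul continuous_const).memLp_of_hasCompactSupport hvcs
    let L : L2 U × L2Vec U →L[ℝ] ℝ :=
      (innerSL ℝ (ha.toLp _)).comp (ContinuousLinearMap.fst ℝ _ _) +
      (innerSL ℝ (hb.toLp _)).comp (ContinuousLinearMap.snd ℝ _ _)
    have hL : ∀ p, L p = (∫ x in (U : Set (E d)), fderiv ℝ ψ x v * p.1 x)
        + (∫ x in (U : Set (E d)), ψ x * inner ℝ v (p.2 x)) := by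
      intro p
      simp only [L, _root_.add_apply, ContinuousLinearMap.comp_apply,
        ContinuousLinearMap.coe_fst', ContinuousLinearMap.coe_snd', innerSL_apply_apply,
        L2.inner_def]
      congr 1
      · apply integral_congr_ae
        filter_upwards [ha.coeFn_toLp] with x hx
        rw [hx]; simp [mul_comm]
      · apply integral_congr_ae
        filter_upwards [hb.coeFn_toLp] with x hx
        rw [hx, real_inner_smul_left]
    suffices h : H1Graph T U ≤ LinearMap.ker (L : L2 U × L2Vec U →ₗ[ℝ] ℝ) by
      intro p hp
      rw [← hL]
      exact h hp
    refine Submodule.topologicalClosure_minimal _ ?_ L.isClosed_ker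
    rw [Submodule.span_le]
    rintro p ⟨φ, hφT, h1, h2⟩
    have hφ : ContDiff ℝ ∞ φ := hT hφT
    change L p = 0
    rw [hL]
    have e1 : ∫ x in (U : Set (E d)), fderiv ℝ ψ x v * p.1 x = ∫ x, φ x * fderiv ℝ ψ x v := by
      symm
      rw [← setIntegral_eq_integral_of_forall_compl_eq_zero (s := (U : Set (E d)))]
      · apply integral_congr_ae
        filter_upwards [h1] with x hx
        rw [hx, mul_comm]
      · intro x hx
        have : fderiv ℝ ψ x = 0 := by
          by_contra hne
          exact hx (hsub (support_fderiv_subset ℝ hne))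
        simp [this]
    have e2 : ∫ x in (U : Set (E d)), ψ x * inner ℝ v (p.2 x) = ∫ x, fderiv ℝ φ x v * ψ x := by
      symm
      rw [← setIntegral_eq_integral_of_forall_compl_eq_zero (s := (U : Set (E d)))]
      · apply integral_congr_ae
        filter_upwards [h2] with x hx
        rw [hx, mul_comm, real_inner_comm, gradient, InnerProductSpace.toDual_symm_apply]
      · intro x hx
        have : ψ x = 0 := by
          by_contra hne
          exact hx (hsub (subset_tsupport _ hne))
        simp [this]
    have hφc : Continuous fun x => fderiv ℝ φ x v :=
      (hφ.continuous_fderiv (by simp)).clm_apply continuous_const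
    rw [e1, e2, integral_mul_fderiv_eq_neg_fderiv_mul_of_integrable, neg_add_cancel]
    · exact (hφc.mul hs.continuous).integrable_of_hasCompactSupport hcs.mul_left
    · exact (hφ.continuous.mul hdc).integrable_of_hasCompactSupport hdcs.mul_left
    · exact (hφ.continuous.mul hs.continuous).integrable_of_hasCompactSupport hcs.mul_left
    · exact fun x _ => hφ.differentiable (by simp) x
    · exact fun x _ => hs.differentiable (by simp) x
  intro p hp hp1
  have hloc : LocallyIntegrableOn p.2 (U : Set (E d)) volume := by
    rw [locallyIntegrableOn_iff U.isOpen.isLocallyClosed]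
    intro k hk hkc
    have h : MemLp p.2 2 (volume.restrict k) :=
      (Lp.memLp p.2).mono_measure (Measure.restrict_mono hk le_rfl)
    have : IsFiniteMeasure (volume.restrict k) :=
      ⟨by rw [Measure.restrict_apply_univ]; exact hkc.measure_lt_top⟩
    exact h.integrable (by norm_num)
  have hz : ∀ᵐ x ∂volume, x ∈ (U : Set (E d)) → p.2 x = 0 := by
    refine U.isOpen.ae_eq_zero_of_integral_contDiff_smul_eq_zero hloc ?_
    intro ψ h1 h2 h3
    have hint : Integrable (fun x => ψ x • p.2 x) (volume.restrict (U : Set (E d))) := by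
      have hψ : MemLp ψ 2 (volume.restrict (U : Set (E d))) :=
        h1.continuous.memLp_of_hasCompactSupport h2
      exact memLp_one_iff_integrable.1 ((Lp.memLp p.2).smul hψ)
    rw [← setIntegral_eq_integral_of_forall_compl_eq_zero (s := (U : Set (E d)))]
    · refine ext_inner_left ℝ fun v => ?_
      rw [inner_zero_right, ← integral_inner hint]
      have h := key ψ ⟨h1, h2, h3⟩ v p hp
      have h0 : ∫ x in (U : Set (E d)), fderiv ℝ ψ x v * p.1 x = 0 := by
        rw [hp1, integral_congr_ae (g := fun _ => (0 : ℝ)), integral_zero]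
        filter_upwards [Lp.coeFn_zero ℝ 2 (volume.restrict (U : Set (E d)))] with x hx
        rw [hx, Pi.zero_apply, mul_zero]
      rw [h0, zero_add] at h
      rw [← h]
      refine integral_congr_ae (Eventually.of_forall fun x => ?_)
      simp only [real_inner_smul_right]
    · intro x hx
      have : ψ x = 0 := by
        by_contra hne
        exact hx (h3 (subset_tsupport _ hne))
      simp [this]
  rw [Lp.eq_zero_iff_ae_eq_zero]
  exact (ae_restrict_iff' U.isOpen.measurableSet).2 hz

/-- The gradient as a linear operator on `L²(U)`: the closure of `φ ↦ ∇φ`, `φ ∈ T`. It is well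
defined by `H1Graph_snd_eq_zero`. -/
def gradOp (T : Set (E d → ℝ)) (U : Opens (E d)) : L2 U →ₗ.[ℝ] L2Vec U :=
  (H1Graph T U).toLinearPMap

/-- `H¹(U)`, the completion of `C^∞` up to the boundary, as a subspace of `L²(U)`. -/
def H1 (U : Opens (E d)) : Submodule ℝ (L2 U) := (gradOp (smoothFns d) U).domain

/-- `H¹₀(U)`, the completion of `C_c^∞(U)`, as a subspace of `L²(U)`. -/
def H10 (U : Opens (E d)) : Submodule ℝ (L2 U) := (gradOp (testFns U) U).domain

/-- The quotient `(f(x) - f(y)) / |x - y|^(d/2 + s)`, whose norm in `L²(A × A)` is the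
Slobodeckij seminorm `(∫_A ∫_A |f(x) - f(y)|² / |x - y|^(d + 2s) dx dy)^(1/2)` for `0 < s < 1`;
it is `0` by convention for `s = 0`. -/
def sloboQuot (s : ℝ) (f : E d → ℝ) (p : E d × E d) : ℝ :=
  if s = 0 then 0 else (f p.1 - f p.2) / ‖p.1 - p.2‖ ^ ((d : ℝ) / 2 + s)

/-- Lebesgue measure on `A × A`. -/
abbrev sqMeasure (A : Set (E d)) : Measure (E d × E d) :=
  (volume.restrict A).prod (volume.restrict A)

/-- The norm of `H^s(A)`, `0 ≤ s < 1`: the `L²(A)` norm plus the Slobodeckij seminorm. -/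
def sobNorm (s : ℝ) (A : Set (E d)) (f : E d → ℝ) : ℝ≥0∞ :=
  eLpNorm f 2 (volume.restrict A) + eLpNorm (sloboQuot s f) 2 (sqMeasure A)

/-- The closure in `L²(U) × L²(A × A)` of the pairs (`φ`, Slobodeckij quotient of `φ`), `φ ∈ T`:
the completion of (the elements of finite norm of) `T` in the norm of `H^s(A)`. -/
def HsGraph (s : ℝ) (T : Set (E d → ℝ)) (U : Opens (E d)) (A : Set (E d)) :
    Submodule ℝ (L2 U × Lp ℝ 2 (sqMeasure A)) :=
  (Submodule.span ℝ {p : L2 U × Lp ℝ 2 (sqMeasure A) | ∃ φ ∈ T,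
    p.1 =ᵐ[volume.restrict (U : Set (E d))] φ ∧
    p.2 =ᵐ[sqMeasure A] sloboQuot s φ}).topologicalClosure

/-- `H^s(U)`, `0 ≤ s < 1`, as a subspace of `L²(U)`. -/
def Hs (s : ℝ) (U : Opens (E d)) : Submodule ℝ (L2 U) :=
  (HsGraph s (smoothFns d) U (U : Set (E d))).map (LinearMap.fst ℝ _ _)

/-- The norm of `H^s(U)`. -/
def HsNorm (s : ℝ) (U : Opens (E d)) (f : L2 U) : ℝ≥0∞ := sobNorm s (U : Set (E d)) f

/-- `H^s₀(U)`, `0 ≤ s < 1`, the completion of `C_c^∞(U)` in the norm of `H^s(ℝ^d)`, as a subspace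
of `L²(U)`. -/
def Hs0 (s : ℝ) (U : Opens (E d)) : Submodule ℝ (L2 U) :=
  (HsGraph s (testFns U) U Set.univ).map (LinearMap.fst ℝ _ _)

/-- The norm of `H^s₀(U)`: the `H^s(ℝ^d)` norm of the extension by zero. -/
def Hs0Norm (s : ℝ) (U : Opens (E d)) (f : L2 U) : ℝ≥0∞ :=
  sobNorm s Set.univ ((U : Set (E d)).indicator f)

/-! ### Bounded symmetric forms on `H^s(U)` and `H^s₀(U)` -/

/-- The form norm `sup {|B(u, u)| : N(u) = 1}` for the norm `N`. -/
def formNorm {U : Opens (E d)} {V : Submodule ℝ (L2 U)} (N : L2 U → ℝ≥0∞)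
    (B : V →ₗ[ℝ] V →ₗ[ℝ] ℝ) : ℝ≥0∞ :=
  ⨆ (u : V) (_ : N u = 1), ‖B u u‖ₑ

/-- A bounded symmetric form on the space `V` with norm `N`. -/
structure BoundedSymmForm {U : Opens (E d)} (V : Submodule ℝ (L2 U)) (N : L2 U → ℝ≥0∞) where
  bilin : V →ₗ[ℝ] V →ₗ[ℝ] ℝ
  symm : ∀ u v, bilin u v = bilin v u
  bounded : formNorm N bilin < ⊤

/-! ### The forms `E_{W,Z}` -/

section MulExp

variable {U : Opens (E d)}

lemma exp_bound {W : E d → ℝ} (hW : MemLp W ∞ (volume.restrict (U : Set (E d)))) :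
    AEStronglyMeasurable (fun x => Real.exp (W x)) (volume.restrict (U : Set (E d))) ∧
    ∃ C : ℝ, ∀ᵐ x ∂(volume.restrict (U : Set (E d))), ‖Real.exp (W x)‖ ≤ C := by
  refine ⟨Real.continuous_exp.comp_aestronglyMeasurable hW.1, ?_⟩
  refine ⟨Real.exp (eLpNorm W ∞ (volume.restrict (U : Set (E d)))).toReal, ?_⟩
  have h := ae_le_eLpNormEssSup (f := W) (μ := volume.restrict (U : Set (E d)))
  filter_upwards [h] with x hx
  rw [Real.norm_eq_abs, abs_of_pos (Real.exp_pos _)]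
  apply Real.exp_le_exp.2
  have h2 : ‖W x‖ ≤ (eLpNorm W ∞ (volume.restrict (U : Set (E d)))).toReal := by
    rw [eLpNorm_exponent_top, ← toReal_enorm]
    refine ENNReal.toReal_mono ?_ hx
    have := hW.2.ne
    rwa [eLpNorm_exponent_top] at this
  exact (le_abs_self _).trans h2

lemma memLp_exp_mul {W : E d → ℝ} (hW : MemLp W ∞ (volume.restrict (U : Set (E d))))
    (u : L2 U) :
    MemLp (fun x => Real.exp (W x) * u x) 2 (volume.restrict (U : Set (E d))) := by
  obtain ⟨hm, C, hC⟩ := exp_bound hW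
  refine MemLp.of_le_mul (c := C) (Lp.memLp u) (hm.mul (Lp.aestronglyMeasurable u)) ?_
  filter_upwards [hC] with x hx
  rw [norm_mul]
  exact mul_le_mul_of_nonneg_right hx (norm_nonneg _)

/-- Multiplication by `e^W` on `L²(U)`. -/
def mulExp (W : E d → ℝ) (hW : MemLp W ∞ (volume.restrict (U : Set (E d)))) :
    L2 U →ₗ[ℝ] L2 U where
  toFun u := (memLp_exp_mul hW u).toLp _
  map_add' u v := by
    rw [← MemLp.toLp_add]
    apply MemLp.toLp_congr
    filter_upwards [Lp.coeFn_add u v] with x hx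
    simp only [hx, Pi.add_apply]
    ring
  map_smul' c u := by
    rw [RingHom.id_apply, ← MemLp.toLp_const_smul]
    apply MemLp.toLp_congr
    filter_upwards [Lp.coeFn_smul c u] with x hx
    simp only [hx, Pi.smul_apply, smul_eq_mul]
    ring

lemma integrable_energy {W : E d → ℝ} (hW : MemLp W ∞ (volume.restrict (U : Set (E d))))
    (g h : L2Vec U) :
    Integrable (fun x => Real.exp (2 * W x) * inner ℝ (g x) (h x))
      (volume.restrict (U : Set (E d))) := by
  obtain ⟨hm, C, hC⟩ := exp_bound (W := fun x => 2 * W x) (hW.const_mul 2)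
  exact (L2.integrable_inner (𝕜 := ℝ) g h).bdd_mul hm hC

/-- `(g, h) ↦ ∫_U e^{2W} g · h`. -/
def energy (W : E d → ℝ) (hW : MemLp W ∞ (volume.restrict (U : Set (E d)))) :
    L2Vec U →ₗ[ℝ] L2Vec U →ₗ[ℝ] ℝ :=
  LinearMap.mk₂ ℝ
    (fun g h => ∫ x in (U : Set (E d)), Real.exp (2 * W x) * inner ℝ (g x) (h x))
    (fun g g' h => by
      rw [← integral_add (integrable_energy hW g h) (integrable_energy hW g' h)]
      apply integral_congr_ae
      filter_upwards [Lp.coeFn_add g g'] with x hx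
      simp only [hx, Pi.add_apply, inner_add_left]
      ring)
    (fun c g h => by
      rw [smul_eq_mul, ← integral_const_mul]
      apply integral_congr_ae
      filter_upwards [Lp.coeFn_smul c g] with x hx
      simp only [hx, Pi.smul_apply, real_inner_smul_left]
      ring)
    (fun g h h' => by
      rw [← integral_add (integrable_energy hW g h) (integrable_energy hW g h')]
      apply integral_congr_ae
      filter_upwards [Lp.coeFn_add h h'] with x hx
      simp only [hx, Pi.add_apply, inner_add_right]
      ring)
    (fun c g h => by
      rw [smul_eq_mul, ← integral_const_mul]
      apply integral_congr_ae
      filter_upwards [Lp.coeFn_smul c h] with x hx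
      simp only [hx, Pi.smul_apply, real_inner_smul_right]
      ring)

lemma energy_symm (W : E d → ℝ) (hW : MemLp W ∞ (volume.restrict (U : Set (E d))))
    (g h : L2Vec U) : energy W hW g h = energy W hW h g := by
  simp only [energy, LinearMap.mk₂_apply]
  refine integral_congr_ae (Eventually.of_forall fun x => ?_)
  simp only [real_inner_comm]

end MulExp

section ExpForm

variable {U : Opens (E d)} (T : Set (E d → ℝ)) (V : Submodule ℝ (L2 U)) (W : E d → ℝ)
  (hW : MemLp W ∞ (volume.restrict (U : Set (E d))))

/-- The set `e^W (H ∩ V)`, where `H` is the domain of the gradient: all `u` such that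
`u♭ = e^{-W} u` lies in `H ∩ V`. -/
def expDomain : Submodule ℝ (L2 U) :=
  ((gradOp T U).domain ⊓ V).comap (mulExp (-W) hW.neg)

/-- `u ↦ u♭ = e^{-W} u` as an element of `V`. -/
def flat : expDomain T V W hW →ₗ[ℝ] V :=
  ((mulExp (-W) hW.neg).domRestrict (expDomain T V W hW)).codRestrict V (fun u => u.2.2)

/-- `u ↦ ∇u♭`. -/
def flatGrad : expDomain T V W hW →ₗ[ℝ] L2Vec U :=
  (gradOp T U).toFun ∘ₗ
    ((mulExp (-W) hW.neg).domRestrict (expDomain T V W hW)).codRestrict (gradOp T U).domain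
      (fun u => u.2.1)

/-- `E_{W,Z}(u, v) = ∫_U e^{2W} ∇u♭ · ∇v♭ + Z(u♭, v♭)` with `u♭ = e^{-W} u`. -/
def expBilin {V : Submodule ℝ (L2 U)} (Z : V →ₗ[ℝ] V →ₗ[ℝ] ℝ) :
    expDomain T V W hW →ₗ[ℝ] expDomain T V W hW →ₗ[ℝ] ℝ :=
  (energy W hW).compl₁₂ (flatGrad T V W hW) (flatGrad T V W hW) +
    Z.compl₁₂ (flat T V W hW) (flat T V W hW)

lemma expBilin_apply {V : Submodule ℝ (L2 U)} (Z : V →ₗ[ℝ] V →ₗ[ℝ] ℝ)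
    (u v : expDomain T V W hW) :
    expBilin T W hW Z u v = energy W hW (flatGrad T V W hW u) (flatGrad T V W hW v) +
      Z (flat T V W hW u) (flat T V W hW v) := rfl

/-- The symmetric form `E_{W,Z}` on the set of all `u` such that `u♭ = e^{-W} u` lies in the
domain of the gradient and in the space `V` on which `Z` is defined. -/
def expForm {V : Submodule ℝ (L2 U)} {N : L2 U → ℝ≥0∞} (Z : BoundedSymmForm V N) :
    SymmForm (L2 U) where
  domain := expDomain T V W hW
  bilin := expBilin T W hW Z.bilin
  symm u v := by
    rw [expBilin_apply, expBilin_apply, energy_symm, Z.symm]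

end ExpForm

/-- `E^D_{W,Z}`, for a bounded symmetric form `Z` on `H^s₀(U)`. Its domain is
`e^W (H¹₀(U) ∩ H^s₀(U))`, which is `e^W H¹₀(U)` because `H¹₀(U) ⊆ H^s₀(U)`. -/
def dirichletForm {U : Opens (E d)} {s : ℝ} (W : E d → ℝ)
    (hW : MemLp W ∞ (volume.restrict (U : Set (E d))))
    (Z : BoundedSymmForm (Hs0 s U) (Hs0Norm s U)) : SymmForm (L2 U) :=
  expForm (testFns U) W hW Z

/-- `E^N_{W,Z}`, for a bounded symmetric form `Z` on `H^s(U)`. Its domain is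
`e^W (H¹(U) ∩ H^s(U))`, which is `e^W H¹(U)` as soon as `H¹(U) ⊆ H^s(U)`, in particular for
bounded Lipschitz domains. -/
def neumannForm {U : Opens (E d)} {s : ℝ} (W : E d → ℝ)
    (hW : MemLp W ∞ (volume.restrict (U : Set (E d))))
    (Z : BoundedSymmForm (Hs s U) (HsNorm s U)) : SymmForm (L2 U) :=
  expForm (smoothFns d) W hW Z

/-- A continuous function on the closure of a bounded open set is bounded on that set. -/
lemma memLp_top_of_continuousOn {U : Opens (E d)} (hU : Bornology.IsBounded (U : Set (E d)))
    {W : E d → ℝ} (hW : ContinuousOn W (closure (U : Set (E d)))) :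
    MemLp W ∞ (volume.restrict (U : Set (E d))) := by
  have hc : IsCompact (closure (U : Set (E d))) := hU.isCompact_closure
  obtain ⟨C, hC⟩ := hc.exists_bound_of_continuousOn hW
  refine memLp_top_of_bound
    ((hW.mono subset_closure).aestronglyMeasurable U.isOpen.measurableSet) C ?_
  filter_upwards [ae_restrict_mem U.isOpen.measurableSet] with x hx
  exact hC x (subset_closure hx)

end SymFormConv

end

/-! Writing u = e^W u♭ turns every form in the theorem into a form in the pair (u♭, ∇u♭), which
ranges over one closed subspace `H1Graph T U` independent of n. What varies with n is only a bounded
multiplier and the form Z.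

Two analytic facts carry the proof. The first is interpolation: for every ε there is C with N(f) ≤
ε‖∇f‖ + C‖f‖, where N is the H^s norm. Substituting y = x + h in the Slobodeckij integral, small h
are handled by the translation bound ∫|φ(x+h) − φ(x)|² ≤ C|h|²∫|∇φ|², since |h|^(2−d−2s) is
integrable at 0 for s < 1; large h are handled by the L² norm, since |h|^(−d−2s) is integrable at
infinity for s > 0. This also gives H¹ ⊆ H^s. The second is Rellich's theorem: bounded sets of the
graph norm are totally bounded in L² (`TestSetting.totallyBounded`).

By interpolation Z is bounded relative to the energy with arbitrarily small constant. Hence the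
shifted forms are equivalent to the squared graph norm, with constants depending only on bounds for
|W| and for the norm of Z (`FormSetting.coercive`). This yields closedness, a common lower bound and
bounds on gradients. In the liminf inequality u♭ converges strongly in L² and ∇u♭ weakly; the energy
is weakly lower semicontinuous, and Z is continuous because interpolation upgrades L² convergence to
convergence in N. A recovery sequence keeps u♭ fixed. Compactness is Rellich plus norm convergence
of the multipliers.

`FormSetting` collects what the abstract argument needs, `TestSetting` what its derivation needs.
Dirichlet is T = C_c^∞(U) with A the whole space; Neumann is T = C^∞ with A = U. The Lipschitz
condition enters only through the translation bound and an interior ball condition. -/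

namespace SymFormConv

/-! ### Weak limits in Hilbert spaces. -/

section Weak

variable {K : Type*} [NormedAddCommGroup K] [InnerProductSpace ℝ K] [CompleteSpace K]

/-- Bounded families in a Hilbert space converge weakly along ultrafilters. -/
lemma exists_weak_limit {ι : Type*} (F : Ultrafilter ι) (g : ι → K) (R : ℝ)
    (hg : ∀ᶠ i in (F : Filter ι), ‖g i‖ ≤ R) :
    ∃ g₀ : K, ∀ k : K, Tendsto (fun i => inner ℝ (g i) k) F (𝓝 (inner ℝ g₀ k)) := by
  have hc := WeakDual.isCompact_closedBall (𝕜 := ℝ) (E := K) 0 R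
  let G : ι → WeakDual ℝ K := fun i => StrongDual.toWeakDual (InnerProductSpace.toDual ℝ K (g i))
  have hmem : ∀ᶠ i in (F : Filter ι), G i ∈
      (WeakDual.toStrongDual ⁻¹' Metric.closedBall (0 : StrongDual ℝ K) R : Set (WeakDual ℝ K)) := by
    filter_upwards [hg] with i hi
    rw [Set.mem_preimage, mem_closedBall_zero_iff]
    change ‖InnerProductSpace.toDual ℝ K (g i)‖ ≤ R
    rwa [LinearIsometryEquiv.norm_map]
  -- Banach–Alaoglu; along an ultrafilter no subsequence has to be extracted.
  obtain ⟨y, -, hy⟩ := hc.ultrafilter_le_nhds' (F.map G) hmem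
  refine ⟨(InnerProductSpace.toDual ℝ K).symm (WeakDual.toStrongDual y), fun k => ?_⟩
  have h1 : Tendsto G F (𝓝 y) := hy
  have h2 : Tendsto (fun i => (G i) k) F (𝓝 (y k)) := ((WeakDual.eval_continuous k).tendsto y).comp h1
  rw [InnerProductSpace.toDual_symm_apply]
  exact h2

/-- Closed subspaces of a product are closed under convergence that is strong in the first and
weak in the second factor. -/
lemma mem_of_tendsto_of_weak {H : Type*} [NormedAddCommGroup H] [InnerProductSpace ℝ H]
    {ι : Type*} {F : Filter ι} [F.NeBot] (S : Submodule ℝ (H × K)) (hS : IsClosed (S : Set (H × K)))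
    {p : ι → H × K} (hp : ∀ᶠ i in F, p i ∈ S) {u : H} {g : K}
    (hu : Tendsto (fun i => (p i).1) F (𝓝 u))
    (hg : ∀ k : K, Tendsto (fun i => inner ℝ (p i).2 k) F (𝓝 (inner ℝ g k))) : (u, g) ∈ S := by
  by_contra hn
  obtain ⟨f, a, hfa, hfS⟩ := geometric_hahn_banach_point_closed S.convex hS hn
  -- A functional on the product is a continuous functional of the first coordinate plus the pairing
  -- of the second with its Riesz vector. So it passes to the mixed strong-weak limit, which
  -- contradicts the strict separation.
  have hsplit : ∀ q : H × K, f q = f (q.1, 0) + inner ℝ q.2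
      ((InnerProductSpace.toDual ℝ K).symm (f.comp (ContinuousLinearMap.inr ℝ H K))) := by
    intro q
    rw [real_inner_comm, InnerProductSpace.toDual_symm_apply]
    simp only [ContinuousLinearMap.comp_apply, ContinuousLinearMap.inr_apply]
    rw [← map_add]; simp
  have hlim : Tendsto (fun i => f (p i)) F (𝓝 (f (u, g))) := by
    rw [hsplit (u, g)]
    simp_rw [fun i => hsplit (p i)]
    refine Tendsto.add ?_ (hg _)
    have : Continuous fun w : H => f (w, 0) := by fun_prop
    exact (this.tendsto u).comp hu
  have : a ≤ f (u, g) := ge_of_tendsto hlim (hp.mono fun i hi => (hfS _ hi).le)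
  linarith

end Weak

/-! ### Quadratic bounds from the form norm. -/

section Seminorm

variable {U : Opens (E d)} {V : Submodule ℝ (L2 U)} {N : L2 U → ℝ≥0∞}

/-- This is homogeneity, as `formNorm` tests unit vectors only. Vectors with `N u = 0` cannot be
normalised, and `hzero` disposes of them. -/
lemma abs_apply_self_le (hsmul : ∀ (c : ℝ) u, N (c • u) = ‖c‖ₑ * N u)
    (hzero : ∀ u, N u = 0 → u = 0) (B : V →ₗ[ℝ] V →ₗ[ℝ] ℝ) (hB : formNorm N B < ⊤)
    (u : V) (hu : N u ≠ ⊤) : |B u u| ≤ (formNorm N B).toReal * (N u).toReal ^ 2 := by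
  by_cases h0 : N u = 0
  · have : u = 0 := Subtype.ext (hzero _ h0)
    simp [this]
    positivity
  set r := (N u).toReal with hr
  have hrpos : 0 < r := ENNReal.toReal_pos h0 hu
  have h1 : N ((r⁻¹ • u : V) : L2 U) = 1 := by
    rw [Submodule.coe_smul, hsmul, ← ENNReal.ofReal_toReal hu, ← hr,
      Real.enorm_of_nonneg (by positivity), ← ENNReal.ofReal_mul (by positivity),
      inv_mul_cancel₀ hrpos.ne', ENNReal.ofReal_one]
  have h2 : ‖B (r⁻¹ • u) (r⁻¹ • u)‖ₑ ≤ formNorm N B :=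
    le_iSup₂_of_le (r⁻¹ • u) h1 le_rfl
  have h3 := ENNReal.toReal_mono hB.ne h2
  rw [toReal_enorm, map_smul, map_smul, LinearMap.smul_apply, smul_eq_mul, smul_eq_mul,
    Real.norm_eq_abs, ← mul_assoc, abs_mul, abs_of_pos (by positivity : 0 < r⁻¹ * r⁻¹)] at h3
  calc |B u u| = r ^ 2 * (r⁻¹ * r⁻¹ * |B u u|) := by field_simp
    _ ≤ r ^ 2 * (formNorm N B).toReal := by gcongr
    _ = _ := mul_comm _ _

lemma formNorm_le_add (B B' : V →ₗ[ℝ] V →ₗ[ℝ] ℝ) :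
    formNorm N B ≤ formNorm N B' + formNorm N (B - B') := by
  refine iSup₂_le fun u hu => ?_
  have : B u u = B' u u + (B - B') u u := by simp
  rw [this]
  refine (enorm_add_le _ _).trans (add_le_add ?_ ?_)
  · exact le_iSup₂_of_le (f := fun (u : V) (_ : N u = 1) => ‖B' u u‖ₑ) u hu le_rfl
  · exact le_iSup₂_of_le (f := fun (u : V) (_ : N u = 1) => ‖(B - B') u u‖ₑ) u hu le_rfl

end Seminorm

/-! ### Multiplication by e^W and the weighted energy. -/

section MulExp

variable {U : Opens (E d)}

lemma mulExp_coeFn {W : E d → ℝ} (hW : MemLp W ∞ (volume.restrict (U : Set (E d)))) (u : L2 U) :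
    mulExp W hW u =ᵐ[volume.restrict (U : Set (E d))] fun x => Real.exp (W x) * u x :=
  (memLp_exp_mul hW u).coeFn_toLp

lemma mulExp_neg_mulExp {W : E d → ℝ} (hW : MemLp W ∞ (volume.restrict (U : Set (E d))))
    (u : L2 U) : mulExp (-W) hW.neg (mulExp W hW u) = u := by
  apply Lp.ext
  filter_upwards [mulExp_coeFn hW u, mulExp_coeFn hW.neg (mulExp W hW u)] with x h1 h2
  rw [h2, h1, ← mul_assoc, ← Real.exp_add]
  simp

lemma mulExp_mulExp_neg {W : E d → ℝ} (hW : MemLp W ∞ (volume.restrict (U : Set (E d))))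
    (u : L2 U) : mulExp W hW (mulExp (-W) hW.neg u) = u := by
  apply Lp.ext
  filter_upwards [mulExp_coeFn hW.neg u, mulExp_coeFn hW (mulExp (-W) hW.neg u)] with x h1 h2
  rw [h2, h1, ← mul_assoc, ← Real.exp_add]
  simp

lemma norm_mulExp_le {W : E d → ℝ} (hW : MemLp W ∞ (volume.restrict (U : Set (E d)))) {R : ℝ}
    (hR : ∀ x ∈ U, |W x| ≤ R) (u : L2 U) : ‖mulExp W hW u‖ ≤ Real.exp R * ‖u‖ := by
  apply Lp.norm_le_mul_norm_of_ae_le_mul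
  filter_upwards [mulExp_coeFn hW u, ae_restrict_mem U.isOpen.measurableSet] with x h1 h2
  rw [h1, norm_mul, Real.norm_eq_abs (Real.exp _), Real.abs_exp]
  gcongr
  exact (le_abs_self _).trans (hR x h2)

lemma norm_le_norm_mulExp {W : E d → ℝ} (hW : MemLp W ∞ (volume.restrict (U : Set (E d)))) {R : ℝ}
    (hR : ∀ x ∈ U, |W x| ≤ R) (u : L2 U) : ‖u‖ ≤ Real.exp R * ‖mulExp W hW u‖ := by
  conv_lhs => rw [← mulExp_neg_mulExp hW u]
  exact norm_mulExp_le _ (by simpa using hR) _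

lemma norm_mulExp_sub_le {W W' : E d → ℝ} (hW : MemLp W ∞ (volume.restrict (U : Set (E d))))
    (hW' : MemLp W' ∞ (volume.restrict (U : Set (E d)))) {η : ℝ}
    (hη : ∀ x ∈ U, |Real.exp (W x) - Real.exp (W' x)| ≤ η) (u : L2 U) :
    ‖mulExp W hW u - mulExp W' hW' u‖ ≤ η * ‖u‖ := by
  apply Lp.norm_le_mul_norm_of_ae_le_mul
  filter_upwards [mulExp_coeFn hW u, mulExp_coeFn hW' u, Lp.coeFn_sub (mulExp W hW u)
    (mulExp W' hW' u), ae_restrict_mem U.isOpen.measurableSet] with x h1 h2 h3 h4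
  rw [h3, Pi.sub_apply, h1, h2, ← sub_mul, norm_mul, Real.norm_eq_abs]
  gcongr
  exact hη x h4

/-- Multiplication by `e^W` as a bounded operator. -/
noncomputable def mulExpL (W : E d → ℝ) (hW : MemLp W ∞ (volume.restrict (U : Set (E d)))) (R : ℝ)
    (hR : ∀ x ∈ U, |W x| ≤ R) : L2 U →L[ℝ] L2 U :=
  (mulExp W hW).mkContinuous (Real.exp R) (norm_mulExp_le hW hR)

lemma energy_apply {W : E d → ℝ} (hW : MemLp W ∞ (volume.restrict (U : Set (E d))))
    (g h : L2Vec U) : energy W hW g h =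
      ∫ x in (U : Set (E d)), Real.exp (2 * W x) * inner ℝ (g x) (h x) := rfl

lemma integrable_norm_sq (g : L2Vec U) :
    Integrable (fun x => ‖g x‖ ^ 2) (volume.restrict (U : Set (E d))) := by
  simpa using L2.integrable_inner (𝕜 := ℝ) g g

lemma norm_sq_eq_integral (g : L2Vec U) : ‖g‖ ^ 2 = ∫ x in (U : Set (E d)), ‖g x‖ ^ 2 := by
  rw [← real_inner_self_eq_norm_sq, L2.inner_def]
  simp

lemma energy_self_le {W : E d → ℝ} (hW : MemLp W ∞ (volume.restrict (U : Set (E d)))) {R : ℝ}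
    (hR : ∀ x ∈ U, |W x| ≤ R) (g : L2Vec U) : energy W hW g g ≤ Real.exp (2 * R) * ‖g‖ ^ 2 := by
  rw [energy_apply, norm_sq_eq_integral, ← integral_const_mul]
  refine integral_mono_ae (integrable_energy hW g g) ((integrable_norm_sq g).const_mul _) ?_
  filter_upwards [ae_restrict_mem U.isOpen.measurableSet] with x hx
  simp only [real_inner_self_eq_norm_sq]
  gcongr
  exact (le_abs_self _).trans (hR x hx)

lemma le_energy_self {W : E d → ℝ} (hW : MemLp W ∞ (volume.restrict (U : Set (E d)))) {R : ℝ}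
    (hR : ∀ x ∈ U, |W x| ≤ R) (g : L2Vec U) :
    Real.exp (-(2 * R)) * ‖g‖ ^ 2 ≤ energy W hW g g := by
  rw [energy_apply, norm_sq_eq_integral, ← integral_const_mul]
  refine integral_mono_ae ((integrable_norm_sq g).const_mul _) (integrable_energy hW g g) ?_
  filter_upwards [ae_restrict_mem U.isOpen.measurableSet] with x hx
  simp only [real_inner_self_eq_norm_sq]
  gcongr
  have := (abs_le.1 (hR x hx)).1
  linarith

lemma abs_energy_sub_le {W W' : E d → ℝ} (hW : MemLp W ∞ (volume.restrict (U : Set (E d))))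
    (hW' : MemLp W' ∞ (volume.restrict (U : Set (E d)))) {η : ℝ}
    (hη : ∀ x ∈ U, |Real.exp (2 * W x) - Real.exp (2 * W' x)| ≤ η) (g : L2Vec U) :
    |energy W hW g g - energy W' hW' g g| ≤ η * ‖g‖ ^ 2 := by
  rw [energy_apply, energy_apply, norm_sq_eq_integral, ← integral_const_mul,
    ← integral_sub (integrable_energy hW g g) (integrable_energy hW' g g), ← Real.norm_eq_abs]
  refine norm_integral_le_of_norm_le ((integrable_norm_sq g).const_mul _) ?_
  filter_upwards [ae_restrict_mem U.isOpen.measurableSet] with x hx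
  rw [← sub_mul, norm_mul, Real.norm_eq_abs, real_inner_self_eq_norm_sq, norm_pow, norm_norm]
  gcongr
  exact hη x hx

/-- The energy paired with a fixed field is given by an inner product. -/
lemma exists_energy_eq_inner {W : E d → ℝ} (hW : MemLp W ∞ (volume.restrict (U : Set (E d))))
    (h : L2Vec U) : ∃ h' : L2Vec U, ∀ g, energy W hW g h = inner ℝ g h' := by
  obtain ⟨hm, C, hC⟩ := exp_bound (W := fun x => 2 * W x) (hW.const_mul 2)
  have hmem : MemLp (fun x => Real.exp (2 * W x) • h x) 2 (volume.restrict (U : Set (E d))) := by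
    refine MemLp.of_le_mul (c := C) (Lp.memLp h) (hm.smul (Lp.aestronglyMeasurable h)) ?_
    filter_upwards [hC] with x hx
    rw [norm_smul]
    gcongr
  refine ⟨hmem.toLp, fun g => ?_⟩
  rw [energy_apply, L2.inner_def]
  apply integral_congr_ae
  filter_upwards [hmem.coeFn_toLp] with x hx
  rw [hx, real_inner_smul_right]

end MulExp

/-! ### Uniform convergence of the exponents. -/

section Uniform

variable {X : Type*} {A : Set X} {Wn : ℕ → X → ℝ} {W : X → ℝ}

/-- Factor out e^(kW) and use |e^a − 1| ≤ 2|a| for |a| ≤ 1. The case k = 1 serves the multipliers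
e^W, the case k = 2 the energy weights e^(2W). -/
lemma eventually_abs_exp_sub_le (h : TendstoUniformlyOn Wn W atTop A) {R : ℝ}
    (hR : ∀ x ∈ A, |W x| ≤ R) (k : ℝ) {ε : ℝ} (hε : 0 < ε) :
    ∀ᶠ n in atTop, ∀ x ∈ A, |Real.exp (k * Wn n x) - Real.exp (k * W x)| ≤ ε := by
  rw [Metric.tendstoUniformlyOn_iff] at h
  have hc : Tendsto (fun t : ℝ => Real.exp (|k| * R) * (2 * (|k| * t))) (𝓝[>] 0) (𝓝 0) := by
    have : Continuous fun t : ℝ => Real.exp (|k| * R) * (2 * (|k| * t)) := by fun_prop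
    simpa using (this.tendsto 0).mono_left nhdsWithin_le_nhds
  have hc' : Tendsto (fun t : ℝ => |k| * t) (𝓝[>] 0) (𝓝 0) := by
    have : Continuous fun t : ℝ => |k| * t := by fun_prop
    simpa using (this.tendsto 0).mono_left nhdsWithin_le_nhds
  obtain ⟨t, ⟨ht1, ht2⟩, ht0⟩ := (((hc.eventually_le_const hε).and
    (hc'.eventually_le_const one_pos)).and self_mem_nhdsWithin).exists
  filter_upwards [h t ht0] with n hn x hx
  have h1 : |k * (Wn n x - W x)| ≤ |k| * t := by
    rw [abs_mul]
    gcongr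
    have := hn x hx
    rw [dist_comm, Real.dist_eq] at this
    exact this.le
  have h2 : Real.exp (k * Wn n x) - Real.exp (k * W x)
      = Real.exp (k * W x) * (Real.exp (k * (Wn n x - W x)) - 1) := by
    rw [mul_sub, ← Real.exp_add]; ring_nf
  rw [h2, abs_mul, Real.abs_exp]
  refine le_trans (mul_le_mul (Real.exp_le_exp.2 ?_) ?_ (abs_nonneg _) (Real.exp_pos _).le) ht1
  · calc k * W x ≤ |k * W x| := le_abs_self _
      _ = |k| * |W x| := abs_mul _ _
      _ ≤ _ := by gcongr; exact hR x hx
  · exact (Real.abs_exp_sub_one_le (h1.trans ht2)).trans (by gcongr)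

lemma exists_uniform_bound [TopologicalSpace X] (hA : IsCompact A)
    (hWn : ∀ n, ContinuousOn (Wn n) A) (hW : ContinuousOn W A)
    (h : TendstoUniformlyOn Wn W atTop A) :
    ∃ R : ℝ, 0 ≤ R ∧ (∀ x ∈ A, |W x| ≤ R) ∧ ∀ n, ∀ x ∈ A, |Wn n x| ≤ R := by
  obtain ⟨C, hC⟩ := hA.exists_bound_of_continuousOn hW
  choose D hD using fun n => hA.exists_bound_of_continuousOn (hWn n)
  obtain ⟨m, hm⟩ := eventually_atTop.1 (Metric.tendstoUniformlyOn_iff.1 h 1 one_pos)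
  -- From index `m` on the functions stay within 1 of the limit; the sum takes care of the finitely
  -- many earlier ones.
  refine ⟨|C| + 1 + ∑ i ∈ Finset.range m, |D i|, by positivity, fun x hx => ?_, fun n x hx => ?_⟩
  · have := hC x hx
    rw [Real.norm_eq_abs] at this
    have h2 : 0 ≤ ∑ i ∈ Finset.range m, |D i| := by positivity
    linarith [le_abs_self C]
  · by_cases hn : n < m
    · have h1 := hD n x hx
      rw [Real.norm_eq_abs] at h1
      have h2 := Finset.single_le_sum (f := fun i => |D i|) (fun i _ => abs_nonneg (D i))
        (Finset.mem_range.2 hn)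
      linarith [le_abs_self (D n), abs_nonneg C]
    · have h1 := hm n (not_lt.1 hn) x hx
      rw [Real.dist_eq] at h1
      have h3 := hC x hx
      rw [Real.norm_eq_abs] at h3
      have h2 : 0 ≤ ∑ i ∈ Finset.range m, |D i| := by positivity
      have h4 : |Wn n x| ≤ |W x| + |W x - Wn n x| := by
        have := abs_sub_abs_le_abs_sub (Wn n x) (W x)
        rw [abs_sub_comm] at this
        linarith
      linarith [le_abs_self C]

end Uniform

end SymFormConv

/-! ### Coercivity, closedness and continuity of a single form. -/

namespace SymFormConv

/-- The elementary inequalities behind `FormSetting.coercive`. -/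
lemma coercive_real {R ζ ε K f g P w En Zv : ℝ} (hζ : 0 ≤ ζ)
    (hζε : 2 * ζ * ε ^ 2 ≤ Real.exp (-(2 * R)) / 2) (hf0 : 0 ≤ f) (hg0 : 0 ≤ g)
    (hw0 : 0 ≤ w) (hP : P = max f g) (hu1 : w ≤ Real.exp R * f) (hu2 : f ≤ Real.exp R * w)
    (hE1 : Real.exp (-(2 * R)) * g ^ 2 ≤ En) (hE2 : En ≤ Real.exp (2 * R) * g ^ 2)
    (hZ : |Zv| ≤ ζ * (ε * g + K * f) ^ 2) :
    min (Real.exp (-(2 * R)) / 2) 1 * P ^ 2 ≤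
      En + Zv + Real.exp (2 * R) * (2 * ζ * K ^ 2 + 1) * w ^ 2 ∧
    En + Zv + Real.exp (2 * R) * (2 * ζ * K ^ 2 + 1) * w ^ 2 ≤
      (Real.exp (2 * R) + 2 * ζ * ε ^ 2 + 2 * ζ * K ^ 2 +
        Real.exp (2 * R) * (2 * ζ * K ^ 2 + 1) * Real.exp (2 * R)) * P ^ 2 := by
  -- Here f, g, w are ‖u♭‖, ‖∇u♭‖, ‖u‖, and P is the norm of the pair, a maximum. By `hζε` the
  -- g-part of this bound is absorbed by half of the lower energy bound.
  have hZ' : |Zv| ≤ ζ * (2 * ε ^ 2 * g ^ 2 + 2 * K ^ 2 * f ^ 2) := by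
    refine hZ.trans ?_
    gcongr
    nlinarith [sq_nonneg (ε * g - K * f)]
  have hP1 : P ^ 2 ≤ f ^ 2 + g ^ 2 := by
    rw [hP]
    rcases max_choice f g with h | h <;> rw [h] <;> nlinarith
  have hPf : f ^ 2 ≤ P ^ 2 := by rw [hP]; gcongr; exact le_max_left _ _
  have hPg : g ^ 2 ≤ P ^ 2 := by rw [hP]; gcongr; exact le_max_right _ _
  have hexp : Real.exp R ^ 2 = Real.exp (2 * R) := by rw [← Real.exp_nat_mul]; norm_num
  have hsq1 : w ^ 2 ≤ Real.exp (2 * R) * f ^ 2 := by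
    rw [← hexp, ← mul_pow]; gcongr
  have hsq2 : f ^ 2 ≤ Real.exp (2 * R) * w ^ 2 := by
    rw [← hexp, ← mul_pow]; gcongr
  obtain ⟨hZ1, hZ2⟩ := abs_le.1 hZ'
  constructor
  -- The shift is large enough to cancel the f-part of the bound on Z and to leave a full f² over.
  · have h1 : (2 * ζ * K ^ 2 + 1) * f ^ 2 ≤ Real.exp (2 * R) * (2 * ζ * K ^ 2 + 1) * w ^ 2 := by
      calc _ ≤ (2 * ζ * K ^ 2 + 1) * (Real.exp (2 * R) * w ^ 2) := by gcongr
        _ = _ := by ring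
    calc min (Real.exp (-(2 * R)) / 2) 1 * P ^ 2
        ≤ min (Real.exp (-(2 * R)) / 2) 1 * (f ^ 2 + g ^ 2) := by gcongr
      _ ≤ 1 * f ^ 2 + Real.exp (-(2 * R)) / 2 * g ^ 2 := by
        rw [mul_add]
        gcongr
        · exact min_le_right _ _
        · exact min_le_left _ _
      _ ≤ _ := by nlinarith [mul_le_mul_of_nonneg_right hζε (sq_nonneg g)]
  · have h1 : Real.exp (2 * R) * (2 * ζ * K ^ 2 + 1) * w ^ 2 ≤
        Real.exp (2 * R) * (2 * ζ * K ^ 2 + 1) * Real.exp (2 * R) * P ^ 2 := by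
      rw [mul_assoc _ (Real.exp (2 * R)) (P ^ 2)]
      gcongr
      exact hsq1.trans (by gcongr)
    have h2 : Real.exp (2 * R) * g ^ 2 ≤ Real.exp (2 * R) * P ^ 2 := by gcongr
    have h3 : 2 * ζ * ε ^ 2 * g ^ 2 ≤ 2 * ζ * ε ^ 2 * P ^ 2 := by gcongr
    have h4 : 2 * ζ * K ^ 2 * f ^ 2 ≤ 2 * ζ * K ^ 2 * P ^ 2 := by gcongr
    linarith

section Setting

variable {d : ℕ}

/-- The properties of a gradient (the closure of `φ ↦ ∇φ`, `φ ∈ T`) and of a norm `N` on a space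
`V` of functions on `U` on which the compact convergence of the forms `expForm` depends. -/
structure FormSetting (T : Set (E d → ℝ)) (U : Opens (E d)) (V : Submodule ℝ (L2 U))
    (N : L2 U → ℝ≥0∞) : Prop where
  smooth : T ⊆ smoothFns d
  smul : ∀ (c : ℝ) u, N (c • u) = ‖c‖ₑ * N u
  add_le : ∀ u v, N (u + v) ≤ N u + N v
  eq_zero : ∀ u, N u = 0 → u = 0
  mem : ∀ p ∈ H1Graph T U, p.1 ∈ V
  interp : ∀ ε : ℝ, 0 < ε → ∃ C : ℝ, 0 ≤ C ∧ ∀ p ∈ H1Graph T U,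
    N p.1 ≤ ENNReal.ofReal (ε * ‖p.2‖ + C * ‖p.1‖)
  totallyBounded : ∀ R : ℝ,
    TotallyBounded {u : L2 U | ∃ p ∈ H1Graph T U, p.1 = u ∧ ‖p.1‖ ≤ R ∧ ‖p.2‖ ≤ R}
  dense : Dense ((gradOp T U).domain : Set (L2 U))

variable {T : Set (E d → ℝ)} {U : Opens (E d)} {V : Submodule ℝ (L2 U)} {N : L2 U → ℝ≥0∞}

lemma isClosed_H1Graph (T : Set (E d → ℝ)) (U : Opens (E d)) :
    IsClosed (H1Graph T U : Set (L2 U × L2Vec U)) :=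
  Submodule.isClosed_topologicalClosure _

lemma mem_domain_of_mem_H1Graph {p : L2 U × L2Vec U} (hp : p ∈ H1Graph T U) :
    p.1 ∈ (gradOp T U).domain :=
  Submodule.mem_map.2 ⟨p, hp, rfl⟩

lemma gradOp_mem_H1Graph (hT : T ⊆ smoothFns d) (x : (gradOp T U).domain) :
    ((x : L2 U), gradOp T U x) ∈ H1Graph T U :=
  Submodule.mem_graph_toLinearPMap (fun p hp h => H1Graph_snd_eq_zero T hT U p hp h) x

lemma H1Graph_snd_unique (hT : T ⊆ smoothFns d) {p q : L2 U × L2Vec U} (hp : p ∈ H1Graph T U)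
    (hq : q ∈ H1Graph T U) (h : p.1 = q.1) : p = q := by
  refine Prod.ext h ?_
  have := H1Graph_snd_eq_zero T hT U (p - q) (sub_mem hp hq) (by simp [h])
  simpa [sub_eq_zero] using this

section Pair

variable {W : E d → ℝ} (hW : MemLp W ∞ (volume.restrict (U : Set (E d))))

/-- `u ↦ (u♭, ∇u♭)`. -/
noncomputable def flatPair (T : Set (E d → ℝ)) (V : Submodule ℝ (L2 U)) :
    expDomain T V W hW →ₗ[ℝ] L2 U × L2Vec U :=
  (V.subtype ∘ₗ flat T V W hW).prod (flatGrad T V W hW)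

lemma flatPair_mem (hT : T ⊆ smoothFns d) (u : expDomain T V W hW) :
    flatPair hW T V u ∈ H1Graph T U :=
  gradOp_mem_H1Graph hT ⟨mulExp (-W) hW.neg u, u.2.1⟩

lemma flatPair_fst (u : expDomain T V W hW) :
    (flatPair hW T V u).1 = mulExp (-W) hW.neg u := rfl

lemma mulExp_flatPair_fst (u : expDomain T V W hW) :
    mulExp W hW (flatPair hW T V u).1 = u := by
  rw [flatPair_fst, mulExp_mulExp_neg]

lemma mulExp_mem_expDomain {p : L2 U × L2Vec U} (hp : p ∈ H1Graph T U) (hV : p.1 ∈ V) :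
    mulExp W hW p.1 ∈ expDomain T V W hW := by
  simp only [expDomain, Submodule.mem_comap, mulExp_neg_mulExp]
  exact ⟨mem_domain_of_mem_H1Graph hp, hV⟩

lemma flatPair_mulExp (hT : T ⊆ smoothFns d) {p : L2 U × L2Vec U} (hp : p ∈ H1Graph T U)
    (hV : p.1 ∈ V) : flatPair hW T V ⟨mulExp W hW p.1, mulExp_mem_expDomain hW hp hV⟩ = p :=
  H1Graph_snd_unique hT (flatPair_mem hW hT _) hp (by rw [flatPair_fst, mulExp_neg_mulExp])

lemma expBilin_self (B : V →ₗ[ℝ] V →ₗ[ℝ] ℝ) (u : expDomain T V W hW) {p : L2 U × L2Vec U}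
    (hp : flatPair hW T V u = p) (hV : p.1 ∈ V) :
    expBilin T W hW B u u = energy W hW p.2 p.2 + B ⟨p.1, hV⟩ ⟨p.1, hV⟩ := by
  subst hp
  rfl

lemma val_expForm (Z : BoundedSymmForm V N) (u : expDomain T V W hW) {p : L2 U × L2Vec U}
    (hp : flatPair hW T V u = p) (hV : p.1 ∈ V) :
    (expForm T W hW Z).val u =
      ((energy W hW p.2 p.2 + Z.bilin ⟨p.1, hV⟩ ⟨p.1, hV⟩ : ℝ) : EReal) := by
  rw [← expBilin_self hW Z.bilin u hp hV]
  exact dif_pos u.2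

lemma mem_of_val_lt_top (Z : BoundedSymmForm V N) {u : L2 U} {b : EReal}
    (h : (expForm T W hW Z).val u < b) : u ∈ expDomain T V W hW := by
  by_contra hn
  rw [SymmForm.val, dif_neg (show u ∉ (expForm T W hW Z).domain from hn)] at h
  exact not_top_lt h

end Pair

namespace FormSetting

variable (S : FormSetting T U V N)
include S

lemma ne_top {p : L2 U × L2Vec U} (hp : p ∈ H1Graph T U) : N p.1 ≠ ⊤ := by
  obtain ⟨C, -, h⟩ := S.interp 1 one_pos
  exact ne_top_of_le_ne_top ENNReal.ofReal_ne_top (h p hp)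

/-- Shifted forms are uniformly equivalent to the squared norm of the graph of the gradient. -/
lemma coercive (R ζ : ℝ) (hζ : 0 ≤ ζ) : ∃ M : ℝ, 0 < M ∧ ∃ c : ℝ, 0 < c ∧ ∃ C : ℝ,
    ∀ (W : E d → ℝ) (hW : MemLp W ∞ (volume.restrict (U : Set (E d)))), (∀ x ∈ U, |W x| ≤ R) →
    ∀ B : V →ₗ[ℝ] V →ₗ[ℝ] ℝ, formNorm N B ≤ ENNReal.ofReal ζ →
    ∀ u : expDomain T V W hW,
      c * ‖flatPair hW T V u‖ ^ 2 ≤ expBilin T W hW B u u + M * ‖(u : L2 U)‖ ^ 2 ∧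
      expBilin T W hW B u u + M * ‖(u : L2 U)‖ ^ 2 ≤ C * ‖flatPair hW T V u‖ ^ 2 := by
  -- Chosen so that 2ζε² is at most half of the lower energy constant e^(−2R); dividing by `ζ + 1`
  -- instead of `ζ` admits ζ = 0.
  set ε : ℝ := √(Real.exp (-(2 * R)) / (4 * (ζ + 1))) with hε
  have hεpos : 0 < ε := by positivity
  have hε2 : ε ^ 2 = Real.exp (-(2 * R)) / (4 * (ζ + 1)) := Real.sq_sqrt (by positivity)
  have hζε : 2 * ζ * ε ^ 2 ≤ Real.exp (-(2 * R)) / 2 := by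
    rw [hε2]
    have : ζ / (ζ + 1) ≤ 1 := by rw [div_le_one (by linarith)]; linarith
    calc 2 * ζ * (Real.exp (-(2 * R)) / (4 * (ζ + 1)))
        = Real.exp (-(2 * R)) / 2 * (ζ / (ζ + 1)) := by field_simp; ring
      _ ≤ Real.exp (-(2 * R)) / 2 * 1 := by gcongr
      _ = _ := mul_one _
  obtain ⟨K, hK0, hK⟩ := S.interp ε hεpos
  refine ⟨Real.exp (2 * R) * (2 * ζ * K ^ 2 + 1), by positivity,
    min (Real.exp (-(2 * R)) / 2) 1, by positivity,
    Real.exp (2 * R) + 2 * ζ * ε ^ 2 + 2 * ζ * K ^ 2 +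
      Real.exp (2 * R) * (2 * ζ * K ^ 2 + 1) * Real.exp (2 * R), ?_⟩
  intro W hW hR B hB u
  have hmem : flatPair hW T V u ∈ H1Graph T U := flatPair_mem hW S.smooth u
  have hV := S.mem _ hmem
  rw [expBilin_self hW B u rfl hV]
  refine coercive_real hζ hζε (norm_nonneg _) (norm_nonneg _) (norm_nonneg _) rfl ?_ ?_
    (le_energy_self hW hR _) (energy_self_le hW hR _) ?_
  · conv_lhs => rw [← mulExp_flatPair_fst hW u]
    exact norm_mulExp_le hW hR _
  · conv_rhs => rw [← mulExp_flatPair_fst hW u]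
    exact norm_le_norm_mulExp hW hR _
  · refine (abs_apply_self_le S.smul S.eq_zero B (hB.trans_lt ENNReal.ofReal_lt_top)
      ⟨(flatPair hW T V u).1, hV⟩ (S.ne_top hmem)).trans ?_
    have h1 : (formNorm N B).toReal ≤ ζ := ENNReal.toReal_le_of_le_ofReal hζ hB
    have h2 := ENNReal.toReal_le_of_le_ofReal (by positivity) (hK _ hmem)
    exact mul_le_mul h1 (pow_le_pow_left₀ ENNReal.toReal_nonneg h2 2) (by positivity) hζ

/-- A bounded surjection, here multiplication by e^W, maps dense sets to dense sets. -/
lemma dense_expDomain {W : E d → ℝ} (hW : MemLp W ∞ (volume.restrict (U : Set (E d)))) {R : ℝ}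
    (hR : ∀ x ∈ U, |W x| ≤ R) : Dense (expDomain T V W hW : Set (L2 U)) := by
  have hsurj : Function.Surjective (mulExpL W hW R hR) := fun v =>
    ⟨mulExp (-W) hW.neg v, mulExp_mulExp_neg hW v⟩
  refine (hsurj.denseRange.dense_image (mulExpL W hW R hR).continuous S.dense).mono ?_
  rintro _ ⟨u, hu, rfl⟩
  obtain ⟨p, hp, rfl⟩ := Submodule.mem_map.1 hu
  exact mulExp_mem_expDomain hW hp (S.mem p hp)

/-- By the lower bound in `coercive`, a Cauchy sequence for the shifted form has Cauchy pairs (u♭,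
∇u♭). Their limit lies in the closed graph, and the upper bound turns convergence of pairs back into
convergence for the form. -/
lemma isClosed_expForm {W : E d → ℝ} (hW : MemLp W ∞ (volume.restrict (U : Set (E d)))) {R : ℝ}
    (hR : ∀ x ∈ U, |W x| ≤ R) (Z : BoundedSymmForm V N) : (expForm T W hW Z).IsClosed := by
  obtain ⟨M, hM, c, hc, C, hcoer⟩ := S.coercive R (formNorm N Z.bilin).toReal ENNReal.toReal_nonneg
  have hco := hcoer W hW hR Z.bilin (ENNReal.ofReal_toReal Z.bounded.ne).ge
  refine ⟨S.dense_expDomain hW hR, M, hM, fun (u : expDomain T V W hW) hu => ?_,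
    fun (u : ℕ → expDomain T V W hW) hu => ?_⟩
  · refine lt_of_lt_of_le ?_ (hco u).1
    have : flatPair hW T V u ≠ 0 := by
      intro h0
      apply hu
      have := mulExp_flatPair_fst hW u
      rw [h0] at this
      exact Subtype.ext (by simpa using this.symm)
    positivity
  · have hcau : CauchySeq fun n => flatPair hW T V (u n) := by
      rw [Metric.cauchySeq_iff]
      intro ε hε
      obtain ⟨n₀, hn₀⟩ := hu (c * ε ^ 2) (by positivity)
      refine ⟨n₀, fun m hm n hn => ?_⟩
      rw [dist_eq_norm, ← map_sub]
      have h1 := (hco (u m - u n)).1.trans_lt (hn₀ m hm n hn)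
      exact lt_of_pow_lt_pow_left₀ 2 hε.le (lt_of_mul_lt_mul_left h1 hc.le)
    obtain ⟨p, hp⟩ := cauchySeq_tendsto_of_complete hcau
    have hpm : p ∈ H1Graph T U := (isClosed_H1Graph T U).mem_of_tendsto hp
      (Eventually.of_forall fun n => flatPair_mem hW S.smooth (u n))
    let v : expDomain T V W hW := ⟨mulExp W hW p.1, mulExp_mem_expDomain hW hpm (S.mem p hpm)⟩
    have hv : flatPair hW T V v = p := flatPair_mulExp hW S.smooth hpm (S.mem p hpm)
    refine ⟨v, ?_⟩
    have hlim : Tendsto (fun n => C * ‖flatPair hW T V (u n) - p‖ ^ 2) atTop (𝓝 0) := by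
      have := ((tendsto_iff_norm_sub_tendsto_zero.1 hp).pow 2).const_mul C
      simpa using this
    refine squeeze_zero (fun n => ?_) (fun n => ?_) hlim
    · exact le_trans (by positivity) (hco (u n - v)).1
    · refine ((hco (u n - v)).2).trans_eq ?_
      rw [map_sub, hv]

-- Polarization applied to normalised vectors. As `N` need not satisfy the parallelogram law, both
-- N(a + b) and N(a − b) are bounded by N(a) + N(b), which costs the factor 2.
set_option maxHeartbeats 1000000 in
lemma abs_apply_le {B : V →ₗ[ℝ] V →ₗ[ℝ] ℝ} (hsymm : ∀ u v, B u v = B v u)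
    (hB : formNorm N B < ⊤) (u v : V) (hu : N u ≠ ⊤) (hv : N v ≠ ⊤) :
    |B u v| ≤ 2 * (formNorm N B).toReal * ((N u).toReal * (N v).toReal) := by
  have hpol : ∀ a b : V, N a ≠ ⊤ → N b ≠ ⊤ →
      |B a b| ≤ (formNorm N B).toReal * ((N a).toReal + (N b).toReal) ^ 2 / 2 := by
    intro a b ha hb
    have hsub : N (a - b : V) ≤ N a + N b := by
      have h := S.add_le a ((-1 : ℝ) • (b : L2 U))
      rw [S.smul] at h
      simpa [sub_eq_add_neg] using h
    have hadd : N (a + b : V) ≤ N a + N b := S.add_le a b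
    have htop : N a + N b ≠ ⊤ := ENNReal.add_ne_top.2 ⟨ha, hb⟩
    have h1 := abs_apply_self_le S.smul S.eq_zero B hB (a + b) (ne_top_of_le_ne_top htop hadd)
    have h2 := abs_apply_self_le S.smul S.eq_zero B hB (a - b) (ne_top_of_le_ne_top htop hsub)
    have h3 : (N (a + b : V)).toReal ≤ (N a).toReal + (N b).toReal := by
      rw [← ENNReal.toReal_add ha hb]; exact ENNReal.toReal_mono htop hadd
    have h4 : (N (a - b : V)).toReal ≤ (N a).toReal + (N b).toReal := by
      rw [← ENNReal.toReal_add ha hb]; exact ENNReal.toReal_mono htop hsub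
    have h5 : (formNorm N B).toReal * (N (a + b : V)).toReal ^ 2 ≤
        (formNorm N B).toReal * ((N a).toReal + (N b).toReal) ^ 2 := by gcongr
    have h6 : (formNorm N B).toReal * (N (a - b : V)).toReal ^ 2 ≤
        (formNorm N B).toReal * ((N a).toReal + (N b).toReal) ^ 2 := by gcongr
    have h7 : B a b = (B (a + b) (a + b) - B (a - b) (a - b)) / 4 := by
      simp only [map_add, map_sub, LinearMap.add_apply, LinearMap.sub_apply]
      rw [hsymm b a]; ring
    have h8 := abs_sub (B (a + b) (a + b)) (B (a - b) (a - b))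
    rw [h7, abs_div, abs_of_pos (by norm_num : (0 : ℝ) < 4)]
    linarith
  by_cases hu0 : N u = 0
  · rw [show u = 0 from Subtype.ext (S.eq_zero _ hu0)]
    simp only [map_zero, LinearMap.zero_apply, abs_zero]
    positivity
  by_cases hv0 : N v = 0
  · rw [show v = 0 from Subtype.ext (S.eq_zero _ hv0)]
    simp only [map_zero, abs_zero]
    positivity
  have hr := ENNReal.toReal_pos hu0 hu
  have ht := ENNReal.toReal_pos hv0 hv
  have key : ∀ w : V, N w ≠ ⊤ → 0 < (N w).toReal → N (((N w).toReal⁻¹ • w : V) : L2 U) = 1 := by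
    intro w hw hpos
    rw [Submodule.coe_smul, S.smul, Real.enorm_of_nonneg (by positivity)]
    conv_lhs => rw [← ENNReal.ofReal_toReal hw]
    rw [ENNReal.toReal_ofReal hpos.le, ← ENNReal.ofReal_mul (by positivity),
      inv_mul_cancel₀ hpos.ne', ENNReal.ofReal_one]
  have h := hpol ((N u).toReal⁻¹ • u) ((N v).toReal⁻¹ • v) (by rw [key u hu hr]; simp)
    (by rw [key v hv ht]; simp)
  rw [key u hu hr, key v hv ht, map_smul, map_smul, LinearMap.smul_apply, smul_eq_mul,
    smul_eq_mul, ENNReal.toReal_one, abs_mul, abs_mul, abs_of_pos (inv_pos.2 hr),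
    abs_of_pos (inv_pos.2 ht)] at h
  calc |B u v| = (N u).toReal * (N v).toReal *
        ((N v).toReal⁻¹ * ((N u).toReal⁻¹ * |B u v|)) := by field_simp
    _ ≤ (N u).toReal * (N v).toReal * ((formNorm N B).toReal * (1 + 1) ^ 2 / 2) := by
      gcongr
    _ = _ := by ring

-- Expand B_i(v,v) − B(u,u) as (B_i − B)(v,v) + B(v−u,v−u) + 2B(v−u,u). Each term is small by the
-- quadratic or the bilinear bound.
set_option maxHeartbeats 1000000 in
lemma tendsto_apply_self {ι : Type*} {F : Filter ι} {Bn : ι → V →ₗ[ℝ] V →ₗ[ℝ] ℝ}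
    {B : V →ₗ[ℝ] V →ₗ[ℝ] ℝ} (hsymm : ∀ u v, B u v = B v u) (hB : formNorm N B < ⊤)
    (hBn : Tendsto (fun i => formNorm N (Bn i - B)) F (𝓝 0)) {v : ι → V} {u : V} (hu : N u ≠ ⊤)
    (hv : Tendsto (fun i => N ((v i : L2 U) - u)) F (𝓝 0)) :
    Tendsto (fun i => Bn i (v i) (v i)) F (𝓝 (B u u)) := by
  have hr : Tendsto (fun i => (N ((v i : L2 U) - u)).toReal) F (𝓝 0) := by
    exact (ENNReal.tendsto_toReal ENNReal.zero_ne_top).comp hv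
  have ha : Tendsto (fun i => (formNorm N (Bn i - B)).toReal) F (𝓝 0) := by
    exact (ENNReal.tendsto_toReal ENNReal.zero_ne_top).comp hBn
  set n := (N u).toReal
  set ζ := (formNorm N B).toReal
  rw [tendsto_iff_norm_sub_tendsto_zero]
  have hlim : Tendsto (fun i => (formNorm N (Bn i - B)).toReal *
      ((N ((v i : L2 U) - u)).toReal + n) ^ 2 + ζ * (N ((v i : L2 U) - u)).toReal ^ 2
        + 2 * (2 * ζ * ((N ((v i : L2 U) - u)).toReal * n))) F (𝓝 0) := by
    have := ((ha.mul ((hr.add_const n).pow 2)).add ((hr.pow 2).const_mul ζ)).add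
      (((hr.mul_const n).const_mul (2 * ζ)).const_mul 2)
    simpa using this
  refine squeeze_zero' (Eventually.of_forall fun i => norm_nonneg _) ?_ hlim
  filter_upwards [hv.eventually_lt_const ENNReal.zero_lt_top,
    hBn.eventually_lt_const ENNReal.zero_lt_top] with i hi1 hi2
  have hvle : N (v i) ≤ N ((v i : L2 U) - u) + N u := by
    simpa using S.add_le ((v i : L2 U) - u) u
  have htop : N ((v i : L2 U) - u) + N u ≠ ⊤ := ENNReal.add_ne_top.2 ⟨hi1.ne, hu⟩
  have hvr : (N (v i)).toReal ≤ (N ((v i : L2 U) - u)).toReal + n := by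
    rw [← ENNReal.toReal_add hi1.ne hu]
    exact ENNReal.toReal_mono htop hvle
  have h1 := abs_apply_self_le S.smul S.eq_zero (Bn i - B) hi2 (v i)
    (ne_top_of_le_ne_top htop hvle)
  have h1' : (formNorm N (Bn i - B)).toReal * (N (v i)).toReal ^ 2 ≤
      (formNorm N (Bn i - B)).toReal * ((N ((v i : L2 U) - u)).toReal + n) ^ 2 := by gcongr
  have h2 := abs_apply_self_le S.smul S.eq_zero B hB (v i - u) hi1.ne
  have h3 := S.abs_apply_le hsymm hB (v i - u) u hi1.ne hu
  have h4 : Bn i (v i) (v i) - B u u = (Bn i - B) (v i) (v i) + B (v i - u) (v i - u)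
      + 2 * B (v i - u) u := by
    simp only [map_sub, LinearMap.sub_apply]
    rw [hsymm u (v i)]; ring
  rw [h4, Real.norm_eq_abs]
  refine (abs_add_le _ _).trans (add_le_add ((abs_add_le _ _).trans
    (add_le_add (h1.trans h1') h2)) ?_)
  rw [abs_mul, abs_two]
  gcongr
  exact h3

/-- Convergence in `L²` of functions with bounded gradients implies convergence in `N`. -/
lemma tendsto_norm_sub {ι : Type*} {F : Filter ι} {p : ι → L2 U × L2Vec U} {q : L2 U × L2Vec U}
    (hp : ∀ᶠ i in F, p i ∈ H1Graph T U) (hq : q ∈ H1Graph T U) {R : ℝ}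
    (hR : ∀ᶠ i in F, ‖(p i).2‖ ≤ R) (hlim : Tendsto (fun i => (p i).1) F (𝓝 q.1)) :
    Tendsto (fun i => N ((p i).1 - q.1)) F (𝓝 0) := by
  rw [ENNReal.tendsto_nhds_zero]
  intro δ hδ
  by_cases htop : δ = ⊤
  · simp [htop]
  have hδ' : 0 < δ.toReal := ENNReal.toReal_pos hδ.ne' htop
  set L := |R| + ‖q.2‖ + 1 with hL
  have hLpos : 0 < L := by positivity
  -- `L` bounds the gradients of the differences, so with this ε the gradient term contributes at
  -- most δ/2; the L² term tends to 0.
  obtain ⟨C, hC0, hC⟩ := S.interp (δ.toReal / 2 / L) (by positivity)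
  have h0 : Tendsto (fun i => C * ‖(p i).1 - q.1‖) F (𝓝 0) := by
    simpa using (tendsto_iff_norm_sub_tendsto_zero.1 hlim).const_mul C
  filter_upwards [hp, hR, h0.eventually_le_const (by positivity : 0 < δ.toReal / 2)]
    with i h1 h2 h3
  refine (hC (p i - q) (sub_mem h1 hq)).trans ?_
  refine LE.le.trans ?_ (ENNReal.ofReal_toReal htop).le
  apply ENNReal.ofReal_le_ofReal
  have h4 : ‖(p i - q).2‖ ≤ L := by
    refine (norm_sub_le _ _).trans ?_
    have := le_abs_self R
    rw [hL]; linarith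
  calc δ.toReal / 2 / L * ‖(p i - q).2‖ + C * ‖(p i - q).1‖
      ≤ δ.toReal / 2 / L * L + δ.toReal / 2 := by gcongr; exact h3
    _ = δ.toReal := by field_simp; ring

end FormSetting

end Setting

end SymFormConv

/-! ### Γ-convergence and compactness in a `FormSetting`. -/

namespace SymFormConv

section Compact

variable {d : ℕ} {T : Set (E d → ℝ)} {U : Opens (E d)} {V : Submodule ℝ (L2 U)} {N : L2 U → ℝ≥0∞}

lemma exists_formNorm_bound {Bn : ℕ → V →ₗ[ℝ] V →ₗ[ℝ] ℝ} {B : V →ₗ[ℝ] V →ₗ[ℝ] ℝ}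
    (hBn : ∀ n, formNorm N (Bn n) < ⊤) (hB : formNorm N B < ⊤)
    (h : Tendsto (fun n => formNorm N (Bn n - B)) atTop (𝓝 0)) :
    ∃ ζ : ℝ, 0 ≤ ζ ∧ formNorm N B ≤ ENNReal.ofReal ζ ∧
      ∀ n, formNorm N (Bn n) ≤ ENNReal.ofReal ζ := by
  obtain ⟨m, hm⟩ := eventually_atTop.1 (h.eventually_le_const (one_pos : (0 : ℝ≥0∞) < 1))
  have hfin : formNorm N B + 1 + ∑ i ∈ Finset.range m, formNorm N (Bn i) ≠ ⊤ := by
    refine ENNReal.add_ne_top.2 ⟨ENNReal.add_ne_top.2 ⟨hB.ne, ENNReal.one_ne_top⟩, ?_⟩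
    exact ENNReal.sum_ne_top.2 fun i _ => (hBn i).ne
  refine ⟨(formNorm N B + 1 + ∑ i ∈ Finset.range m, formNorm N (Bn i)).toReal,
    ENNReal.toReal_nonneg, ?_, fun n => ?_⟩ <;> rw [ENNReal.ofReal_toReal hfin]
  · rw [add_assoc]; exact le_self_add
  · by_cases hn : n < m
    · exact (Finset.single_le_sum (f := fun i => formNorm N (Bn i)) (fun i _ => zero_le)
        (Finset.mem_range.2 hn)).trans le_add_self
    · exact (formNorm_le_add (Bn n) B).trans
        ((add_le_add le_rfl (hm n (not_lt.1 hn))).trans le_self_add)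

lemma norm_mulExpL_sub_le {W W' : E d → ℝ} (hW : MemLp W ∞ (volume.restrict (U : Set (E d))))
    (hW' : MemLp W' ∞ (volume.restrict (U : Set (E d)))) {R R' η : ℝ} (hR : ∀ x ∈ U, |W x| ≤ R)
    (hR' : ∀ x ∈ U, |W' x| ≤ R') (hη0 : 0 ≤ η)
    (hη : ∀ x ∈ U, |Real.exp (W x) - Real.exp (W' x)| ≤ η) :
    ‖mulExpL W hW R hR - mulExpL W' hW' R' hR'‖ ≤ η :=
  ContinuousLinearMap.opNorm_le_bound _ hη0 fun u => norm_mulExp_sub_le hW hW' hη u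

variable {Wn : ℕ → E d → ℝ} {W : E d → ℝ}

/-- Convergence in operator norm makes evaluation jointly continuous in the operator and the
function. The liminf inequality and the compactness argument both rely on this. -/
lemma tendsto_mulExpL (hWn : ∀ n, MemLp (Wn n) ∞ (volume.restrict (U : Set (E d))))
    (hW : MemLp W ∞ (volume.restrict (U : Set (E d)))) {R : ℝ}
    (hRn : ∀ n, ∀ x ∈ U, |Wn n x| ≤ R) (hR : ∀ x ∈ U, |W x| ≤ R)
    (hconv : TendstoUniformlyOn Wn W atTop (U : Set (E d))) :
    Tendsto (fun n => mulExpL (Wn n) (hWn n) R (hRn n)) atTop (𝓝 (mulExpL W hW R hR)) := by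
  rw [Metric.tendsto_atTop']
  intro ε hε
  obtain ⟨m, hm⟩ := eventually_atTop.1 (eventually_abs_exp_sub_le hconv hR 1 (half_pos hε))
  refine ⟨m, fun n hn => ?_⟩
  rw [dist_eq_norm]
  refine (norm_mulExpL_sub_le (hWn n) hW (hRn n) hR (half_pos hε).le fun x hx => ?_).trans_lt
    (half_lt_self hε)
  simpa using hm n hn.le x hx

lemma tendsto_mulExpL_neg (hWn : ∀ n, MemLp (Wn n) ∞ (volume.restrict (U : Set (E d))))
    (hW : MemLp W ∞ (volume.restrict (U : Set (E d)))) {R : ℝ}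
    (hRn : ∀ n, ∀ x ∈ U, |(-Wn n) x| ≤ R) (hR : ∀ x ∈ U, |(-W) x| ≤ R)
    (hconv : TendstoUniformlyOn Wn W atTop (U : Set (E d))) :
    Tendsto (fun n => mulExpL (-Wn n) (hWn n).neg R (hRn n)) atTop
      (𝓝 (mulExpL (-W) hW.neg R hR)) := by
  refine tendsto_mulExpL (fun n => (hWn n).neg) hW.neg hRn hR ?_
  rw [Metric.tendstoUniformlyOn_iff] at hconv ⊢
  simpa only [Pi.neg_apply, dist_neg_neg] using hconv

/-- The field may vary with the index as long as it stays bounded, since in the liminf inequality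
the gradients converge only weakly. -/
lemma tendsto_energy_sub {ι : Type*} {F : Filter ι} {W' : ι → E d → ℝ}
    (hW' : ∀ i, MemLp (W' i) ∞ (volume.restrict (U : Set (E d))))
    (hW : MemLp W ∞ (volume.restrict (U : Set (E d))))
    (h : ∀ ε : ℝ, 0 < ε → ∀ᶠ i in F, ∀ x ∈ U,
      |Real.exp (2 * W' i x) - Real.exp (2 * W x)| ≤ ε)
    {g : ι → L2Vec U} {R : ℝ} (hg : ∀ᶠ i in F, ‖g i‖ ≤ R) :
    Tendsto (fun i => energy (W' i) (hW' i) (g i) (g i) - energy W hW (g i) (g i)) F (𝓝 0) := by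
  rw [Metric.tendsto_nhds]
  intro ε hε
  filter_upwards [h (ε / (R ^ 2 + 1) / 2) (by positivity), hg] with i h1 h2
  rw [Real.dist_0_eq_abs]
  refine (abs_energy_sub_le (hW' i) hW h1 (g i)).trans_lt ?_
  calc ε / (R ^ 2 + 1) / 2 * ‖g i‖ ^ 2 ≤ ε / (R ^ 2 + 1) / 2 * (R ^ 2 + 1) := by
        gcongr
        have : ‖g i‖ ^ 2 ≤ R ^ 2 := by gcongr
        linarith
    _ = ε / 2 := by field_simp
    _ < ε := half_lt_self hε

/-- The energy of g − h is nonnegative. The left side is affine in g, hence passes to weak limits,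
and taking h to be the weak limit gives weak lower semicontinuity. -/
lemma energy_ge_tangent (hW : MemLp W ∞ (volume.restrict (U : Set (E d)))) (g h : L2Vec U) :
    2 * energy W hW g h - energy W hW h h ≤ energy W hW g g := by
  have h1 : 0 ≤ energy W hW (g - h) (g - h) := by
    rw [energy_apply]
    refine integral_nonneg fun x => ?_
    simp only [real_inner_self_eq_norm_sq, Pi.zero_apply]
    positivity
  simp only [map_sub, LinearMap.sub_apply] at h1
  rw [energy_symm W hW h g] at h1
  linarith

namespace FormSetting

variable (S : FormSetting T U V N)
  (hWn : ∀ n, MemLp (Wn n) ∞ (volume.restrict (U : Set (E d))))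
  (hW : MemLp W ∞ (volume.restrict (U : Set (E d)))) {R : ℝ}
  (hRn : ∀ n, ∀ x ∈ U, |Wn n x| ≤ R) (hR : ∀ x ∈ U, |W x| ≤ R)
  (hconv : TendstoUniformlyOn Wn W atTop (U : Set (E d)))
  (Zn : ℕ → BoundedSymmForm V N) (Z : BoundedSymmForm V N)
include S hW hRn hR hconv

/-- Keep u♭ = e^(−W)v fixed and set u_n = e^(W_n)u♭. Then only the energy weight and Z_n vary. -/
lemma exists_recovery (hZ : Tendsto (fun n => formNorm N ((Zn n).bilin - Z.bilin)) atTop (𝓝 0))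
    {v : L2 U} (hv : v ∈ expDomain T V W hW) :
    ∃ u : ℕ → L2 U, Tendsto u atTop (𝓝 v) ∧
      Tendsto (fun n => (expForm T (Wn n) (hWn n) (Zn n)).val (u n)) atTop
        (𝓝 ((expForm T W hW Z).val v)) := by
  set p := flatPair hW T V ⟨v, hv⟩ with hp
  have hpm : p ∈ H1Graph T U := flatPair_mem hW S.smooth _
  have hV : p.1 ∈ V := S.mem p hpm
  refine ⟨fun n => mulExp (Wn n) (hWn n) p.1, ?_, ?_⟩
  · have h1 := ((ContinuousLinearMap.apply ℝ (L2 U) p.1).continuous.tendsto _).comp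
      (tendsto_mulExpL hWn hW hRn hR hconv)
    have h2 : mulExp W hW p.1 = v := mulExp_flatPair_fst hW ⟨v, hv⟩
    rw [← h2]
    exact h1
  · have h1 : ∀ n, (expForm T (Wn n) (hWn n) (Zn n)).val (mulExp (Wn n) (hWn n) p.1) =
        ((energy (Wn n) (hWn n) p.2 p.2 + (Zn n).bilin ⟨p.1, hV⟩ ⟨p.1, hV⟩ : ℝ) : EReal) :=
      fun n => val_expForm (hWn n) (Zn n) ⟨_, mulExp_mem_expDomain (hWn n) hpm hV⟩
        (flatPair_mulExp (hWn n) S.smooth hpm hV) hV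
    have h2 := val_expForm hW Z ⟨v, hv⟩ hp.symm hV
    simp only at h2
    rw [h2]
    simp_rw [h1]
    rw [EReal.tendsto_coe]
    refine Tendsto.add ?_ ?_
    · have := tendsto_energy_sub (F := atTop) hWn hW
        (fun ε hε => eventually_abs_exp_sub_le hconv hR 2 hε) (g := fun _ => p.2) (R := ‖p.2‖)
        (Eventually.of_forall fun _ => le_rfl)
      simpa using this.add_const (energy W hW p.2 p.2)
    · refine S.tendsto_apply_self Z.symm Z.bounded hZ (v := fun _ => ⟨p.1, hV⟩)
        (u := ⟨p.1, hV⟩) (S.ne_top hpm) ?_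
      have h0 : N 0 = 0 := by simpa using S.smul 0 0
      simp [h0]

-- If the inequality fails, some real b lies strictly between the two sides and the values along the
-- sequence are below b infinitely often. On an ultrafilter concentrated there the gradients are
-- bounded and converge weakly, and the limit of the energies plus Z-terms is at most b, a
-- contradiction.
set_option maxHeartbeats 1000000 in
lemma le_liminf (hZ : Tendsto (fun n => formNorm N ((Zn n).bilin - Z.bilin)) atTop (𝓝 0))
    {u : ℕ → L2 U} {v : L2 U} (hu : Tendsto u atTop (𝓝 v)) :
    (expForm T W hW Z).val v ≤
      liminf (fun n => (expForm T (Wn n) (hWn n) (Zn n)).val (u n)) atTop := by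
  by_contra hlt
  obtain ⟨b, hb1, hb2⟩ := EReal.lt_iff_exists_real_btwn.1 (not_le.1 hlt)
  have hfreq : ∃ᶠ n in atTop, (expForm T (Wn n) (hWn n) (Zn n)).val (u n) < b :=
    frequently_lt_of_liminf_lt (by isBoundedDefault) hb1
  have : (atTop ⊓ 𝓟 {n | (expForm T (Wn n) (hWn n) (Zn n)).val (u n) < b}).NeBot :=
    frequently_mem_iff_neBot.1 hfreq
  set F : Ultrafilter ℕ :=
    Ultrafilter.of (atTop ⊓ 𝓟 {n | (expForm T (Wn n) (hWn n) (Zn n)).val (u n) < b})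
  have hF : (F : Filter ℕ) ≤ atTop := (Ultrafilter.of_le _).trans inf_le_left
  have hFb : ∀ᶠ n in (F : Filter ℕ), (expForm T (Wn n) (hWn n) (Zn n)).val (u n) < b :=
    (Ultrafilter.of_le _).trans inf_le_right (mem_principal_self _)
  obtain ⟨ζ, hζ0, hζ, hζn⟩ := exists_formNorm_bound (fun n => (Zn n).bounded) Z.bounded hZ
  obtain ⟨M, hM, c, hc, C, hco⟩ := S.coercive R ζ hζ0
  classical
  -- The value 0 outside the domain is harmless: values below b force membership in the domain along
  -- `F`.
  let p : ℕ → L2 U × L2Vec U := fun n =>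
    if h : u n ∈ expDomain T V (Wn n) (hWn n) then flatPair (hWn n) T V ⟨u n, h⟩ else 0
  have hpm : ∀ n, p n ∈ H1Graph T U := fun n => by
    by_cases h : u n ∈ expDomain T V (Wn n) (hWn n)
    · simp only [p, dif_pos h]; exact flatPair_mem _ S.smooth _
    · simp only [p, dif_neg h]; exact zero_mem _
  have hpV : ∀ n, (p n).1 ∈ V := fun n => S.mem _ (hpm n)
  have hp1 : ∀ᶠ n in (F : Filter ℕ), (p n).1 = mulExp (-Wn n) (hWn n).neg (u n) := by
    filter_upwards [hFb] with n hn
    have hd := mem_of_val_lt_top (hWn n) (Zn n) hn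
    simp only [p, dif_pos hd]
    rfl
  have hpb : ∀ᶠ n in (F : Filter ℕ), energy (Wn n) (hWn n) (p n).2 (p n).2 +
      (Zn n).bilin ⟨(p n).1, hpV n⟩ ⟨(p n).1, hpV n⟩ < b := by
    filter_upwards [hFb] with n hn
    have hd := mem_of_val_lt_top (hWn n) (Zn n) hn
    have h1 := val_expForm (hWn n) (Zn n) ⟨u n, hd⟩ (p := p n)
      (by simp only [p, dif_pos hd]) (hpV n)
    simp only at h1
    rw [h1] at hn
    exact EReal.coe_lt_coe_iff.1 hn
  -- Coercivity, with Q_n(u_n, u_n) < b and ‖u_n‖ ≤ ‖v‖ + 1.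
  have hbd : ∀ᶠ n in (F : Filter ℕ), ‖(p n).2‖ ≤ √((b + M * (‖v‖ + 1) ^ 2) / c) := by
    filter_upwards [hFb, hpb, hF (hu.norm.eventually_le_const (lt_add_one ‖v‖))] with n h1 h2 h3
    have hd := mem_of_val_lt_top (hWn n) (Zn n) h1
    have hpn : flatPair (hWn n) T V ⟨u n, hd⟩ = p n := by simp only [p, dif_pos hd]
    have h4 := (hco (Wn n) (hWn n) (hRn n) (Zn n).bilin (hζn n) ⟨u n, hd⟩).1
    rw [expBilin_self (hWn n) (Zn n).bilin ⟨u n, hd⟩ hpn (hpV n), hpn] at h4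
    apply Real.le_sqrt_of_sq_le
    rw [le_div_iff₀ hc]
    have h5 : ‖(p n).2‖ ^ 2 ≤ ‖p n‖ ^ 2 := by gcongr; exact norm_snd_le _
    have h6 : M * ‖u n‖ ^ 2 ≤ M * (‖v‖ + 1) ^ 2 := by gcongr
    have h7 : c * ‖(p n).2‖ ^ 2 ≤ c * ‖p n‖ ^ 2 := by gcongr
    simp only at h4
    linarith
  have hRn' : ∀ n, ∀ x ∈ U, |(-Wn n) x| ≤ R := fun n x hx => by simpa using hRn n x hx
  have hR' : ∀ x ∈ U, |(-W) x| ≤ R := fun x hx => by simpa using hR x hx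
  have hlim1 : Tendsto (fun n => (p n).1) F (𝓝 (mulExp (-W) hW.neg v)) := by
    have h1 := (isBoundedBilinearMap_apply.continuous.tendsto (mulExpL (-W) hW.neg R hR', v)).comp
      ((tendsto_mulExpL_neg hWn hW hRn' hR' hconv).prodMk_nhds hu)
    refine (h1.mono_left hF).congr' ?_
    filter_upwards [hp1] with n hn
    rw [hn]; rfl
  obtain ⟨g, hg⟩ := exists_weak_limit F (fun n => (p n).2) _ hbd
  have hq : ((mulExp (-W) hW.neg v, g) : L2 U × L2Vec U) ∈ H1Graph T U :=
    mem_of_tendsto_of_weak _ (isClosed_H1Graph T U) (Eventually.of_forall hpm) hlim1 hg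
  have hqV := S.mem _ hq
  have hvd : v ∈ expDomain T V W hW := ⟨mem_domain_of_mem_H1Graph hq, hqV⟩
  have hval := val_expForm hW Z ⟨v, hvd⟩ (p := (mulExp (-W) hW.neg v, g))
    (H1Graph_snd_unique S.smooth (flatPair_mem hW S.smooth _) hq rfl) hqV
  simp only at hval
  rw [hval] at hb2
  have hlimN := S.tendsto_norm_sub (p := p) (q := (mulExp (-W) hW.neg v, g))
    (Eventually.of_forall hpm) hq hbd hlim1
  have hlimZ : Tendsto (fun n => (Zn n).bilin ⟨(p n).1, hpV n⟩ ⟨(p n).1, hpV n⟩) F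
      (𝓝 (Z.bilin ⟨mulExp (-W) hW.neg v, hqV⟩ ⟨mulExp (-W) hW.neg v, hqV⟩)) :=
    S.tendsto_apply_self Z.symm Z.bounded (hZ.mono_left hF)
      (v := fun n => ⟨(p n).1, hpV n⟩) (u := ⟨mulExp (-W) hW.neg v, hqV⟩) (S.ne_top hq)
      hlimN
  have hlimE := tendsto_energy_sub (F := (F : Filter ℕ)) hWn hW
    (fun ε hε => hF (eventually_abs_exp_sub_le hconv hR 2 hε)) hbd
  obtain ⟨g', hg'⟩ := exists_energy_eq_inner hW g
  have hlimW : Tendsto (fun n => energy W hW (p n).2 g) F (𝓝 (energy W hW g g)) := by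
    simp_rw [hg']
    exact hg g'
  have hlim := (hlimE.add ((hlimW.const_mul 2).sub_const (energy W hW g g))).add hlimZ
  have hle : energy W hW g g +
      Z.bilin ⟨mulExp (-W) hW.neg v, hqV⟩ ⟨mulExp (-W) hW.neg v, hqV⟩ ≤ b := by
    refine le_of_tendsto_of_tendsto hlim tendsto_const_nhds ?_ |>.trans' (le_of_eq (by ring))
    filter_upwards [hpb] with n hn
    have := energy_ge_tangent hW (p n).2 g
    linarith
  exact absurd hb2 (not_lt.2 (EReal.coe_le_coe_iff.2 hle))

/-- Coercivity bounds the pairs, so the functions u♭_n lie in a compact set by Rellich. The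
multipliers e^(W_n) together with their limit are compact in operator norm, and evaluation maps the
product of the two onto a compact set that contains all u_n. -/
lemma isCompact_closure_range {M c : ℝ} (hc : 0 < c)
    (hco : ∀ n (u : expDomain T V (Wn n) (hWn n)), c * ‖flatPair (hWn n) T V u‖ ^ 2 ≤
      expBilin T (Wn n) (hWn n) (Zn n).bilin u u + M * ‖(u : L2 U)‖ ^ 2) {u : ℕ → L2 U}
    (hu : (⨆ n, ((expForm T (Wn n) (hWn n) (Zn n)).val (u n) +
      (((M + 1) * ‖u n‖ ^ 2 : ℝ) : EReal))) < ⊤) : IsCompact (closure (Set.range u)) := by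
  obtain ⟨K, hK, -⟩ := EReal.lt_iff_exists_real_btwn.1 hu
  have hle : ∀ n, (expForm T (Wn n) (hWn n) (Zn n)).val (u n) +
      (((M + 1) * ‖u n‖ ^ 2 : ℝ) : EReal) ≤ K := fun n => (le_iSup (fun n =>
        (expForm T (Wn n) (hWn n) (Zn n)).val (u n) +
          (((M + 1) * ‖u n‖ ^ 2 : ℝ) : EReal)) n).trans hK.le
  have hdom : ∀ n, u n ∈ expDomain T V (Wn n) (hWn n) := by
    intro n
    by_contra hn
    have h1 := hle n
    rw [SymmForm.val, dif_neg (show u n ∉ (expForm T (Wn n) (hWn n) (Zn n)).domain from hn),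
      EReal.top_add_coe] at h1
    exact absurd h1 (not_le.2 (EReal.coe_lt_top K))
  have hbd : ∀ n, ‖flatPair (hWn n) T V ⟨u n, hdom n⟩‖ ≤ √(K / c) := by
    intro n
    have hV := S.mem _ (flatPair_mem (hWn n) S.smooth ⟨u n, hdom n⟩)
    have h1 := hle n
    have h2 := val_expForm (hWn n) (Zn n) ⟨u n, hdom n⟩ rfl hV
    have h3 := hco n ⟨u n, hdom n⟩
    rw [expBilin_self (hWn n) (Zn n).bilin ⟨u n, hdom n⟩ rfl hV] at h3
    simp only at h2 h3
    rw [h2, ← EReal.coe_add, EReal.coe_le_coe_iff] at h1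
    apply Real.le_sqrt_of_sq_le
    rw [le_div_iff₀ hc]
    linarith [sq_nonneg ‖u n‖]
  have hK1 := (S.totallyBounded √(K / c)).closure.isCompact_of_isClosed
    isClosed_closure
  have hK2 := (tendsto_mulExpL hWn hW hRn hR hconv).isCompact_insert_range
  have hK3 := (hK2.prod hK1).image
    (f := fun q : (L2 U →L[ℝ] L2 U) × L2 U => q.1 q.2) (by fun_prop)
  refine hK3.closure_of_subset ?_
  rintro _ ⟨n, rfl⟩
  have h1 : mulExpL (Wn n) (hWn n) R (hRn n) ∈ insert (mulExpL W hW R hR)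
      (Set.range fun n => mulExpL (Wn n) (hWn n) R (hRn n)) := Or.inr ⟨n, rfl⟩
  have h2 : (flatPair (hWn n) T V ⟨u n, hdom n⟩).1 ∈ closure {u : L2 U |
      ∃ p ∈ H1Graph T U, p.1 = u ∧ ‖p.1‖ ≤ √(K / c) ∧ ‖p.2‖ ≤ √(K / c)} :=
    subset_closure ⟨_, flatPair_mem (hWn n) S.smooth ⟨u n, hdom n⟩, rfl,
      (norm_fst_le _).trans (hbd n), (norm_snd_le _).trans (hbd n)⟩
  have h3 : mulExpL (Wn n) (hWn n) R (hRn n) (flatPair (hWn n) T V ⟨u n, hdom n⟩).1 = u n :=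
    mulExp_flatPair_fst (hWn n) ⟨u n, hdom n⟩
  exact ⟨(_, _), Set.mk_mem_prod h1 h2, h3⟩

/-- Compact convergence of the forms `expForm`. -/
theorem convergesCompactly
    (hZ : Tendsto (fun n => formNorm N ((Zn n).bilin - Z.bilin)) atTop (𝓝 0)) :
    ConvergesCompactly (fun n => expForm T (Wn n) (hWn n) (Zn n))
    (expForm T W hW Z) := by
  obtain ⟨ζ, hζ0, hζ, hζn⟩ := exists_formNorm_bound (fun n => (Zn n).bounded) Z.bounded hZ
  obtain ⟨M, hM, c, hc, C, hco⟩ := S.coercive R ζ hζ0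
  refine ⟨M, hM, fun n => ⟨S.isClosed_expForm (hWn n) (hRn n) (Zn n), fun u => ?_⟩,
    S.isClosed_expForm hW hR Z, fun u => ?_, ⟨fun u v huv => ?_, fun v hv => ?_⟩, fun u hu => ?_⟩
  · exact le_trans (by positivity) (hco (Wn n) (hWn n) (hRn n) (Zn n).bilin (hζn n) u).1
  · exact le_trans (by positivity) (hco W hW hR Z.bilin hζ u).1
  · exact S.le_liminf hWn hW hRn hR hconv Zn Z hZ huv
  · exact S.exists_recovery hWn hW hRn hR hconv Zn Z hZ hv
  · exact S.isCompact_closure_range hWn hW hRn hR hconv Zn hc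
      (fun n u => (hco (Wn n) (hWn n) (hRn n) (Zn n).bilin (hζn n) u).1) hu

end FormSetting

end Compact

end SymFormConv

/-! ### Translation estimates and interior balls on Lipschitz domains. -/

namespace SymFormConv

section Translation

lemma enorm_sq_eq_ofReal (a : ℝ) : ‖a‖ₑ ^ 2 = ENNReal.ofReal (a ^ 2) := by
  rw [← ofReal_norm, ← ENNReal.ofReal_pow (norm_nonneg _), Real.norm_eq_abs, sq_abs]

lemma enorm_sub_sq_le (a b : ℝ) : ‖a - b‖ₑ ^ 2 ≤ 2 * (‖a‖ₑ ^ 2 + ‖b‖ₑ ^ 2) := by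
  have h2 : (2 : ℝ≥0∞) = ENNReal.ofReal 2 := by simp
  simp only [enorm_sq_eq_ofReal]
  rw [h2, ← ENNReal.ofReal_add (by positivity) (by positivity), ← ENNReal.ofReal_mul (by norm_num)]
  apply ENNReal.ofReal_le_ofReal
  nlinarith [sq_nonneg (a + b)]

lemma enorm_add_sub_sq_le (a b c : ℝ) :
    ‖a + b - c‖ₑ ^ 2 ≤ 3 * (‖a‖ₑ ^ 2 + ‖b‖ₑ ^ 2 + ‖c‖ₑ ^ 2) := by
  have h3 : (3 : ℝ≥0∞) = ENNReal.ofReal 3 := by simp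
  simp only [enorm_sq_eq_ofReal]
  rw [h3, ← ENNReal.ofReal_add (by positivity) (by positivity),
    ← ENNReal.ofReal_add (by positivity) (by positivity), ← ENNReal.ofReal_mul (by norm_num)]
  apply ENNReal.ofReal_le_ofReal
  nlinarith [sq_nonneg (a - b), sq_nonneg (a + c), sq_nonneg (b + c)]

/-- The Cauchy–Schwarz inequality with the constant function `1`. -/
lemma lintegral_sq_le {α : Type*} [MeasurableSpace α] {μ : Measure α} {f : α → ℝ≥0∞}
    (hf : AEMeasurable f μ) : (∫⁻ x, f x ∂μ) ^ 2 ≤ μ Set.univ * ∫⁻ x, f x ^ 2 ∂μ := by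
  have h := ENNReal.lintegral_mul_le_Lp_mul_Lq μ (Real.HolderConjugate.two_two) hf
    (aemeasurable_const (b := (1 : ℝ≥0∞)))
  simp only [Pi.mul_apply, mul_one, ENNReal.one_rpow, lintegral_const, one_mul] at h
  calc (∫⁻ x, f x ∂μ) ^ 2
      ≤ ((∫⁻ x, f x ^ (2 : ℝ) ∂μ) ^ (1 / 2 : ℝ) * μ Set.univ ^ (1 / 2 : ℝ)) ^ 2 := by gcongr
    _ = μ Set.univ * ∫⁻ x, f x ^ 2 ∂μ := by
      rw [mul_pow, ← ENNReal.rpow_natCast, ← ENNReal.rpow_mul, ← ENNReal.rpow_natCast,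
        ← ENNReal.rpow_mul]
      norm_num
      rw [mul_comm]

variable {d : ℕ}

lemma enorm_fderiv_apply_le (φ : E d → ℝ) (x v : E d) :
    ‖fderiv ℝ φ x v‖ₑ ≤ ‖v‖ₑ * ‖gradient φ x‖ₑ := by
  have h : ‖gradient φ x‖ₑ = ‖fderiv ℝ φ x‖ₑ := by
    rw [gradient, ← ofReal_norm, LinearIsometryEquiv.norm_map, ofReal_norm]
  rw [h, mul_comm, ← ofReal_norm, ← ofReal_norm, ← ofReal_norm,
    ← ENNReal.ofReal_mul (norm_nonneg _)]
  exact ENNReal.ofReal_le_ofReal ((fderiv ℝ φ x).le_opNorm v)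

lemma continuous_gradient {φ : E d → ℝ} (hφ : ContDiff ℝ ∞ φ) : Continuous (gradient φ) :=
  (InnerProductSpace.toDual ℝ (E d)).symm.continuous.comp (hφ.continuous_fderiv (by simp))

/-- The increment of a smooth function along a segment. -/
lemma enorm_sub_sq_le_lintegral {φ : E d → ℝ} (hφ : ContDiff ℝ ∞ φ) (x v : E d) :
    ‖φ (x + v) - φ x‖ₑ ^ 2 ≤
      ‖v‖ₑ ^ 2 * ∫⁻ t in Set.Ioc (0 : ℝ) 1, ‖gradient φ (x + t • v)‖ₑ ^ 2 := by
  have hg := continuous_gradient hφ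
  have hd : ∀ t : ℝ, HasDerivAt (fun t : ℝ => φ (x + t • v)) (fderiv ℝ φ (x + t • v) v) t := by
    intro t
    have h1 : HasDerivAt (fun t : ℝ => x + t • v) v t := by
      simpa using ((hasDerivAt_id t).smul_const v).const_add x
    exact ((hφ.differentiable (by simp) _).hasFDerivAt).comp_hasDerivAt t h1
  have hc : Continuous fun t : ℝ => fderiv ℝ φ (x + t • v) v := by
    have := hφ.continuous_fderiv (n := ∞) (by simp)
    fun_prop
  have hint := intervalIntegral.integral_eq_sub_of_hasDerivAt (fun t _ => hd t)
    (hc.intervalIntegrable 0 1)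
  simp only [one_smul, zero_smul, add_zero] at hint
  rw [← hint, intervalIntegral.integral_of_le zero_le_one]
  calc ‖∫ t in Set.Ioc (0 : ℝ) 1, fderiv ℝ φ (x + t • v) v‖ₑ ^ 2
      ≤ (∫⁻ t in Set.Ioc (0 : ℝ) 1, ‖v‖ₑ * ‖gradient φ (x + t • v)‖ₑ) ^ 2 := by
        gcongr
        refine (enorm_integral_le_lintegral_enorm _).trans (lintegral_mono fun t => ?_)
        exact enorm_fderiv_apply_le φ _ v
    _ ≤ volume.restrict (Set.Ioc (0 : ℝ) 1) Set.univ *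
        ∫⁻ t in Set.Ioc (0 : ℝ) 1, (‖v‖ₑ * ‖gradient φ (x + t • v)‖ₑ) ^ 2 := by
        apply lintegral_sq_le
        have : Measurable fun t : ℝ => ‖gradient φ (x + t • v)‖ₑ :=
          Continuous.measurable (by fun_prop)
        exact (this.const_mul _).aemeasurable
    _ = _ := by
        simp only [Measure.restrict_apply_univ, Real.volume_Ioc, sub_zero, ENNReal.ofReal_one,
          one_mul, mul_pow]
        rw [lintegral_const_mul']
        simp

/-- Translation by `v` of a smooth function along segments that stay in `A`. -/
lemma lintegral_sub_sq_le {φ : E d → ℝ} (hφ : ContDiff ℝ ∞ φ) {A S : Set (E d)}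
    (hA : MeasurableSet A) (hS : MeasurableSet S) (a v : E d)
    (h : ∀ x ∈ S, ∀ t ∈ Set.Icc (0 : ℝ) 1, x + a + t • v ∈ A) :
    ∫⁻ x in S, ‖φ (x + a + v) - φ (x + a)‖ₑ ^ 2 ≤
      ‖v‖ₑ ^ 2 * ∫⁻ x in A, ‖gradient φ x‖ₑ ^ 2 := by
  have hg := continuous_gradient hφ
  calc ∫⁻ x in S, ‖φ (x + a + v) - φ (x + a)‖ₑ ^ 2
      ≤ ∫⁻ x in S, ‖v‖ₑ ^ 2 * ∫⁻ t in Set.Ioc (0 : ℝ) 1, ‖gradient φ (x + a + t • v)‖ₑ ^ 2 :=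
        lintegral_mono fun x => enorm_sub_sq_le_lintegral hφ (x + a) v
    _ = ‖v‖ₑ ^ 2 * ∫⁻ t in Set.Ioc (0 : ℝ) 1, ∫⁻ x in S, ‖gradient φ (x + a + t • v)‖ₑ ^ 2 := by
        rw [lintegral_const_mul' _ _ (by simp), lintegral_lintegral_swap]
        have : Continuous fun q : E d × ℝ => ‖gradient φ (q.1 + a + q.2 • v)‖ₑ ^ 2 := by fun_prop
        exact this.measurable.aemeasurable
    _ ≤ ‖v‖ₑ ^ 2 * ∫⁻ t in Set.Ioc (0 : ℝ) 1, ∫⁻ x in A, ‖gradient φ x‖ₑ ^ 2 := by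
        gcongr ‖v‖ₑ ^ 2 * ?_
        refine setLIntegral_mono' measurableSet_Ioc fun t ht => ?_
        have ht' : t ∈ Set.Icc (0 : ℝ) 1 := ⟨ht.1.le, ht.2⟩
        -- Both integrals are extended to the whole space so that translation invariance applies;
        -- the segment condition compares the indicators.
        rw [← lintegral_indicator hA, ← lintegral_indicator hS,
          ← lintegral_add_right_eq_self (A.indicator fun x => ‖gradient φ x‖ₑ ^ 2) (a + t • v)]
        refine lintegral_mono fun x => ?_
        by_cases hx : x ∈ S
        · rw [Set.indicator_of_mem hx, Set.indicator_of_mem (by rw [← add_assoc]; exact h x hx t ht'),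
            ← add_assoc]
        · rw [Set.indicator_of_notMem hx]; exact zero_le
    _ = _ := by simp

/-- The domain `U` is locally above a Lipschitz graph, so it contains truncated cones. -/
lemma mem_of_lipschitz_graph {U : Set (E d)} {y e : E d} {r : ℝ} {K : NNReal} {γ : E d → ℝ}
    (he : ‖e‖ = 1) (hγ : LipschitzWith K γ)
    (hU : U ∩ Metric.ball y r =
        {x | x ∈ Metric.ball y r ∧ γ (x - inner ℝ e x • e) < inner ℝ e x})
    {x w : E d} {t : ℝ} (hx : x ∈ U) (hxy : x ∈ Metric.ball y r) (ht : (2 * K + 1) * ‖w‖ ≤ t)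
    (hz : x + t • e + w ∈ Metric.ball y r) : x + t • e + w ∈ U := by
  have hx' : x ∈ {x | x ∈ Metric.ball y r ∧ γ (x - inner ℝ e x • e) < inner ℝ e x} := by
    rw [← hU]; exact ⟨hx, hxy⟩
  suffices hz' : x + t • e + w ∈
      {x | x ∈ Metric.ball y r ∧ γ (x - inner ℝ e x • e) < inner ℝ e x} by
    rw [← hU] at hz'; exact hz'.1
  refine ⟨hz, ?_⟩
  have hee : inner ℝ e e = (1 : ℝ) := by rw [real_inner_self_eq_norm_sq, he]; norm_num
  have h1 : inner ℝ e (x + t • e + w) = inner ℝ e x + t + inner ℝ e w := by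
    rw [inner_add_right, inner_add_right, inner_smul_right, hee, mul_one]
  have h2 : x + t • e + w - (inner ℝ e x + t + inner ℝ e w) • e =
      (x - inner ℝ e x • e) + (w - inner ℝ e w • e) := by
    simp only [add_smul]; abel
  have hew : |inner ℝ e w| ≤ ‖w‖ := by simpa [he] using abs_real_inner_le_norm e w
  -- With this crude bound the graph rises by at most 2K‖w‖, while the height gains at least t −
  -- ‖w‖. This is the source of the slope 2K + 1.
  have h3 : ‖w - inner ℝ e w • e‖ ≤ 2 * ‖w‖ := by
    refine (norm_sub_le _ _).trans ?_
    rw [norm_smul, he, mul_one, Real.norm_eq_abs]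
    linarith
  have h4 : γ ((x - inner ℝ e x • e) + (w - inner ℝ e w • e)) ≤
      γ (x - inner ℝ e x • e) + K * (2 * ‖w‖) := by
    have h5 := hγ.dist_le_mul ((x - inner ℝ e x • e) + (w - inner ℝ e w • e))
      (x - inner ℝ e x • e)
    rw [dist_eq_norm, dist_eq_norm, add_sub_cancel_left] at h5
    have h6 : (K : ℝ) * ‖w - inner ℝ e w • e‖ ≤ K * (2 * ‖w‖) := by gcongr
    have h7 := le_abs_self (γ ((x - inner ℝ e x • e) + (w - inner ℝ e w • e)) -
      γ (x - inner ℝ e x • e))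
    rw [Real.norm_eq_abs] at h5
    linarith
  rw [h1, h2]
  have h8 := hx'.2
  have h9 := (abs_le.1 hew).1
  refine h4.trans_lt ?_
  nlinarith

/-- Translations of smooth functions on a bounded Lipschitz domain. -/
lemma exists_translation_bound {U : Set (E d)} (hUo : IsOpen U) (hUb : Bornology.IsBounded U)
    (hU : IsLipschitzDomain U) : ∃ C : NNReal, ∃ δ : ℝ, 0 < δ ∧
      ∀ φ : E d → ℝ, ContDiff ℝ ∞ φ → ∀ h : E d, ‖h‖ < δ →
        ∫⁻ x in {x | x ∈ U ∧ x + h ∈ U}, ‖φ (x + h) - φ x‖ₑ ^ 2 ≤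
          C * ‖h‖ₑ ^ 2 * ∫⁻ x in U, ‖gradient φ x‖ₑ ^ 2 := by
  suffices H : ∃ C : NNReal, ∃ δ : ℝ, 0 < δ ∧ ∀ φ : E d → ℝ, ContDiff ℝ ∞ φ → ∀ h : E d, ‖h‖ < δ →
      ∫⁻ x in {x | x ∈ closure U ∧ x ∈ U ∧ x + h ∈ U}, ‖φ (x + h) - φ x‖ₑ ^ 2 ≤
        C * ‖h‖ₑ ^ 2 * ∫⁻ x in U, ‖gradient φ x‖ₑ ^ 2 by
    obtain ⟨C, δ, hδ, H⟩ := H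
    refine ⟨C, δ, hδ, fun φ hφ h hh => (lintegral_mono_set ?_).trans (H φ hφ h hh)⟩
    exact fun x hx => ⟨subset_closure hx.1, hx⟩
  -- The estimate localised to x ∈ S is inherited by subsets and finite unions of S, so by
  -- compactness it suffices to prove it near each point of the closure.
  refine hUb.isCompact_closure.induction_on (p := fun S => ∃ C : NNReal, ∃ δ : ℝ, 0 < δ ∧
    ∀ φ : E d → ℝ, ContDiff ℝ ∞ φ → ∀ h : E d, ‖h‖ < δ →
      ∫⁻ x in {x | x ∈ S ∧ x ∈ U ∧ x + h ∈ U}, ‖φ (x + h) - φ x‖ₑ ^ 2 ≤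
        C * ‖h‖ₑ ^ 2 * ∫⁻ x in U, ‖gradient φ x‖ₑ ^ 2) ?_ ?_ ?_ ?_
  · exact ⟨0, 1, one_pos, fun φ _ h _ => by simp⟩
  · rintro S S' hSS' ⟨C, δ, hδ, H⟩
    refine ⟨C, δ, hδ, fun φ hφ h hh => (lintegral_mono_set ?_).trans (H φ hφ h hh)⟩
    exact fun x hx => ⟨hSS' hx.1, hx.2⟩
  · rintro S S' ⟨C, δ, hδ, H⟩ ⟨C', δ', hδ', H'⟩
    refine ⟨C + C', min δ δ', lt_min hδ hδ', fun φ hφ h hh => ?_⟩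
    have h1 := H φ hφ h (hh.trans_le (min_le_left _ _))
    have h2 := H' φ hφ h (hh.trans_le (min_le_right _ _))
    have h3 : {x | x ∈ S ∪ S' ∧ x ∈ U ∧ x + h ∈ U} ⊆
        {x | x ∈ S ∧ x ∈ U ∧ x + h ∈ U} ∪ {x | x ∈ S' ∧ x ∈ U ∧ x + h ∈ U} := by
      rintro x ⟨hx | hx, hx'⟩
      · exact Or.inl ⟨hx, hx'⟩
      · exact Or.inr ⟨hx, hx'⟩
    refine (lintegral_mono_set h3).trans ((lintegral_union_le _ _ _).trans
      ((add_le_add h1 h2).trans_eq ?_))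
    push_cast
    ring
  · intro y hy
    by_cases hyU : y ∈ U
    · obtain ⟨r, hr, hrU⟩ := Metric.isOpen_iff.1 hUo y hyU
      refine ⟨Metric.ball y (r / 2), mem_nhdsWithin_of_mem_nhds (Metric.ball_mem_nhds y (by positivity)), 1,
        r / 2, by positivity, fun φ hφ h hh => ?_⟩
      refine (lintegral_mono_set (t := Metric.ball y (r / 2)) fun x hx => hx.1).trans ?_
      have := lintegral_sub_sq_le hφ hUo.measurableSet
        (measurableSet_ball (x := y) (ε := r / 2)) 0 h ?_
      · simpa using this
      · intro x hx t ht
        apply hrU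
        rw [add_zero, Metric.mem_ball, dist_eq_norm]
        rw [Metric.mem_ball, dist_eq_norm] at hx
        have h1 : ‖t • h‖ ≤ ‖h‖ := by
          rw [norm_smul, Real.norm_eq_abs, abs_of_nonneg ht.1]
          exact mul_le_of_le_one_left (norm_nonneg _) ht.2
        have h2 : x + t • h - y = (x - y) + t • h := by abel
        rw [h2]
        have := norm_add_le (x - y) (t • h)
        linarith
    · obtain ⟨r, hr, e, he, K, γ, hγ, hgr⟩ := hU y ⟨hy, by rwa [hUo.interior_eq]⟩
      set L : ℝ := 2 * K + 1 with hL
      have hLpos : 0 < L := by positivity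
      -- The segment from x to x + h may leave U, so take the detour x, x + te, x + te + h, x + h
      -- with t = L‖h‖, whose legs stay in U by the cone property. The two vertical legs contribute
      -- L²‖h‖² each, the middle one ‖h‖², and squaring a sum of three terms costs a factor 3. The
      -- detour stays within (L + 1)‖h‖ < r/2 of x.
      refine ⟨Metric.ball y (r / 2), mem_nhdsWithin_of_mem_nhds (Metric.ball_mem_nhds y (by positivity)),
        3 * (2 * (2 * K + 1) ^ 2 + 1), r / 2 / (L + 1), by positivity, fun φ hφ h hh => ?_⟩
      have hh' : (L + 1) * ‖h‖ < r / 2 := by rwa [lt_div_iff₀ (by positivity), mul_comm] at hh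
      set t : ℝ := L * ‖h‖ with ht
      have ht0 : 0 ≤ t := by positivity
      have hte : ‖t • e‖ = L * ‖h‖ := by
        rw [norm_smul, he, mul_one, Real.norm_eq_abs, abs_of_nonneg ht0]
      have hS : MeasurableSet {x | x ∈ Metric.ball y (r / 2) ∧ x ∈ U ∧ x + h ∈ U} :=
        Metric.isOpen_ball.measurableSet.inter (hUo.measurableSet.inter
          ((hUo.preimage (continuous_add_const h)).measurableSet))
      have hball : ∀ x w : E d, x ∈ Metric.ball y (r / 2) → ‖w‖ ≤ (L + 1) * ‖h‖ →
          x + w ∈ Metric.ball y r := by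
        intro x w hx hw
        rw [Metric.mem_ball, dist_eq_norm] at hx ⊢
        have h2 : x + w - y = (x - y) + w := by abel
        rw [h2]
        have := norm_add_le (x - y) w
        linarith
      have hscale : ∀ (s : ℝ) (w : E d), s ∈ Set.Icc (0 : ℝ) 1 → ‖s • w‖ ≤ ‖w‖ := by
        intro s w hs
        rw [norm_smul, Real.norm_eq_abs, abs_of_nonneg hs.1]
        exact mul_le_of_le_one_left (norm_nonneg _) hs.2
      have hbase : ∀ x ∈ Metric.ball y (r / 2), x ∈ Metric.ball y r := fun x hx =>
        Metric.ball_subset_ball (by linarith) hx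
      have i1 := lintegral_sub_sq_le hφ hUo.measurableSet hS 0 (t • e) (by
        rintro x ⟨hx, hxU, -⟩ s hs
        have h0 : ‖s • t • e‖ ≤ (L + 1) * ‖h‖ := by
          have := hscale s (t • e) hs
          linarith [norm_nonneg h]
        have := mem_of_lipschitz_graph (w := 0) (t := s * t) he hγ hgr hxU (hbase x hx)
          (by simpa using mul_nonneg hs.1 ht0) (by
            rw [add_zero, mul_smul]; exact hball x _ hx h0)
        simpa [mul_smul] using this)
      have i2 := lintegral_sub_sq_le hφ hUo.measurableSet hS (t • e) h (by
        rintro x ⟨hx, hxU, -⟩ s hs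
        refine mem_of_lipschitz_graph he hγ hgr hxU (hbase x hx) ?_ ?_
        · exact mul_le_mul_of_nonneg_left (hscale s h hs) hLpos.le
        · rw [add_assoc]
          refine hball x _ hx ((norm_add_le _ _).trans ?_)
          have := hscale s h hs
          linarith)
      have i3 := lintegral_sub_sq_le hφ hUo.measurableSet hS h (t • e) (by
        rintro x ⟨hx, -, hxU⟩ s hs
        have h0 : ‖h + s • t • e‖ ≤ (L + 1) * ‖h‖ := by
          have := hscale s (t • e) hs
          have := norm_add_le h (s • t • e)
          linarith
        have := mem_of_lipschitz_graph (w := 0) (t := s * t) he hγ hgr hxU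
          (hball x h hx (by nlinarith [norm_nonneg h]))
          (by simpa using mul_nonneg hs.1 ht0) (by
            rw [add_zero, mul_smul, add_assoc]; exact hball x _ hx h0)
        simpa [mul_smul] using this)
      simp only [add_zero] at i1
      have hm : ∀ a b : E d, Measurable fun x => ‖φ (x + a) - φ (x + b)‖ₑ ^ 2 := by
        intro a b
        have := hφ.continuous
        exact Continuous.measurable (by fun_prop)
      have hte' : ‖t • e‖ₑ ^ 2 = (2 * K + 1 : NNReal) ^ 2 * ‖h‖ₑ ^ 2 := by
        rw [← mul_pow]
        congr 1
        rw [← ofReal_norm, hte, ← ofReal_norm, ENNReal.ofReal_mul hLpos.le]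
        congr 1
        rw [hL, ENNReal.ofReal, ← Real.toNNReal_coe (r := 2 * K + 1)]
        push_cast
        rfl
      calc ∫⁻ x in {x | x ∈ Metric.ball y (r / 2) ∧ x ∈ U ∧ x + h ∈ U}, ‖φ (x + h) - φ x‖ₑ ^ 2
          ≤ ∫⁻ x in {x | x ∈ Metric.ball y (r / 2) ∧ x ∈ U ∧ x + h ∈ U},
            3 * (‖φ (x + t • e) - φ x‖ₑ ^ 2 + ‖φ (x + t • e + h) - φ (x + t • e)‖ₑ ^ 2 +
              ‖φ (x + h + t • e) - φ (x + h)‖ₑ ^ 2) := by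
            refine lintegral_mono fun x => ?_
            have h1 : φ (x + h) - φ x = (φ (x + t • e) - φ x) +
                (φ (x + t • e + h) - φ (x + t • e)) - (φ (x + h + t • e) - φ (x + h)) := by
              rw [add_right_comm x h]; ring
            rw [h1]
            exact enorm_add_sub_sq_le _ _ _
        _ = 3 * ((∫⁻ x in {x | x ∈ Metric.ball y (r / 2) ∧ x ∈ U ∧ x + h ∈ U},
              ‖φ (x + t • e) - φ x‖ₑ ^ 2) +
            (∫⁻ x in {x | x ∈ Metric.ball y (r / 2) ∧ x ∈ U ∧ x + h ∈ U},
              ‖φ (x + t • e + h) - φ (x + t • e)‖ₑ ^ 2) +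
            (∫⁻ x in {x | x ∈ Metric.ball y (r / 2) ∧ x ∈ U ∧ x + h ∈ U},
              ‖φ (x + h + t • e) - φ (x + h)‖ₑ ^ 2)) := by
            have m1 := hm (t • e) 0
            have m2 := hm (t • e + h) (t • e)
            simp only [add_zero, ← add_assoc] at m1 m2
            rw [lintegral_const_mul' _ _ (by simp), lintegral_add_left, lintegral_add_left m1]
            exact m1.add m2
        _ ≤ 3 * ((‖t • e‖ₑ ^ 2 * ∫⁻ x in U, ‖gradient φ x‖ₑ ^ 2) +
            (‖h‖ₑ ^ 2 * ∫⁻ x in U, ‖gradient φ x‖ₑ ^ 2) +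
            (‖t • e‖ₑ ^ 2 * ∫⁻ x in U, ‖gradient φ x‖ₑ ^ 2)) := by gcongr
        _ = _ := by
            rw [hte']
            push_cast
            ring

/-- Bounded Lipschitz domains satisfy an interior ball condition at every scale. -/
lemma exists_ball_subset {U : Set (E d)} (hUo : IsOpen U) (hUb : Bornology.IsBounded U)
    (hU : IsLipschitzDomain U) : ∃ κ : ℝ, 0 < κ ∧ ∃ δ : ℝ, 0 < δ ∧
      ∀ x ∈ U, ∀ ρ : ℝ, 0 < ρ → ρ < δ →
        ∃ z, Metric.ball z (κ * ρ) ⊆ Metric.ball x ρ ∩ U := by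
  suffices H : ∃ κ : ℝ, 0 < κ ∧ ∃ δ : ℝ, 0 < δ ∧
      ∀ x ∈ closure U, x ∈ U → ∀ ρ : ℝ, 0 < ρ → ρ < δ →
        ∃ z, Metric.ball z (κ * ρ) ⊆ Metric.ball x ρ ∩ U by
    obtain ⟨κ, hκ, δ, hδ, H⟩ := H
    exact ⟨κ, hκ, δ, hδ, fun x hx => H x (subset_closure hx) hx⟩
  refine hUb.isCompact_closure.induction_on (p := fun S => ∃ κ : ℝ, 0 < κ ∧ ∃ δ : ℝ, 0 < δ ∧
      ∀ x ∈ S, x ∈ U → ∀ ρ : ℝ, 0 < ρ → ρ < δ →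
        ∃ z, Metric.ball z (κ * ρ) ⊆ Metric.ball x ρ ∩ U) ?_ ?_ ?_ ?_
  · exact ⟨1, one_pos, 1, one_pos, fun x hx => absurd hx (Set.notMem_empty x)⟩
  · rintro S S' hSS' ⟨κ, hκ, δ, hδ, H⟩
    exact ⟨κ, hκ, δ, hδ, fun x hx => H x (hSS' hx)⟩
  · rintro S S' ⟨κ, hκ, δ, hδ, H⟩ ⟨κ', hκ', δ', hδ', H'⟩
    refine ⟨min κ κ', lt_min hκ hκ', min δ δ', lt_min hδ hδ', fun x hx hxU ρ h0 hρ => ?_⟩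
    rcases hx with hx | hx
    · obtain ⟨z, hz⟩ := H x hx hxU ρ h0 (hρ.trans_le (min_le_left _ _))
      exact ⟨z, (Metric.ball_subset_ball (by gcongr; exact min_le_left _ _)).trans hz⟩
    · obtain ⟨z, hz⟩ := H' x hx hxU ρ h0 (hρ.trans_le (min_le_right _ _))
      exact ⟨z, (Metric.ball_subset_ball (by gcongr; exact min_le_right _ _)).trans hz⟩
  · intro y hy
    by_cases hyU : y ∈ U
    · obtain ⟨r, hr, hrU⟩ := Metric.isOpen_iff.1 hUo y hyU
      refine ⟨Metric.ball y (r / 2), mem_nhdsWithin_of_mem_nhds (Metric.ball_mem_nhds y (by positivity)), 1,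
        one_pos, r / 2, by positivity, fun x hx _ ρ h0 hρ => ⟨x, ?_⟩⟩
      rw [one_mul]
      refine Set.subset_inter subset_rfl (subset_trans (Metric.ball_subset_ball' ?_) hrU)
      have := Metric.mem_ball.1 hx
      linarith
    · obtain ⟨r, hr, e, he, K, γ, hγ, hgr⟩ := hU y ⟨hy, by rwa [hUo.interior_eq]⟩
      set L : ℝ := 2 * K + 1 with hL
      have hL1 : 1 ≤ L := by rw [hL]; linarith [K.coe_nonneg]
      have hLpos : 0 < L := by positivity
      -- Move up by ρ/2: the cone condition L‖w‖ ≤ ρ/2 leaves a ball of radius ρ/(2L), and L ≥ 1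
      -- keeps it inside the ball of radius ρ about x.
      refine ⟨Metric.ball y (r / 2), mem_nhdsWithin_of_mem_nhds (Metric.ball_mem_nhds y (by positivity)),
        1 / (2 * L), by positivity, r / 2, by positivity, fun x hx hxU ρ h0 hρ =>
          ⟨x + (ρ / 2) • e, fun z hz => ?_⟩⟩
      rw [Metric.mem_ball, dist_eq_norm] at hx hz
      set w := z - (x + (ρ / 2) • e) with hw
      have hzw : z = x + (ρ / 2) • e + w := by rw [hw]; abel
      have hw1 : L * ‖w‖ ≤ ρ / 2 := by
        calc L * ‖w‖ ≤ L * (1 / (2 * L) * ρ) := by gcongr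
          _ = ρ / 2 := by field_simp
      have hw2 : ‖w‖ < ρ / 2 := by
        refine hz.trans_le ?_
        rw [div_mul_eq_mul_div, one_mul]
        gcongr
        linarith
      have hzx : ‖z - x‖ < ρ := by
        have : z - x = (ρ / 2) • e + w := by rw [hzw]; abel
        rw [this]
        refine (norm_add_le _ _).trans_lt ?_
        rw [norm_smul, he, mul_one, Real.norm_eq_abs, abs_of_pos (by positivity)]
        linarith
      refine ⟨by rwa [Metric.mem_ball, dist_eq_norm], ?_⟩
      rw [hzw]
      refine mem_of_lipschitz_graph he hγ hgr hxU ?_ hw1 ?_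
      · rw [Metric.mem_ball, dist_eq_norm]; linarith
      · rw [← hzw, Metric.mem_ball, dist_eq_norm]
        have := norm_sub_le_norm_sub_add_norm_sub z x y
        linarith

end Translation

end SymFormConv

/-! ### The Slobodeckij seminorm in terms of translations. -/

namespace SymFormConv

section Slobodeckij

variable {d : ℕ}

lemma eLpNorm_two_sq {α F : Type*} [MeasurableSpace α] [NormedAddCommGroup F] (μ : Measure α)
    (f : α → F) : eLpNorm f 2 μ ^ 2 = ∫⁻ x, ‖f x‖ₑ ^ 2 ∂μ := by
  have h := eLpNorm_nnreal_pow_eq_lintegral (f := f) (μ := μ) (p := 2) (by norm_num)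
  have h2 : ((2 : NNReal) : ℝ) = ((2 : ℕ) : ℝ) := by norm_num
  rw [h2] at h
  simp_rw [ENNReal.rpow_natCast] at h
  exact h

/-- Substituting `y = x + h` in an integral over `A × A`. -/
lemma lintegral_lintegral_sub {A : Set (E d)} (hA : MeasurableSet A) {k : E d → ℝ≥0∞}
    (hk : Measurable k) {F : E d × E d → ℝ≥0∞} (hF : Measurable F) :
    ∫⁻ x in A, ∫⁻ y in A, k (y - x) * F (x, y) =
      ∫⁻ h, k h * ∫⁻ x in {x | x ∈ A ∧ x + h ∈ A}, F (x, x + h) := by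
  have hset : ∀ h : E d, MeasurableSet {x | x ∈ A ∧ x + h ∈ A} := fun h =>
    hA.inter (measurable_add_const h hA)
  have h1 : ∀ x, ∫⁻ y in A, k (y - x) * F (x, y) =
      ∫⁻ h, A.indicator (fun y => k (y - x) * F (x, y)) (x + h) := fun x => by
    rw [lintegral_add_left_eq_self (A.indicator fun y => k (y - x) * F (x, y)) x,
      lintegral_indicator hA]
  simp_rw [h1]
  rw [lintegral_lintegral_swap]
  · refine lintegral_congr fun h => ?_
    rw [← lintegral_const_mul _ (by fun_prop), ← lintegral_indicator hA,
      ← lintegral_indicator (hset h)]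
    refine lintegral_congr fun x => ?_
    by_cases hx : x ∈ A <;> by_cases hxh : x + h ∈ A <;> simp [Set.indicator, hx, hxh]
  · have : (Function.uncurry fun x h => A.indicator (fun y => k (y - x) * F (x, y)) (x + h)) =
        Set.indicator ((fun q : E d × E d => q.1 + q.2) ⁻¹' A)
          (fun q => k (q.1 + q.2 - q.1) * F (q.1, q.1 + q.2)) := by
      ext q
      rfl
    rw [this]
    refine (Measurable.indicator ?_ ?_).aemeasurable
    · fun_prop
    · exact (measurable_fst.add measurable_snd) hA

/-- The kernel `|h|^{-(d+2s)}`. -/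
noncomputable def sloboKernel (d : ℕ) (s : ℝ) (h : E d) : ℝ≥0∞ :=
  ENNReal.ofReal (‖h‖ ^ (-((d : ℝ) + 2 * s)))

lemma measurable_sloboKernel (s : ℝ) : Measurable (sloboKernel d s) := by
  unfold sloboKernel
  fun_prop

lemma enorm_sloboQuot_sq {s : ℝ} (hs : s ≠ 0) (f : E d → ℝ) (x y : E d) :
    ‖sloboQuot s f (x, y)‖ₑ ^ 2 = sloboKernel d s (y - x) * ‖f y - f x‖ₑ ^ 2 := by
  rw [enorm_sq_eq_ofReal, enorm_sq_eq_ofReal, sloboKernel, ← ENNReal.ofReal_mul (by positivity)]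
  congr 1
  rw [sloboQuot, if_neg hs]
  simp only
  rw [norm_sub_rev y x, div_pow, Real.rpow_neg (norm_nonneg _), div_eq_inv_mul,
    ← Real.rpow_mul_natCast (norm_nonneg _)]
  rw [show (f x - f y) ^ 2 = (f y - f x) ^ 2 by ring]
  congr 3
  push_cast
  ring

lemma eLpNorm_sloboQuot_sq {s : ℝ} (hs : s ≠ 0) {f : E d → ℝ} (hf : Measurable f) {A : Set (E d)}
    (hA : MeasurableSet A) : eLpNorm (sloboQuot s f) 2 (sqMeasure A) ^ 2 =
      ∫⁻ h, sloboKernel d s h * ∫⁻ x in {x | x ∈ A ∧ x + h ∈ A}, ‖f (x + h) - f x‖ₑ ^ 2 := by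
  have hm := measurable_sloboKernel (d := d) s
  rw [← lintegral_lintegral_sub hA hm (F := fun q => ‖f q.2 - f q.1‖ₑ ^ 2)
    (by fun_prop), eLpNorm_two_sq, lintegral_prod]
  · simp_rw [enorm_sloboQuot_sq hs]
  · have h : (fun q : E d × E d => ‖sloboQuot s f q‖ₑ ^ 2) =
        fun q => sloboKernel d s (q.2 - q.1) * ‖f q.2 - f q.1‖ₑ ^ 2 := by
      ext q; exact enorm_sloboQuot_sq hs f q.1 q.2
    rw [h]
    fun_prop

/-- Away from 0 the integrand is |h|^(−(d+2s−2)), and d + 2s − 2 < d because s < 1. -/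
lemma lintegral_sloboKernel_mul_sq_lt_top (hd : 1 ≤ d) {s : ℝ} (hs1 : s < 1) (r : ℝ) :
    ∫⁻ h in Metric.ball (0 : E d) r, sloboKernel d s h * ‖h‖ₑ ^ 2 < ⊤ := by
  have hint : IntegrableOn (fun h : E d => ‖h‖ ^ (-((d : ℝ) + 2 * s - 2)))
      (Metric.ball 0 r) volume := by
    refine integrableOn_ball_of_norm_le_rpow (by simpa using hd) (C := 1) (α := (d : ℝ) + 2 * s - 2)
      (by simp; linarith) (Eventually.of_forall fun h => ?_) ?_
    · rw [Real.norm_of_nonneg (by positivity), one_mul]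
    · exact Measurable.aestronglyMeasurable (by fun_prop)
  refine lt_of_le_of_lt (lintegral_mono fun h => ?_) hint.2
  by_cases h0 : h = 0
  · simp [h0]
  have hpos : 0 < ‖h‖ := norm_pos_iff.2 h0
  rw [sloboKernel, ← ofReal_norm, ← ENNReal.ofReal_pow (norm_nonneg _),
    ← ENNReal.ofReal_mul (by positivity), Real.enorm_of_nonneg (by positivity),
    ← Real.rpow_natCast, ← Real.rpow_add hpos]
  refine ENNReal.ofReal_le_ofReal (le_of_eq ?_)
  congr 1
  push_cast
  ring

/-- For |h| ≥ r one has |h| ≥ (r/(1+r))(1+|h|), so the kernel is dominated by a multiple of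
(1+|h|)^(−(d+2s)), which is integrable because s > 0. -/
lemma lintegral_sloboKernel_compl_lt_top {s : ℝ} (hs : 0 < s) {r : ℝ} (hr : 0 < r) :
    ∫⁻ h in (Metric.ball (0 : E d) r)ᶜ, sloboKernel d s h < ⊤ := by
  have hfin := finite_integral_one_add_norm (E := E d) (μ := volume) (r := (d : ℝ) + 2 * s)
    (by simp; linarith)
  set c : ℝ := (r / (1 + r)) ^ (-((d : ℝ) + 2 * s)) with hc
  calc ∫⁻ h in (Metric.ball (0 : E d) r)ᶜ, sloboKernel d s h
      ≤ ∫⁻ h in (Metric.ball (0 : E d) r)ᶜ,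
          ENNReal.ofReal c * ENNReal.ofReal ((1 + ‖h‖) ^ (-((d : ℝ) + 2 * s))) := by
        refine setLIntegral_mono' Metric.isOpen_ball.measurableSet.compl fun h hh => ?_
        rw [Set.mem_compl_iff, mem_ball_zero_iff, not_lt] at hh
        rw [sloboKernel, ← ENNReal.ofReal_mul (by positivity)]
        apply ENNReal.ofReal_le_ofReal
        rw [hc, ← Real.mul_rpow (by positivity) (by positivity)]
        refine Real.rpow_le_rpow_of_nonpos (by positivity) ?_ (by
          have : (0 : ℝ) ≤ d := by positivity
          linarith)
        rw [div_mul_eq_mul_div, div_le_iff₀ (by positivity)]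
        nlinarith
    _ ≤ ∫⁻ h : E d, ENNReal.ofReal c * ENNReal.ofReal ((1 + ‖h‖) ^ (-((d : ℝ) + 2 * s))) :=
        setLIntegral_le_lintegral _ _
    _ < ⊤ := by
        rw [lintegral_const_mul' _ _ ENNReal.ofReal_ne_top]
        exact ENNReal.mul_lt_top ENNReal.ofReal_lt_top hfin

end Slobodeckij

section Setting

variable {d : ℕ}

/-- The properties of a space `T` of smooth functions on which the estimates of this section
depend; functions in `T` vanish on `A \ U`. -/
structure TestSetting (T : Set (E d → ℝ)) (U : Opens (E d)) (A : Set (E d)) : Prop where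
  bounded : Bornology.IsBounded (U : Set (E d))
  smooth : T ⊆ smoothFns d
  test : testFns U ⊆ T
  add : ∀ φ ∈ T, ∀ ψ ∈ T, φ + ψ ∈ T
  smul : ∀ (c : ℝ), ∀ φ ∈ T, c • φ ∈ T
  meas : MeasurableSet A
  sub : (U : Set (E d)) ⊆ A
  vanish : ∀ φ ∈ T, ∀ x ∈ A, x ∉ U → φ x = 0
  translation : ∃ C : NNReal, ∃ δ : ℝ, 0 < δ ∧ ∀ φ ∈ T, ∀ h : E d, ‖h‖ < δ →
    ∫⁻ x in {x | x ∈ A ∧ x + h ∈ A}, ‖φ (x + h) - φ x‖ₑ ^ 2 ≤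
      C * ‖h‖ₑ ^ 2 * ∫⁻ x in (U : Set (E d)), ‖gradient φ x‖ₑ ^ 2
  ball : ∃ κ : ℝ, 0 < κ ∧ ∃ δ : ℝ, 0 < δ ∧ ∀ x ∈ U, ∀ ρ : ℝ, 0 < ρ → ρ < δ →
    ∃ z, Metric.ball z (κ * ρ) ⊆ Metric.ball x ρ ∩ A

namespace TestSetting

variable {T : Set (E d → ℝ)} {U : Opens (E d)} {A : Set (E d)} (S : TestSetting T U A)
include S

lemma continuous {φ : E d → ℝ} (hφ : φ ∈ T) : Continuous φ :=
  (show ContDiff ℝ ∞ φ from S.smooth hφ).continuous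

lemma lintegral_eq {φ : E d → ℝ} (hφ : φ ∈ T) :
    ∫⁻ x in A, ‖φ x‖ₑ ^ 2 = ∫⁻ x in (U : Set (E d)), ‖φ x‖ₑ ^ 2 := by
  rw [← lintegral_indicator S.meas, ← lintegral_indicator U.isOpen.measurableSet]
  refine lintegral_congr fun x => ?_
  by_cases hxA : x ∈ A
  · by_cases hxU : x ∈ (U : Set (E d))
    · simp [Set.indicator, hxA, hxU]
    · simp [Set.indicator, hxU, S.vanish φ hφ x hxA hxU]
  · have hxU : x ∉ (U : Set (E d)) := fun h => hxA (S.sub h)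
    simp [Set.indicator, hxA, hxU]

/-- This serves the large shifts, where the kernel itself is integrable and no gradient is needed.
-/
lemma translation_le {φ : E d → ℝ} (hφ : φ ∈ T) (h : E d) :
    ∫⁻ x in {x | x ∈ A ∧ x + h ∈ A}, ‖φ (x + h) - φ x‖ₑ ^ 2 ≤
      4 * ∫⁻ x in (U : Set (E d)), ‖φ x‖ₑ ^ 2 := by
  have hc := S.continuous hφ
  have hm : Measurable fun x => ‖φ x‖ₑ ^ 2 := Continuous.measurable (by fun_prop)
  have hm' : Measurable fun x => ‖φ (x + h)‖ₑ ^ 2 := Continuous.measurable (by fun_prop)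
  have hset : MeasurableSet {x | x ∈ A ∧ x + h ∈ A} :=
    S.meas.inter (measurable_add_const h S.meas)
  have h1 : ∫⁻ x in {x | x ∈ A ∧ x + h ∈ A}, ‖φ (x + h)‖ₑ ^ 2 ≤ ∫⁻ x in A, ‖φ x‖ₑ ^ 2 := by
    rw [← lintegral_indicator S.meas, ← lintegral_indicator hset,
      ← lintegral_add_right_eq_self (A.indicator fun x => ‖φ x‖ₑ ^ 2) h]
    refine lintegral_mono fun x => ?_
    by_cases hx : x ∈ A <;> by_cases hxh : x + h ∈ A <;> simp [Set.indicator, hx, hxh]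
  calc ∫⁻ x in {x | x ∈ A ∧ x + h ∈ A}, ‖φ (x + h) - φ x‖ₑ ^ 2
      ≤ ∫⁻ x in {x | x ∈ A ∧ x + h ∈ A}, 2 * (‖φ (x + h)‖ₑ ^ 2 + ‖φ x‖ₑ ^ 2) :=
        lintegral_mono fun x => enorm_sub_sq_le _ _
    _ = 2 * ((∫⁻ x in {x | x ∈ A ∧ x + h ∈ A}, ‖φ (x + h)‖ₑ ^ 2) +
          ∫⁻ x in {x | x ∈ A ∧ x + h ∈ A}, ‖φ x‖ₑ ^ 2) := by
        rw [lintegral_const_mul' _ _ (by simp), lintegral_add_left hm']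
    _ ≤ 2 * ((∫⁻ x in A, ‖φ x‖ₑ ^ 2) + ∫⁻ x in A, ‖φ x‖ₑ ^ 2) := by
        gcongr
        exact fun x hx => hx.1
    _ = _ := by
        rw [S.lintegral_eq hφ]
        ring

/-- The Slobodeckij seminorm of a smooth function is dominated by an arbitrarily small multiple
of the `L²` norm of its gradient and a multiple of its own `L²` norm. -/
lemma eLpNorm_sloboQuot_le (hd : 1 ≤ d) {s : ℝ} (hs0 : 0 ≤ s) (hs1 : s < 1) {ε : ℝ} (hε : 0 < ε) :
    ∃ C : ℝ, 0 ≤ C ∧ ∀ φ ∈ T, eLpNorm (sloboQuot s φ) 2 (sqMeasure A) ≤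
      ENNReal.ofReal ε * eLpNorm (gradient φ) 2 (volume.restrict (U : Set (E d))) +
        ENNReal.ofReal C * eLpNorm φ 2 (volume.restrict (U : Set (E d))) := by
  rcases hs0.eq_or_lt with rfl | hs
  · refine ⟨0, le_rfl, fun φ _ => ?_⟩
    have : sloboQuot 0 φ = fun _ : E d × E d => (0 : ℝ) := by ext q; simp [sloboQuot]
    rw [this]
    simp
  obtain ⟨K, δ, hδ, hK⟩ := S.translation
  have hfin := lintegral_sloboKernel_mul_sq_lt_top hd hs1 δ
  have hvol : Tendsto (fun r : ℝ => volume.restrict (Metric.ball (0 : E d) δ)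
      (Metric.ball 0 r)) (𝓝[>] 0) (𝓝 0) := by
    have h1 : Tendsto (fun r : ℝ => volume (Metric.ball (0 : E d) r)) (𝓝[>] 0) (𝓝 0) := by
      have h2 : ∀ᶠ r : ℝ in 𝓝[>] 0, volume (Metric.ball (0 : E d) r) =
          ENNReal.ofReal (r ^ d) * volume (Metric.ball (0 : E d) 1) := by
        filter_upwards [self_mem_nhdsWithin] with r hr
        rw [Measure.addHaar_ball_of_pos volume _ hr]
        simp
      have h3 : Tendsto (fun r : ℝ => ENNReal.ofReal (r ^ d) * volume (Metric.ball (0 : E d) 1))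
          (𝓝[>] 0) (𝓝 (ENNReal.ofReal (0 ^ d) * volume (Metric.ball (0 : E d) 1))) := by
        refine ENNReal.Tendsto.mul_const ?_ (Or.inr measure_ball_lt_top.ne)
        have : Continuous fun r : ℝ => ENNReal.ofReal (r ^ d) :=
          ENNReal.continuous_ofReal.comp (continuous_pow d)
        exact (this.tendsto 0).mono_left nhdsWithin_le_nhds
      rw [zero_pow (by omega), ENNReal.ofReal_zero, zero_mul] at h3
      exact h3.congr' (h2.mono fun r hr => hr.symm)
    exact tendsto_of_tendsto_of_tendsto_of_le_of_le tendsto_const_nhds h1 (fun _ => zero_le)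
      fun r => Measure.restrict_apply_le _ _
  -- Absolute continuity of the integral of |h|² times the kernel gives a radius r on which K times
  -- this integral is at most ε².
  have hsmall := tendsto_setLIntegral_zero hfin.ne hvol
  have hsmall' := ENNReal.Tendsto.const_mul hsmall (a := (K : ℝ≥0∞)) (Or.inr ENNReal.coe_ne_top)
  rw [mul_zero] at hsmall'
  have hε2 : (0 : ℝ≥0∞) < ENNReal.ofReal (ε ^ 2) := ENNReal.ofReal_pos.2 (by positivity)
  have hlt : ∀ᶠ r : ℝ in 𝓝[>] 0, r < δ := nhdsWithin_le_nhds (eventually_lt_nhds hδ)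
  obtain ⟨r, ⟨hr1, hr2⟩, hr0⟩ :=
    ((hsmall'.eventually_le_const hε2).and (hlt.and self_mem_nhdsWithin)).exists.imp
      fun r hr => (⟨⟨hr.1, hr.2.1⟩, hr.2.2⟩ : (_ ∧ _) ∧ _)
  rw [Measure.restrict_restrict Metric.isOpen_ball.measurableSet,
    Set.inter_eq_left.2 (Metric.ball_subset_ball hr2.le)] at hr1
  have hJ := lintegral_sloboKernel_compl_lt_top (d := d) hs hr0
  set J := ∫⁻ h in (Metric.ball (0 : E d) r)ᶜ, sloboKernel d s h with hJdef
  refine ⟨√(4 * J).toReal, by positivity, fun φ hφ => ?_⟩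
  have hsq : ENNReal.ofReal (√(4 * J).toReal) ^ 2 = 4 * J := by
    rw [← ENNReal.ofReal_pow (by positivity), Real.sq_sqrt ENNReal.toReal_nonneg,
      ENNReal.ofReal_toReal (ENNReal.mul_lt_top (by simp) hJ).ne]
  set G := ∫⁻ x in (U : Set (E d)), ‖gradient φ x‖ₑ ^ 2 with hG
  set F := ∫⁻ x in (U : Set (E d)), ‖φ x‖ₑ ^ 2 with hF
  have hkey : eLpNorm (sloboQuot s φ) 2 (sqMeasure A) ^ 2 ≤
      ENNReal.ofReal (ε ^ 2) * G + 4 * J * F := by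
    rw [eLpNorm_sloboQuot_sq hs.ne' (S.continuous hφ).measurable S.meas,
      ← lintegral_add_compl _ (Metric.isOpen_ball (x := (0 : E d)) (ε := r)).measurableSet]
    have hm := measurable_sloboKernel (d := d) s
    refine add_le_add ?_ ?_
    · calc _ ≤ ∫⁻ h in Metric.ball (0 : E d) r, sloboKernel d s h * ‖h‖ₑ ^ 2 * (K * G) := by
            refine setLIntegral_mono' Metric.isOpen_ball.measurableSet fun h hh => ?_
            rw [mul_assoc]
            gcongr
            refine (hK φ hφ h ((mem_ball_zero_iff.1 hh).trans hr2)).trans_eq ?_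
            ring
        _ = (K * ∫⁻ h in Metric.ball (0 : E d) r, sloboKernel d s h * ‖h‖ₑ ^ 2) * G := by
            rw [lintegral_mul_const _ (by fun_prop)]
            ring
        _ ≤ _ := by gcongr
    · calc _ ≤ ∫⁻ h in (Metric.ball (0 : E d) r)ᶜ, sloboKernel d s h * (4 * F) := by
            gcongr with h
            exact S.translation_le hφ h
        _ = _ := by
            rw [lintegral_mul_const _ hm]
            ring
  rw [← ENNReal.pow_le_pow_left_iff (two_ne_zero)]
  refine hkey.trans ?_
  -- After squaring, the right side exceeds the bound `hkey` exactly by the cross term, which is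
  -- dropped.
  rw [hG, hF, ← eLpNorm_two_sq, ← eLpNorm_two_sq, ENNReal.ofReal_pow hε.le, ← mul_pow, add_sq,
    mul_pow (ENNReal.ofReal √_), hsq, add_right_comm]
  exact le_self_add

end TestSetting

end Setting

end SymFormConv

/-! ### A quantitative form of Rellich's theorem for smooth functions. -/

namespace SymFormConv

section Rellich

variable {d : ℕ}

/-- A pointwise bound by the mean over `B` and the mean oscillation relative to `B`. -/
lemma enorm_sq_le_of_mean {φ : E d → ℝ} (hφ : Continuous φ) {B B' : Set (E d)}
    (hBb : Bornology.IsBounded B) (hBB' : B ⊆ B') {v : ℝ≥0∞} (hv : v ≠ 0)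
    (hvB : v ≤ volume B) (x : E d) :
    ‖φ x‖ₑ ^ 2 ≤ 2 * v⁻¹ * (∫⁻ y in B', ‖φ y - φ x‖ₑ ^ 2) +
      2 * v⁻¹ ^ 2 * ‖∫ y in B, φ y‖ₑ ^ 2 := by
  have hBtop : volume B ≠ ⊤ := hBb.measure_lt_top.ne
  have hB0 : volume B ≠ 0 := fun h => hv (le_antisymm (h ▸ hvB) zero_le)
  have : IsFiniteMeasure (volume.restrict B) := ⟨by
    rw [Measure.restrict_apply_univ]; exact hBb.measure_lt_top⟩
  have hint : IntegrableOn φ B := (hφ.locallyIntegrable.integrableOn_isCompact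
    hBb.isCompact_closure).mono_set subset_closure
  -- |B| φ(x) is the integral of φ over B minus that of φ − φ(x); Cauchy–Schwarz then treats the
  -- oscillation.
  have h1 : volume B * ‖φ x‖ₑ ≤ (∫⁻ y in B, ‖φ y - φ x‖ₑ) + ‖∫ y in B, φ y‖ₑ := by
    have h2 : volume.real B * φ x = (∫ y in B, φ y) - ∫ y in B, (φ y - φ x) := by
      rw [integral_sub hint (integrable_const _), setIntegral_const, smul_eq_mul]
      ring
    have h3 : volume B * ‖φ x‖ₑ = ‖volume.real B * φ x‖ₑ := by
      rw [enorm_mul, Real.enorm_of_nonneg measureReal_nonneg, Measure.real,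
        ENNReal.ofReal_toReal hBtop]
    rw [h3, h2, add_comm]
    exact (enorm_sub_le).trans (add_le_add le_rfl (enorm_integral_le_lintegral_enorm _))
  have h4 : (∫⁻ y in B, ‖φ y - φ x‖ₑ) ^ 2 ≤ volume B * ∫⁻ y in B', ‖φ y - φ x‖ₑ ^ 2 := by
    refine (lintegral_sq_le ?_).trans ?_
    · exact (Continuous.measurable (by fun_prop)).aemeasurable
    · rw [Measure.restrict_apply_univ]
      gcongr
  have h5 : (volume B * ‖φ x‖ₑ) ^ 2 ≤
      2 * ((volume B * ∫⁻ y in B', ‖φ y - φ x‖ₑ ^ 2) + ‖∫ y in B, φ y‖ₑ ^ 2) := by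
    refine (pow_le_pow_left₀ zero_le h1 2).trans ?_
    have h6 := ENNReal.rpow_add_le_mul_rpow_add_rpow (∫⁻ y in B, ‖φ y - φ x‖ₑ)
      ‖∫ y in B, φ y‖ₑ (p := 2) (by norm_num)
    norm_num at h6
    exact h6.trans (by gcongr)
  have hcancel : (volume B)⁻¹ * volume B = 1 := ENNReal.inv_mul_cancel hB0 hBtop
  calc ‖φ x‖ₑ ^ 2 = (volume B)⁻¹ ^ 2 * (volume B * ‖φ x‖ₑ) ^ 2 := by
        rw [← mul_pow, ← mul_assoc, hcancel, one_mul]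
    _ ≤ (volume B)⁻¹ ^ 2 *
        (2 * ((volume B * ∫⁻ y in B', ‖φ y - φ x‖ₑ ^ 2) + ‖∫ y in B, φ y‖ₑ ^ 2)) := by gcongr
    _ = 2 * (volume B)⁻¹ * ((volume B)⁻¹ * volume B) * (∫⁻ y in B', ‖φ y - φ x‖ₑ ^ 2) +
        2 * (volume B)⁻¹ ^ 2 * ‖∫ y in B, φ y‖ₑ ^ 2 := by ring
    _ ≤ _ := by
        rw [hcancel, mul_one]
        gcongr

namespace TestSetting

variable {T : Set (E d → ℝ)} {U : Opens (E d)} {A : Set (E d)} (S : TestSetting T U A)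
include S

/-- Substitute y = x + h with the indicator of |h| < r as kernel, and apply the translation bound
for each h. -/
lemma lintegral_lintegral_ball_le {φ : E d → ℝ} (hφ : φ ∈ T) {K : NNReal} {r : ℝ}
    (hK : ∀ h : E d, ‖h‖ < r → ∫⁻ x in {x | x ∈ A ∧ x + h ∈ A}, ‖φ (x + h) - φ x‖ₑ ^ 2 ≤
      K * ‖h‖ₑ ^ 2 * ∫⁻ x in (U : Set (E d)), ‖gradient φ x‖ₑ ^ 2) :
    ∫⁻ x in (U : Set (E d)), ∫⁻ y in Metric.ball x r ∩ A, ‖φ y - φ x‖ₑ ^ 2 ≤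
      volume (Metric.ball (0 : E d) r) * (K * ENNReal.ofReal r ^ 2) *
        ∫⁻ x in (U : Set (E d)), ‖gradient φ x‖ₑ ^ 2 := by
  have hc := S.continuous hφ
  set k : E d → ℝ≥0∞ := (Metric.ball (0 : E d) r).indicator 1 with hk
  have hkm : Measurable k := measurable_one.indicator Metric.isOpen_ball.measurableSet
  calc ∫⁻ x in (U : Set (E d)), ∫⁻ y in Metric.ball x r ∩ A, ‖φ y - φ x‖ₑ ^ 2
      ≤ ∫⁻ x in A, ∫⁻ y in Metric.ball x r ∩ A, ‖φ y - φ x‖ₑ ^ 2 := lintegral_mono_set S.sub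
    _ = ∫⁻ x in A, ∫⁻ y in A, k (y - x) * ‖φ y - φ x‖ₑ ^ 2 := by
        refine lintegral_congr fun x => ?_
        rw [← Measure.restrict_restrict Metric.isOpen_ball.measurableSet,
          ← lintegral_indicator Metric.isOpen_ball.measurableSet]
        refine lintegral_congr fun y => ?_
        by_cases hy : ‖y - x‖ < r
        · have h1 : y ∈ Metric.ball x r := by rwa [Metric.mem_ball, dist_eq_norm]
          have h2 : y - x ∈ Metric.ball (0 : E d) r := by rwa [mem_ball_zero_iff]
          simp only [hk, Set.indicator_of_mem h1, Set.indicator_of_mem h2, Pi.one_apply, one_mul]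
        · have h1 : y ∉ Metric.ball x r := by rwa [Metric.mem_ball, dist_eq_norm]
          have h2 : y - x ∉ Metric.ball (0 : E d) r := by rwa [mem_ball_zero_iff]
          simp only [hk, Set.indicator_of_notMem h1, Set.indicator_of_notMem h2, zero_mul]
    _ = ∫⁻ h, k h * ∫⁻ x in {x | x ∈ A ∧ x + h ∈ A}, ‖φ (x + h) - φ x‖ₑ ^ 2 :=
        lintegral_lintegral_sub S.meas hkm (F := fun q => ‖φ q.2 - φ q.1‖ₑ ^ 2)
          (Continuous.measurable (by fun_prop))
    _ ≤ ∫⁻ h, (Metric.ball (0 : E d) r).indicator (fun _ => (K * ENNReal.ofReal r ^ 2) *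
        ∫⁻ x in (U : Set (E d)), ‖gradient φ x‖ₑ ^ 2) h := by
        refine lintegral_mono fun h => ?_
        by_cases hh : h ∈ Metric.ball (0 : E d) r
        · simp only [hk, Set.indicator_of_mem hh, Pi.one_apply, one_mul]
          rw [mem_ball_zero_iff] at hh
          refine (hK h hh).trans ?_
          gcongr
          rw [← ofReal_norm]
          exact ENNReal.ofReal_le_ofReal hh.le
        · simp only [hk, Set.indicator_of_notMem hh, zero_mul, le_refl]
    _ = _ := by
        rw [lintegral_indicator Metric.isOpen_ball.measurableSet, setLIntegral_const]
        ring

/-- Up to a small multiple of the gradient norm, the `L²` norm is controlled by finitely many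
linear functionals. -/
lemma exists_finite_family {ε : ℝ} (hε : 0 < ε) :
    ∃ (n : ℕ) (ψ : Fin n → L2 U) (C : ℝ), 0 ≤ C ∧ ∀ φ ∈ T, ∀ p : L2 U × L2Vec U,
      p.1 =ᵐ[volume.restrict (U : Set (E d))] φ →
      p.2 =ᵐ[volume.restrict (U : Set (E d))] gradient φ →
      ‖p.1‖ ^ 2 ≤ ε * ‖p.2‖ ^ 2 + C * ∑ j, (inner ℝ (ψ j) p.1) ^ 2 := by
  obtain ⟨K, δ, hδ, hK⟩ := S.translation
  obtain ⟨κ, hκ, δ', hδ', hball⟩ := S.ball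
  -- The left side of the last condition is the final coefficient of the squared gradient norm:
  -- (3/κ)^d is the volume ratio of balls of radii 3ρ and κρ, and K(3ρ)² comes from translations by
  -- at most 3ρ.
  obtain ⟨ρ, hρ0, hρ1, hρ2, hρ3⟩ : ∃ ρ : ℝ, 0 < ρ ∧ 3 * ρ < δ ∧ ρ < δ' ∧
      2 * (3 / κ) ^ d * (K * (3 * ρ) ^ 2) ≤ ε := by
    have hc : Continuous fun ρ : ℝ => 2 * (3 / κ) ^ d * (K * (3 * ρ) ^ 2) := by fun_prop
    have h1 := hc.tendsto 0
    simp only [mul_zero, ne_eq, OfNat.ofNat_ne_zero, not_false_eq_true, zero_pow] at h1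
    have h2 : ∀ᶠ ρ : ℝ in 𝓝[>] 0, 2 * (3 / κ) ^ d * (K * (3 * ρ) ^ 2) ≤ ε :=
      nhdsWithin_le_nhds (h1.eventually_le_const hε)
    have h3 : ∀ᶠ ρ : ℝ in 𝓝[>] 0, ρ < min (δ / 3) δ' :=
      nhdsWithin_le_nhds (eventually_lt_nhds (by positivity))
    obtain ⟨ρ, h2, h3, h4⟩ := (h2.and (h3.and self_mem_nhdsWithin)).exists
    refine ⟨ρ, h4, ?_, h3.trans_le (min_le_right _ _), h2⟩
    have := h3.trans_le (min_le_left _ _)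
    linarith
  obtain ⟨t, -, htf, ht⟩ := Metric.totallyBounded_iff.1 
    (S.bounded.isCompact_closure.totallyBounded.subset subset_closure) ρ hρ0 |>.imp
    fun t ht => (⟨trivial, ht⟩ : True ∧ _)
  set e := htf.toFinset.equivFin with he
  set n := htf.toFinset.card
  set c : Fin n → E d := fun j => (e.symm j).1 with hcdef
  have hcov : ∀ x ∈ U, ∃ j, dist x (c j) < ρ := by
    intro x hx
    obtain ⟨y, hy, hxy⟩ := Set.mem_iUnion₂.1 (ht hx)
    exact ⟨e ⟨y, htf.mem_toFinset.2 hy⟩, by simpa [hcdef] using hxy⟩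
  -- If x is within ρ of c_j, then B_j lies in the ball of radius 3ρ about x and contains the part
  -- in A of the ball of radius ρ. So its volume is at least that of the interior ball of radius κρ.
  set B : Fin n → Set (E d) := fun j => Metric.ball (c j) (2 * ρ) ∩ A with hB
  have hBm : ∀ j, MeasurableSet (B j) := fun j => Metric.isOpen_ball.measurableSet.inter S.meas
  have hBb : ∀ j, Bornology.IsBounded (B j) := fun j =>
    Metric.isBounded_ball.subset Set.inter_subset_left
  have hUvol : volume (U : Set (E d)) < ⊤ := S.bounded.measure_lt_top
  have hBfin : ∀ j, volume.restrict (U : Set (E d)) (B j) ≠ ⊤ := fun j =>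
    ((Measure.restrict_apply_le _ _).trans_lt (hBb j).measure_lt_top).ne
  set v := volume (Metric.ball (0 : E d) (κ * ρ)) with hvdef
  have hv0 : v ≠ 0 := (Metric.measure_ball_pos volume 0 (by positivity)).ne'
  have hvtop : v ≠ ⊤ := measure_ball_lt_top.ne
  set C : ℝ≥0∞ := 2 * v⁻¹ ^ 2 * volume (U : Set (E d)) with hC
  have hCtop : C ≠ ⊤ := by
    refine ENNReal.mul_ne_top (ENNReal.mul_ne_top (by simp) ?_) hUvol.ne
    exact ENNReal.pow_ne_top (ENNReal.inv_ne_top.2 hv0)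
  refine ⟨n, fun j => indicatorConstLp 2 (hBm j) (hBfin j) (1 : ℝ), C.toReal,
    ENNReal.toReal_nonneg, fun φ hφ p hp1 hp2 => ?_⟩
  have hc := S.continuous hφ
  -- The pairing only sees B_j ∩ U, but φ vanishes on the rest of B_j because B_j ⊆ A.
  have hS : ∀ j, inner ℝ (indicatorConstLp 2 (hBm j) (hBfin j) (1 : ℝ)) p.1 =
      ∫ y in B j, φ y := by
    intro j
    rw [L2.inner_indicatorConstLp_one, Measure.restrict_restrict (hBm j),
      ← integral_indicator (hBm j), ← integral_indicator ((hBm j).inter U.isOpen.measurableSet)]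
    refine integral_congr_ae ?_
    have hp1' := (ae_restrict_iff' U.isOpen.measurableSet).1 hp1
    filter_upwards [hp1'] with x hx
    by_cases hxB : x ∈ B j
    · by_cases hxU : x ∈ (U : Set (E d))
      · simp [Set.indicator, hxB, hxU, hx hxU]
      · simp [Set.indicator, hxU, S.vanish φ hφ x hxB.2 hxU]
    · simp [Set.indicator, hxB]
  have hpt : ∀ x ∈ (U : Set (E d)), ‖φ x‖ₑ ^ 2 ≤
      2 * v⁻¹ * (∫⁻ y in Metric.ball x (3 * ρ) ∩ A, ‖φ y - φ x‖ₑ ^ 2) +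
        2 * v⁻¹ ^ 2 * ∑ j, ‖∫ y in B j, φ y‖ₑ ^ 2 := by
    intro x hx
    obtain ⟨j, hj⟩ := hcov x hx
    obtain ⟨z, hz⟩ := hball x hx ρ hρ0 hρ2
    have h1 : B j ⊆ Metric.ball x (3 * ρ) ∩ A := by
      refine Set.inter_subset_inter_left _ (Metric.ball_subset_ball' ?_)
      rw [dist_comm]
      linarith
    have h2 : v ≤ volume (B j) := by
      rw [hvdef, ← Measure.addHaar_ball_center volume z]
      refine measure_mono (hz.trans (Set.inter_subset_inter_left _ (Metric.ball_subset_ball' ?_)))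
      linarith
    refine (enorm_sq_le_of_mean hc (hBb j) h1 hv0 h2 x).trans ?_
    gcongr
    exact Finset.single_le_sum (f := fun j => ‖∫ y in B j, φ y‖ₑ ^ 2) (fun _ _ => zero_le)
      (Finset.mem_univ j)
  have hmain : ‖p.1‖ₑ ^ 2 ≤ ENNReal.ofReal ε * ‖p.2‖ₑ ^ 2 +
      C * ∑ j, ‖inner ℝ (indicatorConstLp 2 (hBm j) (hBfin j) (1 : ℝ)) p.1‖ₑ ^ 2 := by
    rw [Lp.enorm_def, Lp.enorm_def, eLpNorm_congr_ae hp1, eLpNorm_congr_ae hp2, eLpNorm_two_sq,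
      eLpNorm_two_sq]
    simp_rw [hS]
    have hcoef : 2 * v⁻¹ * (volume (Metric.ball (0 : E d) (3 * ρ)) *
        (K * ENNReal.ofReal (3 * ρ) ^ 2)) ≤ ENNReal.ofReal ε := by
      have h3 : volume (Metric.ball (0 : E d) (3 * ρ)) = ENNReal.ofReal ((3 / κ) ^ d) * v := by
        have h4 : 3 * ρ = 3 / κ * (κ * ρ) := by field_simp
        rw [h4, Measure.addHaar_ball_mul_of_pos volume _ (by positivity), finrank_euclideanSpace,
          Fintype.card_fin]
      rw [h3]
      calc 2 * v⁻¹ * (ENNReal.ofReal ((3 / κ) ^ d) * v * (K * ENNReal.ofReal (3 * ρ) ^ 2))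
          = (v⁻¹ * v) * (2 * ENNReal.ofReal ((3 / κ) ^ d) *
            (K * ENNReal.ofReal (3 * ρ) ^ 2)) := by ring
        _ = ENNReal.ofReal (2 * (3 / κ) ^ d * (K * (3 * ρ) ^ 2)) := by
            rw [ENNReal.inv_mul_cancel hv0 hvtop, one_mul,
              ENNReal.ofReal_mul (p := 2 * (3 / κ) ^ d) (by positivity),
              ENNReal.ofReal_mul (p := 2) (by positivity),
              ENNReal.ofReal_mul (p := (K : ℝ)) (by positivity),
              ENNReal.ofReal_pow (by positivity) 2, ENNReal.ofReal_coe_nnreal]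
            simp
        _ ≤ _ := ENNReal.ofReal_le_ofReal hρ3
    have hdouble := S.lintegral_lintegral_ball_le hφ (r := 3 * ρ)
      fun h hh => hK φ hφ h (hh.trans hρ1)
    calc ∫⁻ x in (U : Set (E d)), ‖φ x‖ₑ ^ 2
        ≤ ∫⁻ x in (U : Set (E d)),
          (2 * v⁻¹ * (∫⁻ y in Metric.ball x (3 * ρ) ∩ A, ‖φ y - φ x‖ₑ ^ 2) +
            2 * v⁻¹ ^ 2 * ∑ j, ‖∫ y in B j, φ y‖ₑ ^ 2) :=
          setLIntegral_mono' U.isOpen.measurableSet hpt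
      _ = 2 * v⁻¹ * (∫⁻ x in (U : Set (E d)), ∫⁻ y in Metric.ball x (3 * ρ) ∩ A,
            ‖φ y - φ x‖ₑ ^ 2) + C * ∑ j, ‖∫ y in B j, φ y‖ₑ ^ 2 := by
          rw [lintegral_add_right _ measurable_const, lintegral_const_mul' _ _
            (ENNReal.mul_ne_top (by simp) (ENNReal.inv_ne_top.2 hv0)), setLIntegral_const, hC]
          ring
      _ ≤ 2 * v⁻¹ * (volume (Metric.ball (0 : E d) (3 * ρ)) * (K * ENNReal.ofReal (3 * ρ) ^ 2) *
            ∫⁻ x in (U : Set (E d)), ‖gradient φ x‖ₑ ^ 2) +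
            C * ∑ j, ‖∫ y in B j, φ y‖ₑ ^ 2 := by gcongr
      _ = 2 * v⁻¹ * (volume (Metric.ball (0 : E d) (3 * ρ)) * (K * ENNReal.ofReal (3 * ρ) ^ 2)) *
            (∫⁻ x in (U : Set (E d)), ‖gradient φ x‖ₑ ^ 2) +
            C * ∑ j, ‖∫ y in B j, φ y‖ₑ ^ 2 := by ring
      _ ≤ _ := by gcongr
  rw [← ENNReal.ofReal_toReal hCtop] at hmain
  simp_rw [enorm_sq_eq_ofReal, ← ofReal_norm, ← ENNReal.ofReal_pow (norm_nonneg _)] at hmain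
  rw [← ENNReal.ofReal_sum_of_nonneg (fun _ _ => by positivity),
    ← ENNReal.ofReal_mul hε.le, ← ENNReal.ofReal_mul ENNReal.toReal_nonneg,
    ← ENNReal.ofReal_add (by positivity) (by positivity)] at hmain
  exact (ENNReal.ofReal_le_ofReal_iff (by positivity)).1 hmain

end TestSetting

end Rellich

end SymFormConv

/-! ### From smooth functions to their closures. -/

namespace SymFormConv

section Quotients

variable {d : ℕ} {s : ℝ} {A : Set (E d)}

lemma ae_sqMeasure {P : E d → Prop} (h : ∀ᵐ x ∂(volume.restrict A), P x) :
    ∀ᵐ q ∂(sqMeasure A), P q.1 ∧ P q.2 :=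
  (Measure.quasiMeasurePreserving_fst.ae h).and (Measure.quasiMeasurePreserving_snd.ae h)

lemma sloboQuot_congr {f g : E d → ℝ} (h : f =ᵐ[volume.restrict A] g) :
    sloboQuot s f =ᵐ[sqMeasure A] sloboQuot s g := by
  filter_upwards [ae_sqMeasure h] with q hq
  simp only [sloboQuot, hq.1, hq.2]

lemma aestronglyMeasurable_sloboQuot {f : E d → ℝ}
    (hf : AEStronglyMeasurable f (volume.restrict A)) :
    AEStronglyMeasurable (sloboQuot s f) (sqMeasure A) := by
  unfold sloboQuot
  split_ifs with hs
  · exact aestronglyMeasurable_const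
  · have h1 : AEStronglyMeasurable (fun q : E d × E d => f q.1) (sqMeasure A) := hf.comp_fst
    have h2 : AEStronglyMeasurable (fun q : E d × E d => f q.2) (sqMeasure A) := hf.comp_snd
    have h3 : Measurable fun q : E d × E d => ‖q.1 - q.2‖ ^ ((d : ℝ) / 2 + s) := by fun_prop
    exact ((h1.sub h2).aemeasurable.div h3.aemeasurable).aestronglyMeasurable

lemma sloboQuot_add (f g : E d → ℝ) : sloboQuot s (f + g) = sloboQuot s f + sloboQuot s g := by
  ext q
  simp only [sloboQuot, Pi.add_apply]
  split_ifs
  · simp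
  · ring

lemma sloboQuot_sub (f g : E d → ℝ) : sloboQuot s (f - g) = sloboQuot s f - sloboQuot s g := by
  ext q
  simp only [sloboQuot, Pi.sub_apply]
  split_ifs
  · simp
  · ring

lemma sloboQuot_smul (c : ℝ) (f : E d → ℝ) : sloboQuot s (c • f) = c • sloboQuot s f := by
  ext q
  simp only [sloboQuot, Pi.smul_apply, smul_eq_mul]
  split_ifs
  · simp
  · ring

/-- The norm of `H^s(A)` of the extension by zero of a function on `U`. -/
noncomputable def extNorm (s : ℝ) (U : Opens (E d)) (A : Set (E d)) (u : L2 U) : ℝ≥0∞ :=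
  sobNorm s A ((U : Set (E d)).indicator u)

variable {U : Opens (E d)}

lemma indicator_congr {f g : E d → ℝ} (h : f =ᵐ[volume.restrict (U : Set (E d))] g) :
    (U : Set (E d)).indicator f =ᵐ[volume.restrict A] (U : Set (E d)).indicator g := by
  apply ae_restrict_of_ae
  filter_upwards [(ae_restrict_iff' U.isOpen.measurableSet).1 h] with x hx
  by_cases hxU : x ∈ (U : Set (E d))
  · simp [hxU, hx hxU]
  · simp [hxU]

lemma aestronglyMeasurable_indicator (u : L2 U) :
    AEStronglyMeasurable ((U : Set (E d)).indicator u) (volume.restrict A) :=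
  (((aestronglyMeasurable_indicator_iff U.isOpen.measurableSet).2
    (Lp.aestronglyMeasurable u)).restrict)

lemma eLpNorm_indicator_coe (hUA : (U : Set (E d)) ⊆ A) (u : L2 U) :
    eLpNorm ((U : Set (E d)).indicator u) 2 (volume.restrict A) = ‖u‖ₑ := by
  rw [eLpNorm_indicator_eq_eLpNorm_restrict U.isOpen.measurableSet,
    Measure.restrict_restrict U.isOpen.measurableSet, Set.inter_eq_left.2 hUA, Lp.enorm_def]

lemma sobNorm_congr {f g : E d → ℝ} (h : f =ᵐ[volume.restrict A] g) :
    sobNorm s A f = sobNorm s A g := by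
  rw [sobNorm, sobNorm, eLpNorm_congr_ae h, eLpNorm_congr_ae (sloboQuot_congr h)]

lemma extNorm_smul (c : ℝ) (u : L2 U) : extNorm s U A (c • u) = ‖c‖ₑ * extNorm s U A u := by
  have h : (U : Set (E d)).indicator (c • u : L2 U) =ᵐ[volume.restrict A]
      c • (U : Set (E d)).indicator u := by
    refine (indicator_congr (Lp.coeFn_smul c u)).trans (Eventually.of_forall fun x => ?_)
    by_cases hx : x ∈ (U : Set (E d)) <;> simp [hx]
  rw [extNorm, sobNorm_congr h, sobNorm, sloboQuot_smul, eLpNorm_const_smul, eLpNorm_const_smul,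
    ← mul_add]
  rfl

lemma extNorm_add_le (u v : L2 U) :
    extNorm s U A (u + v) ≤ extNorm s U A u + extNorm s U A v := by
  have h : (U : Set (E d)).indicator (u + v : L2 U) =ᵐ[volume.restrict A]
      (U : Set (E d)).indicator u + (U : Set (E d)).indicator v := by
    refine (indicator_congr (Lp.coeFn_add u v)).trans (Eventually.of_forall fun x => ?_)
    by_cases hx : x ∈ (U : Set (E d)) <;> simp [hx]
  rw [extNorm, sobNorm_congr h, sobNorm, sloboQuot_add]
  refine (add_le_add (eLpNorm_add_le (aestronglyMeasurable_indicator u)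
    (aestronglyMeasurable_indicator v) (by norm_num))
    (eLpNorm_add_le (aestronglyMeasurable_sloboQuot (aestronglyMeasurable_indicator u))
      (aestronglyMeasurable_sloboQuot (aestronglyMeasurable_indicator v)) (by norm_num))).trans_eq ?_
  simp only [extNorm, sobNorm]
  ring

lemma extNorm_eq_zero (hUA : (U : Set (E d)) ⊆ A) (u : L2 U) (h : extNorm s U A u = 0) :
    u = 0 := by
  have h1 := (add_eq_zero.1 h).1
  rw [eLpNorm_indicator_coe hUA] at h1
  simpa using h1

end Quotients

namespace TestSetting

variable {d : ℕ} {T : Set (E d → ℝ)} {U : Opens (E d)} {A : Set (E d)}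
  (S : TestSetting T U A)
include S

lemma differentiable {φ : E d → ℝ} (hφ : φ ∈ T) : Differentiable ℝ φ :=
  (show ContDiff ℝ ∞ φ from S.smooth hφ).differentiable (by simp)

/-- `H1Graph T U` is the closure of the set of pairs `(φ, ∇φ)`. -/
lemma mem_closure_of_mem_H1Graph {p : L2 U × L2Vec U} (hp : p ∈ H1Graph T U) :
    p ∈ closure {p : L2 U × L2Vec U | ∃ φ ∈ T, p.1 =ᵐ[volume.restrict (U : Set (E d))] φ ∧
      p.2 =ᵐ[volume.restrict (U : Set (E d))] gradient φ} := by
  let G : Submodule ℝ (L2 U × L2Vec U) :=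
    { carrier := {p | ∃ φ ∈ T, p.1 =ᵐ[volume.restrict (U : Set (E d))] φ ∧
        p.2 =ᵐ[volume.restrict (U : Set (E d))] gradient φ}
      zero_mem' := by
        have h0 : (0 : E d → ℝ) ∈ testFns U :=
          ⟨contDiff_const, HasCompactSupport.zero, by
            rw [show (0 : E d → ℝ) = fun _ => 0 from rfl, tsupport]; simp⟩
        refine ⟨0, S.test h0, Lp.coeFn_zero _ _ _, ?_⟩
        filter_upwards [Lp.coeFn_zero (E d) 2 (volume.restrict (U : Set (E d)))] with x hx
        have h1 : gradient (0 : E d → ℝ) x = 0 := by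
          rw [gradient, show (0 : E d → ℝ) = fun _ => 0 from rfl]; simp
        rw [h1]
        exact hx
      add_mem' := by
        rintro p q ⟨φ, hφ, h1, h2⟩ ⟨ψ, hψ, h3, h4⟩
        refine ⟨φ + ψ, S.add φ hφ ψ hψ, ?_, ?_⟩
        · filter_upwards [Lp.coeFn_add p.1 q.1, h1, h3] with x h5 h6 h7
          rw [Prod.fst_add, h5, Pi.add_apply, h6, h7, Pi.add_apply]
        · filter_upwards [Lp.coeFn_add p.2 q.2, h2, h4] with x h5 h6 h7
          rw [Prod.snd_add, h5, Pi.add_apply, h6, h7, gradient, gradient, gradient,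
            fderiv_add (S.differentiable hφ x) (S.differentiable hψ x), map_add]
      smul_mem' := by
        rintro c p ⟨φ, hφ, h1, h2⟩
        refine ⟨c • φ, S.smul c φ hφ, ?_, ?_⟩
        · filter_upwards [Lp.coeFn_smul c p.1, h1] with x h5 h6
          rw [Prod.smul_fst, h5, Pi.smul_apply, h6, Pi.smul_apply]
        · filter_upwards [Lp.coeFn_smul c p.2, h2] with x h5 h6
          rw [Prod.smul_snd, h5, Pi.smul_apply, h6, gradient, gradient,
            fderiv_const_smul (S.differentiable hφ x)]
          simp }
  have h1 : Submodule.span ℝ {p : L2 U × L2Vec U | ∃ φ ∈ T,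
      p.1 =ᵐ[volume.restrict (U : Set (E d))] φ ∧
      p.2 =ᵐ[volume.restrict (U : Set (E d))] gradient φ} = G := Submodule.span_eq G
  rw [H1Graph, h1] at hp
  exact hp

/-- Approximation of the elements of `H1Graph T U` in `L²` and almost everywhere. -/
lemma exists_seq {p : L2 U × L2Vec U} (hp : p ∈ H1Graph T U) :
    ∃ (φ : ℕ → E d → ℝ) (q : ℕ → L2 U × L2Vec U), (∀ k, φ k ∈ T) ∧
      (∀ k, (q k).1 =ᵐ[volume.restrict (U : Set (E d))] φ k) ∧
      (∀ k, (q k).2 =ᵐ[volume.restrict (U : Set (E d))] gradient (φ k)) ∧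
      Tendsto q atTop (𝓝 p) ∧
      ∀ᵐ x ∂(volume.restrict A),
        Tendsto (fun k => φ k x) atTop (𝓝 ((U : Set (E d)).indicator p.1 x)) := by
  obtain ⟨q, hq, hqp⟩ := mem_closure_iff_seq_limit.1 (S.mem_closure_of_mem_H1Graph hp)
  choose φ hφ h1 h2 using hq
  have hq1 : Tendsto (fun k => (q k).1) atTop (𝓝 p.1) := (continuous_fst.tendsto p).comp hqp
  obtain ⟨ns, hns, hae⟩ := (tendstoInMeasure_of_tendsto_Lp hq1).exists_seq_tendsto_ae
  refine ⟨fun k => φ (ns k), fun k => q (ns k), fun k => hφ _, fun k => h1 _, fun k => h2 _,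
    hqp.comp hns.tendsto_atTop, ?_⟩
  rw [ae_restrict_iff' S.meas]
  filter_upwards [(ae_restrict_iff' U.isOpen.measurableSet).1 hae,
    (ae_restrict_iff' U.isOpen.measurableSet).1 (ae_all_iff.2 h1)] with x h3 h4 hxA
  by_cases hx : x ∈ (U : Set (E d))
  · rw [Set.indicator_of_mem hx]
    exact (h3 hx).congr fun k => h4 hx (ns k)
  · rw [Set.indicator_of_notMem hx]
    simp [fun k => S.vanish (φ (ns k)) (hφ _) x hxA hx]

/-- Fatou's lemma: along an approximating sequence of smooth functions that converges almost
everywhere on A, the quotients converge almost everywhere on A × A. -/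
lemma exists_sloboQuot_bound (hd : 1 ≤ d) {s : ℝ} (hs0 : 0 ≤ s) (hs1 : s < 1) {ε : ℝ}
    (hε : 0 < ε) : ∃ C : ℝ, 0 ≤ C ∧ ∀ p ∈ H1Graph T U,
      eLpNorm (sloboQuot s ((U : Set (E d)).indicator p.1)) 2 (sqMeasure A) ≤
        ENNReal.ofReal (ε * ‖p.2‖ + C * ‖p.1‖) := by
  obtain ⟨C, hC0, hC⟩ := S.eLpNorm_sloboQuot_le hd hs0 hs1 hε
  refine ⟨C, hC0, fun p hp => ?_⟩
  obtain ⟨φ, q, hφ, h1, h2, hqp, hae⟩ := S.exists_seq hp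
  have hlim : ∀ᵐ z ∂(sqMeasure A), Tendsto (fun k => sloboQuot s (φ k) z) atTop
      (𝓝 (sloboQuot s ((U : Set (E d)).indicator p.1) z)) := by
    filter_upwards [ae_sqMeasure hae] with z hz
    unfold sloboQuot
    split_ifs
    · exact tendsto_const_nhds
    · exact (hz.1.sub hz.2).div_const _
  have hmeas : ∀ k, AEStronglyMeasurable (sloboQuot s (φ k)) (sqMeasure A) := fun k =>
    aestronglyMeasurable_sloboQuot (S.continuous (hφ k)).aestronglyMeasurable
  refine (Lp.eLpNorm_lim_le_liminf_eLpNorm hmeas _ hlim).trans ?_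
  have hb : ∀ k, eLpNorm (sloboQuot s (φ k)) 2 (sqMeasure A) ≤
      ENNReal.ofReal (ε * ‖(q k).2‖ + C * ‖(q k).1‖) := by
    intro k
    refine (hC (φ k) (hφ k)).trans (le_of_eq ?_)
    rw [← eLpNorm_congr_ae (h1 k), ← eLpNorm_congr_ae (h2 k), ← Lp.enorm_def, ← Lp.enorm_def,
      ENNReal.ofReal_add (by positivity) (by positivity), ENNReal.ofReal_mul hε.le,
      ENNReal.ofReal_mul hC0, ofReal_norm, ofReal_norm]
  have hlim2 : Tendsto (fun k => ENNReal.ofReal (ε * ‖(q k).2‖ + C * ‖(q k).1‖)) atTop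
      (𝓝 (ENNReal.ofReal (ε * ‖p.2‖ + C * ‖p.1‖))) := by
    have : Continuous fun p : L2 U × L2Vec U => ENNReal.ofReal (ε * ‖p.2‖ + C * ‖p.1‖) :=
      ENNReal.continuous_ofReal.comp (by fun_prop)
    exact (this.tendsto p).comp hqp
  exact (liminf_le_liminf (Eventually.of_forall hb)).trans_eq hlim2.liminf_eq

/-- This contains the inclusion of H¹ in H^s. The bound for the quotient, applied to q_k − p, shows
that the quotients of smooth approximants converge in L²(A × A), so the limit pair lies in the
closure. -/
lemma mem_HsGraph (hd : 1 ≤ d) {s : ℝ} (hs0 : 0 ≤ s) (hs1 : s < 1) {p : L2 U × L2Vec U}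
    (hp : p ∈ H1Graph T U) : p.1 ∈ (HsGraph s T U A).map (LinearMap.fst ℝ _ _) := by
  obtain ⟨C, hC0, hC⟩ := S.exists_sloboQuot_bound hd hs0 hs1 one_pos
  obtain ⟨φ, q, hφ, h1, h2, hqp, -⟩ := S.exists_seq hp
  have hq : ∀ k, q k ∈ H1Graph T U := fun k =>
    Submodule.le_topologicalClosure _ (Submodule.subset_span ⟨φ k, hφ k, h1 k, h2 k⟩)
  have hφq : ∀ k, (U : Set (E d)).indicator (q k).1 =ᵐ[volume.restrict A] φ k := by
    intro k
    refine (indicator_congr (h1 k)).trans ((ae_restrict_iff' S.meas).2 (Eventually.of_forall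
      fun x hxA => ?_))
    by_cases hx : x ∈ (U : Set (E d))
    · simp [hx]
    · simp [hx, S.vanish (φ k) (hφ k) x hxA hx]
  have hmem : ∀ r ∈ H1Graph T U,
      MemLp (sloboQuot s ((U : Set (E d)).indicator r.1)) 2 (sqMeasure A) := fun r hr =>
    ⟨aestronglyMeasurable_sloboQuot (aestronglyMeasurable_indicator r.1),
      (hC r hr).trans_lt ENNReal.ofReal_lt_top⟩
  refine Submodule.mem_map.2 ⟨(p.1, (hmem p hp).toLp _), ?_, rfl⟩
  refine mem_closure_of_tendsto (b := atTop)
    (f := fun k => ((q k).1, (hmem (q k) (hq k)).toLp _)) ?_ (Eventually.of_forall fun k => ?_)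
  · refine ((continuous_fst.tendsto p).comp hqp).prodMk_nhds ?_
    rw [Lp.tendsto_Lp_iff_tendsto_eLpNorm'']
    have hlim : Tendsto (fun k => ENNReal.ofReal (1 * ‖(q k - p).2‖ + C * ‖(q k - p).1‖)) atTop
        (𝓝 0) := by
      have hc : Continuous fun r : L2 U × L2Vec U =>
          ENNReal.ofReal (1 * ‖(r - p).2‖ + C * ‖(r - p).1‖) :=
        ENNReal.continuous_ofReal.comp (by fun_prop)
      simpa [Function.comp_def] using (hc.tendsto p).comp hqp
    refine tendsto_of_tendsto_of_tendsto_of_le_of_le tendsto_const_nhds hlim (fun _ => zero_le)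
      fun k => ?_
    refine le_trans (le_of_eq ?_) (hC (q k - p) (sub_mem (hq k) hp))
    rw [← sloboQuot_sub]
    refine eLpNorm_congr_ae (sloboQuot_congr ?_)
    refine EventuallyEq.symm ((indicator_congr (Lp.coeFn_sub (q k).1 p.1)).trans
      (Eventually.of_forall fun x => ?_))
    by_cases hx : x ∈ (U : Set (E d)) <;> simp [hx]
  · refine Submodule.subset_span ⟨φ k, hφ k, h1 k, ?_⟩
    exact (hmem (q k) (hq k)).coeFn_toLp.trans (sloboQuot_congr (hφq k))

/-- By `exists_finite_family`, extended to the closure by continuity, the distance of two members is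
controlled by a small multiple of their gradients and by finitely many functionals. A finite net for
the image in ℝⁿ therefore lifts to a finite net in L². -/
lemma totallyBounded (R : ℝ) :
    TotallyBounded {u : L2 U | ∃ p ∈ H1Graph T U, p.1 = u ∧ ‖p.1‖ ≤ R ∧ ‖p.2‖ ≤ R} := by
  rw [Metric.totallyBounded_iff]
  intro ε hε
  -- Gradients of differences have norm at most 2R, so the gradient term is at most ε²/4; `η` below
  -- makes the functionals contribute at most ε²/4 as well.
  obtain ⟨n, ψ, C, hC0, hC⟩ := S.exists_finite_family
    (ε := ε ^ 2 / (4 * (4 * R ^ 2 + 1))) (by positivity)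
  have hall : ∀ p ∈ H1Graph T U, ‖p.1‖ ^ 2 ≤
      ε ^ 2 / (4 * (4 * R ^ 2 + 1)) * ‖p.2‖ ^ 2 + C * ∑ j, (inner ℝ (ψ j) p.1) ^ 2 := by
    intro p hp
    have hcl : IsClosed {p : L2 U × L2Vec U | ‖p.1‖ ^ 2 ≤
        ε ^ 2 / (4 * (4 * R ^ 2 + 1)) * ‖p.2‖ ^ 2 + C * ∑ j, (inner ℝ (ψ j) p.1) ^ 2} := by
      refine isClosed_le (by fun_prop) (by fun_prop)
    refine closure_minimal ?_ hcl (S.mem_closure_of_mem_H1Graph hp)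
    rintro p ⟨φ, hφ, h1, h2⟩
    exact hC φ hφ p h1 h2
  set B := {u : L2 U | ∃ p ∈ H1Graph T U, p.1 = u ∧ ‖p.1‖ ≤ R ∧ ‖p.2‖ ≤ R} with hB
  let L : L2 U → Fin n → ℝ := fun u j => inner ℝ (ψ j) u
  have hbdd : Bornology.IsBounded (L '' B) := by
    rw [isBounded_iff_forall_norm_le]
    refine ⟨∑ j, ‖ψ j‖ * |R|, ?_⟩
    rintro _ ⟨u, ⟨p, -, rfl, hp1, -⟩, rfl⟩
    rw [pi_norm_le_iff_of_nonneg (by positivity)]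
    intro j
    refine (norm_inner_le_norm _ _).trans ?_
    refine le_trans ?_ (Finset.single_le_sum (f := fun j => ‖ψ j‖ * |R|)
      (fun _ _ => by positivity) (Finset.mem_univ j))
    have := hp1.trans (le_abs_self R)
    gcongr
  set η : ℝ := √(ε ^ 2 / (4 * (C * n + 1))) with hη
  have hη0 : 0 < η := by positivity
  have hη2 : η ^ 2 = ε ^ 2 / (4 * (C * n + 1)) := Real.sq_sqrt (by positivity)
  obtain ⟨t, htB, htf, ht⟩ := (hbdd.isCompact_closure.totallyBounded.subset
    subset_closure).exists_subset (Metric.dist_mem_uniformity hη0)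
  obtain ⟨t', ht'B, ht'f, rfl⟩ := Set.exists_subset_image_finite_and.1 ⟨t, htB, htf, rfl⟩
  refine ⟨t', ht'f, fun u hu => ?_⟩
  obtain ⟨y, hy, hyu⟩ := Set.mem_iUnion₂.1 (ht ⟨u, hu, rfl⟩)
  obtain ⟨w, hw, rfl⟩ := hy
  refine Set.mem_iUnion₂.2 ⟨w, hw, ?_⟩
  obtain ⟨p, hp, rfl, -, hp2⟩ := hu
  obtain ⟨p', hp', rfl, -, hp2'⟩ := ht'B hw
  have hdist : dist (L p.1) (L p'.1) < η := hyu
  have hkey := hall (p - p') (sub_mem hp hp')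
  have h1 : ∀ j, (inner ℝ (ψ j) (p - p').1) ^ 2 ≤ η ^ 2 := by
    intro j
    have h2 : inner ℝ (ψ j) (p - p').1 = L p.1 j - L p'.1 j := by
      simp only [L, Prod.fst_sub, inner_sub_right]
    rw [h2, ← sq_abs, ← Real.dist_eq]
    have := (dist_le_pi_dist (L p.1) (L p'.1) j).trans hdist.le
    gcongr
  have h3 : ∑ j, (inner ℝ (ψ j) (p - p').1) ^ 2 ≤ n * η ^ 2 := by
    refine (Finset.sum_le_card_nsmul _ _ _ fun j _ => h1 j).trans_eq ?_
    simp
  have h4 : ‖(p - p').2‖ ^ 2 ≤ 4 * R ^ 2 := by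
    have h5 : ‖(p - p').2‖ ≤ 2 * R := by
      refine (norm_sub_le _ _).trans ?_
      linarith
    nlinarith [norm_nonneg (p - p').2]
  rw [Metric.mem_ball, dist_eq_norm]
  refine lt_of_pow_lt_pow_left₀ 2 hε.le ?_
  calc ‖p.1 - p'.1‖ ^ 2 ≤ _ := hkey
    _ ≤ ε ^ 2 / (4 * (4 * R ^ 2 + 1)) * (4 * R ^ 2 + 1) + C * (n * η ^ 2) := by
        gcongr
        linarith
    _ ≤ ε ^ 2 / 4 + (C * n + 1) * η ^ 2 := by
        have h6 : ε ^ 2 / (4 * (4 * R ^ 2 + 1)) * (4 * R ^ 2 + 1) = ε ^ 2 / 4 := by field_simp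
        rw [h6]
        nlinarith [sq_nonneg η]
    _ = ε ^ 2 / 2 := by
        rw [hη2]
        field_simp
        ring
    _ < ε ^ 2 := half_lt_self (by positivity)

/-- The domain contains the test functions, and an L² function orthogonal to all of them vanishes
almost everywhere. -/
lemma dense_domain : Dense ((gradOp T U).domain : Set (L2 U)) := by
  rw [Submodule.dense_iff_topologicalClosure_eq_top, Submodule.topologicalClosure_eq_top_iff,
    Submodule.eq_bot_iff]
  intro u hu
  have hloc : LocallyIntegrableOn u (U : Set (E d)) volume := by
    rw [locallyIntegrableOn_iff U.isOpen.isLocallyClosed]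
    intro k hk hkc
    have h : MemLp u 2 (volume.restrict k) :=
      (Lp.memLp u).mono_measure (Measure.restrict_mono hk le_rfl)
    have : IsFiniteMeasure (volume.restrict k) :=
      ⟨by rw [Measure.restrict_apply_univ]; exact hkc.measure_lt_top⟩
    exact h.integrable (by norm_num)
  rw [Lp.eq_zero_iff_ae_eq_zero]
  refine (ae_restrict_iff' U.isOpen.measurableSet).2
    (U.isOpen.ae_eq_zero_of_integral_contDiff_smul_eq_zero hloc ?_)
  intro ψ h1 h2 h3
  have hψ : MemLp ψ 2 (volume.restrict (U : Set (E d))) :=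
    h1.continuous.memLp_of_hasCompactSupport h2
  have hgc : HasCompactSupport (gradient ψ) :=
    (h2.fderiv (𝕜 := ℝ)).comp_left (map_zero (InnerProductSpace.toDual ℝ (E d)).symm)
  have hg : MemLp (gradient ψ) 2 (volume.restrict (U : Set (E d))) :=
    (continuous_gradient h1).memLp_of_hasCompactSupport hgc
  have hmem : (hψ.toLp, hg.toLp) ∈ H1Graph T U :=
    Submodule.le_topologicalClosure _ (Submodule.subset_span
      ⟨ψ, S.test ⟨h1, h2, h3⟩, hψ.coeFn_toLp, hg.coeFn_toLp⟩)
  have h0 := (Submodule.mem_orthogonal _ _).1 hu _ (mem_domain_of_mem_H1Graph hmem)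
  rw [← setIntegral_eq_integral_of_forall_compl_eq_zero (s := (U : Set (E d)))]
  · rw [← h0, L2.inner_def]
    apply integral_congr_ae
    filter_upwards [hψ.coeFn_toLp] with x hx
    rw [hx]
    simp [mul_comm]
  · intro x hx
    have : ψ x = 0 := by
      by_contra hne
      exact hx (h3 (subset_tsupport _ hne))
    simp [this]

/-- The estimates for smooth functions provide everything that compact convergence depends on. -/
theorem formSetting (hd : 1 ≤ d) {s : ℝ} (hs0 : 0 ≤ s) (hs1 : s < 1) :
    FormSetting T U ((HsGraph s T U A).map (LinearMap.fst ℝ _ _)) (extNorm s U A) where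
  smooth := S.smooth
  smul := extNorm_smul
  add_le := extNorm_add_le
  eq_zero := extNorm_eq_zero S.sub
  mem _ hp := S.mem_HsGraph hd hs0 hs1 hp
  interp ε hε := by
    obtain ⟨C, hC0, hC⟩ := S.exists_sloboQuot_bound hd hs0 hs1 hε
    -- The extra 1 is the L² part of the norm.
    refine ⟨C + 1, by positivity, fun p hp => ?_⟩
    rw [extNorm, sobNorm, eLpNorm_indicator_coe S.sub]
    refine (add_le_add le_rfl (hC p hp)).trans_eq ?_
    rw [← ofReal_norm, ← ENNReal.ofReal_add (by positivity) (by positivity)]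
    congr 1
    ring
  totallyBounded := S.totallyBounded
  dense := S.dense_domain

end TestSetting

end SymFormConv

/-! ### The Dirichlet and Neumann cases and the theorem. -/

namespace SymFormConv

variable {d : ℕ} {U : Opens (E d)}

lemma testFns_eq_zero {φ : E d → ℝ} (hφ : φ ∈ testFns U) {x : E d} (hx : x ∉ U) : φ x = 0 :=
  image_eq_zero_of_notMem_tsupport fun h => hx (hφ.2.2 h)

/-- Test functions, extended by zero to the whole space. -/
theorem testSetting_testFns (hU : Bornology.IsBounded (U : Set (E d))) :
    TestSetting (testFns U) U Set.univ where
  bounded := hU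
  smooth _ h := h.1
  test := subset_rfl
  add φ hφ ψ hψ := ⟨hφ.1.add hψ.1, hφ.2.1.add hψ.2.1,
    (tsupport_add φ ψ).trans (Set.union_subset hφ.2.2 hψ.2.2)⟩
  smul c φ hφ := ⟨contDiff_const.smul hφ.1, hφ.2.1.smul_left (f := fun _ => c),
    (tsupport_smul_subset_right (fun _ => c) φ).trans hφ.2.2⟩
  meas := MeasurableSet.univ
  sub := Set.subset_univ _
  vanish _ hφ _ _ hx := testFns_eq_zero hφ hx
  translation := by
    -- In the whole space no segment can leave the domain, so the constant is 1 and the radius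
    -- arbitrary.
    refine ⟨1, 1, one_pos, fun φ hφ h _ => ?_⟩
    have h1 := lintegral_sub_sq_le hφ.1 MeasurableSet.univ MeasurableSet.univ 0 h
      fun _ _ _ _ => Set.mem_univ _
    have h2 : ∫⁻ x, ‖gradient φ x‖ₑ ^ 2 = ∫⁻ x in (U : Set (E d)), ‖gradient φ x‖ₑ ^ 2 := by
      refine (setLIntegral_eq_of_support_subset fun x hx => ?_).symm
      by_contra hxU
      have h3 : fderiv ℝ φ x = 0 := by
        by_contra hne
        exact hxU (hφ.2.2 (support_fderiv_subset ℝ hne))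
      have h4 : gradient φ x = 0 := by rw [gradient, h3, map_zero]
      exact hx (by simp [h4])
    simpa [h2] using h1
  ball := ⟨1, one_pos, 1, one_pos, fun x _ ρ _ _ => ⟨x, by simp⟩⟩

/-- Smooth functions on a bounded Lipschitz domain. -/
theorem testSetting_smoothFns (hU : Bornology.IsBounded (U : Set (E d)))
    (hL : IsLipschitzDomain (U : Set (E d))) : TestSetting (smoothFns d) U (U : Set (E d)) where
  bounded := hU
  smooth := subset_rfl
  test _ h := h.1
  add φ (hφ : ContDiff ℝ ∞ φ) ψ (hψ : ContDiff ℝ ∞ ψ) := hφ.add hψ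
  smul _ φ (hφ : ContDiff ℝ ∞ φ) := contDiff_const.smul hφ
  meas := U.isOpen.measurableSet
  sub := subset_rfl
  vanish _ _ _ hx hx' := absurd hx hx'
  translation := exists_translation_bound U.isOpen hU hL
  ball := exists_ball_subset U.isOpen hU hL

/-- Extension by zero does not change a function on U up to null sets. For `Hs0Norm` the
corresponding identity with A the whole space holds by definition. -/
lemma HsNorm_eq_extNorm (s : ℝ) (U : Opens (E d)) :
    HsNorm s U = extNorm s U (U : Set (E d)) :=
  funext fun _ => sobNorm_congr (indicator_ae_eq_restrict U.isOpen.measurableSet).symm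

end SymFormConv

theorem mainTheorem10 {d : ℕ} (hd : 2 ≤ d)
    (U : TopologicalSpace.Opens (SymFormConv.E d))
    (hU : Bornology.IsBounded (U : Set (SymFormConv.E d)))
    (s : ℝ) (hs0 : 0 ≤ s) (hs1 : s < 1)
    (Wn : ℕ → SymFormConv.E d → ℝ) (W : SymFormConv.E d → ℝ)
    (hWn : ∀ n, ContinuousOn (Wn n) (closure (U : Set (SymFormConv.E d))))
    (hW : ContinuousOn W (closure (U : Set (SymFormConv.E d))))
    (hWconv : TendstoUniformlyOn Wn W atTop (closure (U : Set (SymFormConv.E d)))) :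
    (SymFormConv.H10 U ≤ SymFormConv.Hs0 s U ∧
      ∀ (Zn : ℕ → SymFormConv.BoundedSymmForm (SymFormConv.Hs0 s U) (SymFormConv.Hs0Norm s U))
        (Z : SymFormConv.BoundedSymmForm (SymFormConv.Hs0 s U) (SymFormConv.Hs0Norm s U)),
        Tendsto (fun n => SymFormConv.formNorm (SymFormConv.Hs0Norm s U)
          ((Zn n).bilin - Z.bilin)) atTop (𝓝 0) →
        SymFormConv.ConvergesCompactly
          (fun n => SymFormConv.dirichletForm (Wn n)
            (SymFormConv.memLp_top_of_continuousOn hU (hWn n)) (Zn n))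
          (SymFormConv.dirichletForm W (SymFormConv.memLp_top_of_continuousOn hU hW) Z)) ∧
    (SymFormConv.IsLipschitzDomain (U : Set (SymFormConv.E d)) →
      SymFormConv.H1 U ≤ SymFormConv.Hs s U ∧
      ∀ (Zn : ℕ → SymFormConv.BoundedSymmForm (SymFormConv.Hs s U) (SymFormConv.HsNorm s U))
        (Z : SymFormConv.BoundedSymmForm (SymFormConv.Hs s U) (SymFormConv.HsNorm s U)),
        Tendsto (fun n => SymFormConv.formNorm (SymFormConv.HsNorm s U)
          ((Zn n).bilin - Z.bilin)) atTop (𝓝 0) →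
        SymFormConv.ConvergesCompactly
          (fun n => SymFormConv.neumannForm (Wn n)
            (SymFormConv.memLp_top_of_continuousOn hU (hWn n)) (Zn n))
          (SymFormConv.neumannForm W (SymFormConv.memLp_top_of_continuousOn hU hW) Z)) := by
  obtain ⟨R, -, hR, hRn⟩ := SymFormConv.exists_uniform_bound hU.isCompact_closure hWn hW hWconv
  have hRU : ∀ x ∈ U, |W x| ≤ R := fun x hx => hR x (subset_closure hx)
  have hRnU : ∀ n, ∀ x ∈ U, |Wn n x| ≤ R := fun n x hx => hRn n x (subset_closure hx)
  have hconv := hWconv.mono (subset_closure (s := (U : Set (SymFormConv.E d))))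
  have hd1 : 1 ≤ d := by omega
  refine ⟨?_, fun hL => ?_⟩
  · have S : SymFormConv.FormSetting (SymFormConv.testFns U) U (SymFormConv.Hs0 s U)
        (SymFormConv.Hs0Norm s U) :=
      (SymFormConv.testSetting_testFns hU).formSetting hd1 hs0 hs1
    refine ⟨fun u hu => ?_, fun Zn Z hZ => S.convergesCompactly _ _ hRnU hRU hconv Zn Z hZ⟩
    obtain ⟨p, hp, rfl⟩ := Submodule.mem_map.1 hu
    exact S.mem p hp
  · have S : SymFormConv.FormSetting (SymFormConv.smoothFns d) U (SymFormConv.Hs s U)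
        (SymFormConv.HsNorm s U) := by
      rw [SymFormConv.HsNorm_eq_extNorm]
      exact (SymFormConv.testSetting_smoothFns hU hL).formSetting hd1 hs0 hs1
    refine ⟨fun u hu => ?_, fun Zn Z hZ => S.convergesCompactly _ _ hRnU hRU hconv Zn Z hZ⟩
    obtain ⟨p, hp, rfl⟩ := Submodule.mem_map.1 hu
    exact S.mem p hp
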